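/- Fix $a_{\max},\lambda_{\max},\varrho^*_{\min},\varrho^*_{\max}>0$. Let $\xi$ be the càdlàg Ornstein–Uhlenbeck process $$d\xi_t=a\,\xi_t\,dt+\varrho_1\,dw_t+\varrho_2\,dz_t,\qquad \xi_0=0,\qquad z_t=\sum_{j=1}^{N_t}Y_j ,$$ where $w$ is a standard Brownian motion, $N$ is a homogeneous Poisson process of intensity $\lambda$ (with $N\equiv0$ if $\lambda=0$), $(Y_j)_{j\ge1}$ is i.i.d. with $\mathbf E Y_j=0$, $\mathbf E Y_j^2=1$, $\mathbf E Y_j^4<\infty$, the three are mutually independent, and $$-a_{\max}\le a\le 0,\qquad 0\le\lambda\le\lambda_{\max},\qquad \varrho^*_{\min}\le\varrho^*\le\varrho^*_{\max},\qquad \varrho^*:=\varrho_1^2+\lambda\varrho_2^2 .$$ Let $Q$ be the law of $\xi$. For $n\ge1$ an integer let $y_t=\int_0^tS(s)\,ds+\xi_t$, $0\le t\le n$, with $S:\mathbb R\to\mathbb R$ $1$-periodic and in $L_2[0,1]$. Let $(\phi_j)_{j\ge1}$ be the trigonometric basis: $\phi_1=1$ and, for $j\ge2$, $\phi_j(x)=\sqrt2\cos(2\pi[j/2]x)$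 for even $j$, $\phi_j(x)=\sqrt2\sin(2\pi[j/2]x)$ for odd $j$. Put $\hat\theta_{j,n}=\frac1n\int_0^n\phi_j\,dy$ and $\xi_{j,n}=\frac1{\sqrt n}\int_0^n\phi_j\,d\xi$. For a real sequence $x=(x_j)_{j\ge1}$ put $|x|^2=\sum_jx_j^2$ and let $\#(x)$ be the number of its nonzero terms. Then: (i) (Condition C1 with $\varsigma_Q=\varrho^*$.) $\varrho^*>0$ and, for every $n\ge1$, $$\sup_{x\in[-1,1]^{\infty},\ \#(x)\le n}\Big|\sum_{j\ge1}x_j\big(\mathbf E_Q\xi_{j,n}^2-\varrho^*\big)\Big|<\infty .$$ (ii) (Condition C2.) For every $n\ge1$, $$\sup_{|x|\le1,\ \#(x)\le n}\mathbf E_Q\Big(\sum_{j\ge1}x_j\big(\xi_{j,n}^2-\mathbf E_Q\xi_{j,n}^2\big)\Big)^2<\infty .$$ (iii) (Sharp oracle inequality.) Let $n\ge1$, $0<\rho<1/3$, and let $\Gamma$ be a finite nonempty set of weight sequences $\gamma=(\gamma(j))_{j\ge1}$ with $0\le\gamma(j)\le1$ and $0<\#(\gamma)\le n$; put $\nu=\mathrm{card}(\Gamma)$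 and $\mu=\max_{\gamma\in\Gamma}\#(\gamma)$. Let $\hat\sigma_n$ be any estimator (a real random variable measurable with respect to $\sigma\{y_t,0\le t\le n\}$). Put $\hat S_\gamma=\sum_j\gamma(j)\hat\theta_{j,n}\phi_j$, $$J_n(\gamma)=\sum_j\gamma^2(j)\hat\theta_{j,n}^2-2\sum_j\gamma(j)\Big(\hat\theta_{j,n}^2-\frac{\hat\sigma_n}{n}\Big)+\rho\,\frac{\hat\sigma_n|\gamma|^2}{n},$$ and $\hat S_*=\hat S_{\hat\gamma}$, where $\hat\gamma$ is any (measurable with respect to the observations) minimizer of $J_n$ over $\Gamma$. With $\mathcal R_Q(\hat S,S)=\mathbf E_{Q,S}\int_0^1(\hat S(t)-S(t))^2dt$, $$\mathcal R_Q(\hat S_*,S)\le\frac{1+3\rho-2\rho^2}{1-3\rho}\,\min_{\gamma\in\Gamma}\mathcal R_Q(\hat S_\gamma,S)+\frac1n\Big(\Psi_Q(n,\rho)+\frac{6\mu\,\mathbf E_{Q,S}|\hat\sigma_n-\varrho^*|}{1-3\rho}\Big),$$ (the right-hand side being $+\infty$ if $\hat\sigma_n$ is not integrable), where $$\Psi_Q(n,\rho)=\frac{6\varrho^*_{\max}\nu+4\varrho^*_{\max}L_1^*+56\,\nu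 M^*}{\varrho^*_{\min}\,\rho(1-3\rho)},\qquad L_1^*=2\big(1+a_{\max}(a_{\max}+1)\big)\varrho^*_{\max},$$ $$M^*=4\varrho_1^2+\varrho_2^2D_1^*+80\lambda_2+12D_2^*+21\varrho_3,\qquad \lambda_2=\varrho_1^2\varrho^*+\lambda\varrho_2^2,$$ $$D_1^*=4\lambda\varrho_1^2+7\lambda^2\varrho_2^2,\qquad D_2^*=4\varrho_1^2\varrho^*+\varrho_2^2D_1^*+23\lambda_2,\qquad \varrho_3=\lambda\varrho_2^4\,\mathbf E Y_1^4 .$$ -/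

import Mathlib

open MeasureTheory ProbabilityTheory Filter
open scoped NNReal ENNReal Topology

namespace OURegression

noncomputable section

/-! ### The noise process -/

/-- Right-continuous with left limits on `[0, ∞)`. -/
def IsCadlag (f : ℝ≥0 → ℝ) : Prop :=
  ∀ t, ContinuousWithinAt f (Set.Ici t) t ∧ ∃ l, Tendsto f (𝓝[<] t) (𝓝 l)

/-- `N` is a homogeneous Poisson process of intensity `lam` (identically `0` if `lam = 0`). -/
structure IsPoissonProcess {Ω : Type*} [MeasurableSpace Ω] (P : Measure Ω) (lam : ℝ≥0)
    (N : ℝ≥0 → Ω → ℕ) : Prop where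
  measurable : ∀ t, Measurable (N t)
  zero : ∀ᵐ ω ∂P, N 0 ω = 0
  indep_increments : HasIndepIncrements (fun t ω => (N t ω : ℝ)) P
  law_increments : ∀ s t : ℝ≥0, s ≤ t →
    HasLaw (fun ω => N t ω - N s ω) (poissonMeasure (lam * (t - s))) P
  monotone : ∀ᵐ ω ∂P, Monotone (fun t => N t ω)
  right_continuous : ∀ᵐ ω ∂P, ∀ t, ContinuousWithinAt (fun s => N s ω) (Set.Ici t) t

/-- Jump sizes: an i.i.d. sequence, centred, of variance one, with a finite fourth moment.
`Y j` is the size of the jump number `j + 1`. -/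
structure IsJumpSequence {Ω : Type*} [MeasurableSpace Ω] (P : Measure Ω)
    (Y : ℕ → Ω → ℝ) : Prop where
  measurable : ∀ j, Measurable (Y j)
  indep : iIndepFun Y P
  identDistrib : ∀ j, IdentDistrib (Y j) (Y 0) P P
  mean : ∀ j, ∫ ω, Y j ω ∂P = 0
  second_moment : ∀ j, ∫ ω, Y j ω ^ 2 ∂P = 1
  fourth_moment : ∀ j, Integrable (fun ω => Y j ω ^ 4) P

/-- The compound Poisson process `z_t = ∑_{j = 1}^{N_t} Y_j`. -/
def compoundPoisson {Ω : Type*} (N : ℝ≥0 → Ω → ℕ) (Y : ℕ → Ω → ℝ) (t : ℝ≥0) (ω : Ω) : ℝ :=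
  ∑ j ∈ Finset.range (N t ω), Y j ω

/-- The driving Lévy process `u = r₁ w + r₂ z`. -/
def drivingProcess {Ω : Type*} (r₁ r₂ : ℝ) (w : ℝ≥0 → Ω → ℝ) (N : ℝ≥0 → Ω → ℕ)
    (Y : ℕ → Ω → ℝ) (t : ℝ≥0) (ω : Ω) : ℝ :=
  r₁ * w t ω + r₂ * compoundPoisson N Y t ω

/-- `ξ` is the non-Gaussian Ornstein–Uhlenbeck process `dξ = a ξ dt + du`, `ξ_0 = 0`, where
`u = r₁ w + r₂ z`, `w` is a standard Brownian motion, `z` is the compound Poisson process of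
intensity `lam` with jump sizes `Y`, and `w`, `N`, `Y` are mutually independent. -/
structure IsOUNoise {Ω : Type*} [MeasurableSpace Ω] (P : Measure Ω) (a : ℝ) (lam : ℝ≥0)
    (r₁ r₂ : ℝ) (w : ℝ≥0 → Ω → ℝ) (N : ℝ≥0 → Ω → ℕ) (Y : ℕ → Ω → ℝ)
    (ξ : ℝ≥0 → Ω → ℝ) : Prop where
  brownian_measurable : ∀ t, Measurable (w t)
  brownian : IsBrownianReal w P
  poisson : IsPoissonProcess P lam N
  jumps : IsJumpSequence P Y
  indep_brownian : IndepFun (fun ω t => w t ω) (fun ω => (fun t => N t ω, fun j => Y j ω)) P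
  indep_poisson : IndepFun (fun ω t => N t ω) (fun ω j => Y j ω) P
  measurable : ∀ t, Measurable (ξ t)
  cadlag : ∀ᵐ ω ∂P, IsCadlag (fun t => ξ t ω)
  equation : ∀ᵐ ω ∂P, ∀ t : ℝ≥0,
    ξ t ω = a * (∫ s in (0 : ℝ)..t, ξ s.toNNReal ω) + drivingProcess r₁ r₂ w N Y t ω

/-! ### The observations and the stochastic integral -/

/-- The observed process `y_t = ∫_0^t S(s) ds + ξ_t`. -/
def observed {Ω : Type*} (S : ℝ → ℝ) (ξ : ℝ≥0 → Ω → ℝ) (t : ℝ≥0) (ω : Ω) : ℝ :=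
  (∫ s in (0 : ℝ)..t, S s) + ξ t ω

/-- The σ-algebra `σ{y_t, 0 ≤ t ≤ n}`; estimators are the functions measurable for it. -/
abbrev observationSigma {Ω : Type*} (y : ℝ≥0 → Ω → ℝ) (n : ℕ) : MeasurableSpace Ω :=
  ⨆ t : Set.Iic (n : ℝ≥0), MeasurableSpace.comap (y t) inferInstance

/-- The integral `∫_0^n f(t) dy_t` of a smooth deterministic function `f` against a càdlàg path
`y`, as the limit of the left-point Riemann sums over the uniform partitions of `[0, n]`.
The limit exists for every continuously differentiable `f` and every càdlàg path `y`, and for a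
semimartingale `y` it is the (Itô) stochastic integral. -/
def pathIntegral (f : ℝ → ℝ) (y : ℝ≥0 → ℝ) (n : ℕ) : ℝ :=
  limUnder atTop fun m : ℕ => ∑ i ∈ Finset.range m,
    f (n * i / m) * (y ((n : ℝ≥0) * (i + 1) / m) - y ((n : ℝ≥0) * i / m))

/-! ### Model selection -/

/-- The trigonometric basis: `φ_1 = 1`, and for `j ≥ 2`, `φ_j(x) = √2 cos(2π[j/2]x)` if `j` is
even, `φ_j(x) = √2 sin(2π[j/2]x)` if `j` is odd. -/
def trigBasis (j : ℕ+) (x : ℝ) : ℝ :=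
  if j = 1 then 1
  else if Even (j : ℕ) then √2 * Real.cos (2 * Real.pi * (((j : ℕ) / 2 : ℕ) : ℝ) * x)
  else √2 * Real.sin (2 * Real.pi * (((j : ℕ) / 2 : ℕ) : ℝ) * x)

/-- The estimated Fourier coefficient `(1/n) ∫_0^n φ_j dy`. -/
def thetaHat (n : ℕ) (y : ℝ≥0 → ℝ) (j : ℕ+) : ℝ :=
  (1 / n) * pathIntegral (trigBasis j) y n

/-- `ξ_{j,n} = n^{-1/2} ∫_0^n φ_j dξ`. -/
def xiCoeff {Ω : Type*} (n : ℕ) (ξ : ℝ≥0 → Ω → ℝ) (j : ℕ+) (ω : Ω) : ℝ :=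
  (1 / √n) * pathIntegral (trigBasis j) (fun t => ξ t ω) n

/-- `#(x)`, the number of nonzero terms of the sequence `x`. -/
def numNonzero (x : ℕ+ → ℝ) : ℕ∞ := Set.encard {j | 0 < |x j|}

/-- Weight sequences: `0 ≤ γ(j) ≤ 1` and `0 < #(γ) ≤ n`. -/
def IsWeight (n : ℕ) (γ : ℕ+ → ℝ) : Prop :=
  (∀ j, 0 ≤ γ j ∧ γ j ≤ 1) ∧ 0 < numNonzero γ ∧ numNonzero γ ≤ n

/-- `μ = max_{γ ∈ Γ} #(γ)`. -/
def maxNonzero (Γ : Finset (ℕ+ → ℝ)) : ℕ := (Γ.sup numNonzero).toNat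

/-- The weighted least squares estimate `Ŝ_γ = ∑_j γ(j) θ̂_{j,n} φ_j`, from the path `y`. -/
def weightedLSE (n : ℕ) (y : ℝ≥0 → ℝ) (γ : ℕ+ → ℝ) (x : ℝ) : ℝ :=
  ∑' j, γ j * thetaHat n y j * trigBasis j x

/-- The cost function
`J_n(γ) = ∑ γ²(j) θ̂_j² - 2 ∑ γ(j) (θ̂_j² - σ̂/n) + ρ σ̂ |γ|² / n`. -/
def cost (n : ℕ) (ρ : ℝ) (y : ℝ≥0 → ℝ) (sigmaHat : ℝ) (γ : ℕ+ → ℝ) : ℝ :=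
  (∑' j, γ j ^ 2 * thetaHat n y j ^ 2)
    - 2 * (∑' j, γ j * (thetaHat n y j ^ 2 - sigmaHat / n))
    + ρ * (sigmaHat * (∑' j, γ j ^ 2) / n)

/-- `gammaHat` selects, from the observations of `y` on `[0, n]`, a minimizer over `Γ` of the cost
function that is built with the variance estimator `sigmaHat`. -/
structure IsModelSelection {Ω : Type*} (n : ℕ) (ρ : ℝ) (y : ℝ≥0 → Ω → ℝ) (sigmaHat : Ω → ℝ)
    (Γ : Finset (ℕ+ → ℝ)) (gammaHat : Ω → ℕ+ → ℝ) : Prop where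
  measurable : Measurable[observationSigma y n] gammaHat
  mem : ∀ ω, gammaHat ω ∈ Γ
  minimizes : ∀ ω, ∀ γ ∈ Γ,
    cost n ρ (fun t => y t ω) (sigmaHat ω) (gammaHat ω) ≤ cost n ρ (fun t => y t ω) (sigmaHat ω) γ

/-- The quadratic risk `E ‖Ŝ - S‖²`, with the norm of `L₂[0,1]`. -/
def risk {Ω : Type*} [MeasurableSpace Ω] (P : Measure Ω) (Shat : Ω → ℝ → ℝ) (S : ℝ → ℝ) : ℝ≥0∞ :=
  ∫⁻ ω, (∫⁻ x in Set.Icc (0 : ℝ) 1, ENNReal.ofReal ((Shat ω x - S x) ^ 2)) ∂P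

/-! ### The conditions on the noise -/

/-- `L_{1,n} = sup |∑_j x_j (E ξ²_{j,n} - ς)|` over `x ∈ [-1,1]^∞` with `#(x) ≤ n`. -/
def L1 {Ω : Type*} [MeasurableSpace Ω] (P : Measure Ω) (ξ : ℝ≥0 → Ω → ℝ) (vs : ℝ) (n : ℕ) :
    ℝ≥0∞ :=
  ⨆ x ∈ {x : ℕ+ → ℝ | (∀ j, x j ∈ Set.Icc (-1 : ℝ) 1) ∧ numNonzero x ≤ n},
    ENNReal.ofReal |∑' j, x j * ((∫ ω, xiCoeff n ξ j ω ^ 2 ∂P) - vs)|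

/-- `L_{2,n} = sup E (∑_j x_j (ξ²_{j,n} - E ξ²_{j,n}))²` over `|x| ≤ 1` with `#(x) ≤ n`. -/
def L2 {Ω : Type*} [MeasurableSpace Ω] (P : Measure Ω) (ξ : ℝ≥0 → Ω → ℝ) (n : ℕ) : ℝ≥0∞ :=
  ⨆ x ∈ {x : ℕ+ → ℝ | (∑' j, x j ^ 2) ≤ 1 ∧ numNonzero x ≤ n},
    ∫⁻ ω, ENNReal.ofReal
      ((∑' j, x j * (xiCoeff n ξ j ω ^ 2 - ∫ ω', xiCoeff n ξ j ω' ^ 2 ∂P)) ^ 2) ∂P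

/-- Condition C1 with the constant `ς = vs`. -/
def ConditionC1 {Ω : Type*} [MeasurableSpace Ω] (P : Measure Ω) (ξ : ℝ≥0 → Ω → ℝ) (vs : ℝ) :
    Prop :=
  0 < vs ∧ ∀ n : ℕ, 1 ≤ n → L1 P ξ vs n < ∞

/-- Condition C2. -/
def ConditionC2 {Ω : Type*} [MeasurableSpace Ω] (P : Measure Ω) (ξ : ℝ≥0 → Ω → ℝ) : Prop :=
  ∀ n : ℕ, 1 ≤ n → L2 P ξ n < ∞

/-! ### The constants -/

/-- `ϱ* = ϱ₁² + λ ϱ₂²`. -/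
def rhoStar (lam r₁ r₂ : ℝ) : ℝ := r₁ ^ 2 + lam * r₂ ^ 2

/-- `λ₂ = ϱ₁² ϱ* + λ ϱ₂²`. -/
def lambda2 (lam r₁ r₂ : ℝ) : ℝ := r₁ ^ 2 * rhoStar lam r₁ r₂ + lam * r₂ ^ 2

/-- `D₁* = 4 λ ϱ₁² + 7 λ² ϱ₂²`. -/
def D1star (lam r₁ r₂ : ℝ) : ℝ := 4 * lam * r₁ ^ 2 + 7 * lam ^ 2 * r₂ ^ 2

/-- `D₂* = 4 ϱ₁² ϱ* + ϱ₂² D₁* + 23 λ₂`. -/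
def D2star (lam r₁ r₂ : ℝ) : ℝ :=
  4 * r₁ ^ 2 * rhoStar lam r₁ r₂ + r₂ ^ 2 * D1star lam r₁ r₂ + 23 * lambda2 lam r₁ r₂

/-- `M* = 4 ϱ₁² + ϱ₂² D₁* + 80 λ₂ + 12 D₂* + 21 ϱ₃` with `ϱ₃ = λ ϱ₂⁴ E Y₁⁴`; the argument `m₄` is
the fourth moment `E Y₁⁴`. -/
def Mstar (lam r₁ r₂ m₄ : ℝ) : ℝ :=
  4 * r₁ ^ 2 + r₂ ^ 2 * D1star lam r₁ r₂ + 80 * lambda2 lam r₁ r₂ + 12 * D2star lam r₁ r₂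
    + 21 * (lam * r₂ ^ 4 * m₄)

/-- `L₁* = 2 (1 + a_max (a_max + 1)) ϱ*_max`. -/
def L1star (amax rmax : ℝ) : ℝ := 2 * (1 + amax * (amax + 1)) * rmax

/-- `Ψ = (6 ϱ*_max ν + 4 ϱ*_max L₁* + 56 ν M*) / (ϱ*_min ρ (1 - 3ρ))`. -/
def Psi (amax rmin rmax : ℝ) (ν : ℕ) (M ρ : ℝ) : ℝ :=
  (6 * rmax * ν + 4 * rmax * L1star amax rmax + 56 * ν * M) / (rmin * ρ * (1 - 3 * ρ))

/-- `B = Ψ + 6 μ E|σ̂ - ς| / (1 - 3ρ)`; it is `∞` if `σ̂` is not integrable. -/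
def remainderB {Ω : Type*} [MeasurableSpace Ω] (P : Measure Ω) (psi : ℝ) (μ : ℕ)
    (sigmaHat : Ω → ℝ) (vs ρ : ℝ) : ℝ≥0∞ :=
  ENNReal.ofReal psi
    + ENNReal.ofReal (6 * μ / (1 - 3 * ρ)) * ∫⁻ ω, ENNReal.ofReal |sigmaHat ω - vs| ∂P

end

end OURegression

/-! The argument is an L² computation on Riemann sums; no stochastic calculus enters. The process ξ
is a linear filter of the Lévy process u = ϱ₁w + ϱ₂z, so ∫_0^n f dξ = ∫_0^n g du with g(s) = f(s) +
a k(s) and k(s) = ∫_s^n e^{a(t-s)} f(t) dt (`exists_tendsto_riemannSum_ou`); pathwise, both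
integrals are limits of Riemann sums. On a uniform grid of mesh δ the increments of u are
independent and centred, with variance ϱ*δ and fourth moment at most κδ + Cδ²
(`IsOUNoise.increments`). Weighted sums of squared Riemann sums are therefore quadratic forms in
independent variables, and a form with matrix A has variance at most 2v²‖A‖² + κ'∑A_ii², where v and
κ' bound the moments of the variables (`integral_quadForm_sq_le`). Fatou's lemma carries this to the
limit: E ξ_{j,n}² = ϱ* G_jj and Var(∑ x_j ξ_{j,n}²) ≤ (2ϱ*² + 64κ)|x|² for at most n nonzero x_j,
where G is the Gram matrix of the filtered, normalized basis.

The properties of G come from a ≤ 0. The energy identity ∫f² = ∫g² + a²∫k² - a k(0)² makes the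
filter an L²-contraction, so 0 ≤ G_jj ≤ 1 and the rows of G have norm at most 1; with a uniform
bound on the filtered basis this gives C1 and C2. A nonconstant φ_j has a primitive of size O(1/j),
so 1 - G_jj = O(1/j²), and the total deficit ∑(1 - G_jj) is bounded uniformly in n
(`sum_one_sub_filteredGram_le`).

For the oracle inequality write θ̂_j = θ_j + e_j with e_j = ξ_{j,n}/√n. Up to a constant, the loss
is the cost plus noise terms linear and quadratic in e (`loss_eq`). When the selected γ is compared
with a fixed γ₀, each noise term M is absorbed by 2M ≤ ρQ + M²/(ρQ). For the linear terms Q = ∑(γ -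
γ₀)²θ², which the two losses control up to a second linear noise term; this comparison produces 1 -
3ρ (`oracle_pathwise`). The ratios M²/Q at the random γ are dominated by their sum over Γ, which
produces the factor ν, and each has a bounded expectation (`oracle_expectation`). It remains to
check that the constants obtained lie below Ψ (`remainder_le_Psi`). -/

namespace OURegression

/-! ### Quadratic forms in independent variables -/

section QuadraticForm

variable {Ω : Type*} [MeasurableSpace Ω] {P : Measure Ω}

lemma MemLp.integrable_pow_four {X : Ω → ℝ} (h : MemLp X 4 P) :
    Integrable (fun ω => X ω ^ 4) P := by
  have := h.integrable_norm_pow (p := 4) (by norm_num)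
  simpa [Even.pow_abs (show Even 4 by decide)] using this

lemma memLp_mul_of_four {X Y : Ω → ℝ} (hX : MemLp X 4 P) (hY : MemLp Y 4 P) :
    MemLp (fun ω => X ω * Y ω) 2 P := by
  have : ENNReal.HolderTriple 4 4 2 := by
    constructor
    rw [← ENNReal.toReal_eq_toReal_iff' (by simp) (by simp)]
    rw [ENNReal.toReal_add (by simp) (by simp)]
    simp [ENNReal.toReal_inv]; norm_num
  exact hY.mul' hX

/-- The initial segment of an independent sequence is independent of the next variable. -/
lemma iIndepFun.indepFun_initial {X : ℕ → Ω → ℝ} (hm : ∀ i, Measurable (X i))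
    (hind : iIndepFun X P) (m : ℕ) :
    IndepFun (fun ω (i : Finset.range m) => X i ω) (X m) P := by
  have h := hind.indepFun_finset (Finset.range m) {m} (by simp) hm
  exact h.comp (φ := id) (ψ := fun z : (({m} : Finset ℕ) → ℝ) => z ⟨m, Finset.mem_singleton_self m⟩)
    measurable_id (measurable_pi_apply _)

lemma sum_range_succ_sq_form (A : ℕ → ℕ → ℝ) (hA : ∀ i k, A i k = A k i) (x : ℕ → ℝ) (m : ℕ) :
    ∑ i ∈ Finset.range (m + 1), ∑ k ∈ Finset.range (m + 1), A i k * (x i * x k)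
      = (∑ i ∈ Finset.range m, ∑ k ∈ Finset.range m, A i k * (x i * x k))
        + 2 * (x m * ∑ i ∈ Finset.range m, A i m * x i) + A m m * x m ^ 2 := by
  rw [Finset.sum_range_succ, Finset.sum_range_succ (fun k => A m k * (x m * x k))]
  simp_rw [Finset.sum_range_succ (fun k => A _ k * (x _ * x k)) m, Finset.sum_add_distrib]
  have h1 : ∑ i ∈ Finset.range m, A i m * (x i * x m) = x m * ∑ i ∈ Finset.range m, A i m * x i := by
    rw [Finset.mul_sum]; exact Finset.sum_congr rfl fun i _ => by ring
  have h2 : ∑ i ∈ Finset.range m, A m i * (x m * x i) = x m * ∑ i ∈ Finset.range m, A i m * x i := by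
    rw [Finset.mul_sum]; exact Finset.sum_congr rfl fun i _ => by rw [hA m i]; ring
  rw [h1, h2]; ring

lemma integral_indep_linear_sq {X : ℕ → Ω → ℝ} (hm : ∀ i, Measurable (X i))
    (hind : iIndepFun X P) (h2 : ∀ i, MemLp (X i) 2 P) (h0 : ∀ i, ∫ ω, X i ω ∂P = 0)
    {v : ℝ} (hv : ∀ i, ∫ ω, X i ω ^ 2 ∂P = v) (b : ℕ → ℝ) (m : ℕ) :
    ∫ ω, (∑ i ∈ Finset.range m, b i * X i ω) ^ 2 ∂P = v * ∑ i ∈ Finset.range m, b i ^ 2 := by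
  have hij : ∀ i k, ∫ ω, (b i * X i ω) * (b k * X k ω) ∂P = if i = k then v * b i ^ 2 else 0 := by
    intro i k
    have : (fun ω => (b i * X i ω) * (b k * X k ω)) = fun ω => (b i * b k) * (X i ω * X k ω) := by
      ext; ring
    rw [this, integral_const_mul]
    split_ifs with h
    · subst h
      simp_rw [← pow_two]; rw [hv]; ring
    · rw [(hind.indepFun h).integral_fun_mul_eq_mul_integral (hm i).aestronglyMeasurable
        (hm k).aestronglyMeasurable, h0 i]; ring
  have hint : ∀ i k, Integrable (fun ω => (b i * X i ω) * (b k * X k ω)) P := fun i k =>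
    ((h2 i).const_mul _).integrable_mul ((h2 k).const_mul _)
  simp_rw [pow_two, Finset.sum_mul_sum]
  rw [integral_finsetSum _ fun i _ => integrable_finsetSum _ fun k _ => hint i k]
  simp_rw [integral_finsetSum _ fun k _ => hint _ k, hij]
  rw [Finset.mul_sum]
  refine Finset.sum_congr rfl fun i hi => ?_
  simp only [Finset.sum_ite_eq, hi, if_true]; ring

/-- The variance of a quadratic form in independent centred variables. -/
theorem integral_quadForm_sq_le [IsProbabilityMeasure P] {X : ℕ → Ω → ℝ} (hm : ∀ i, Measurable (X i))
    (hind : iIndepFun X P) (h4 : ∀ i, MemLp (X i) 4 P) (h0 : ∀ i, ∫ ω, X i ω ∂P = 0)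
    {v κ : ℝ} (hv : ∀ i, ∫ ω, X i ω ^ 2 ∂P = v) (hκ : ∀ i, ∫ ω, X i ω ^ 4 ∂P ≤ κ)
    (A : ℕ → ℕ → ℝ) (hA : ∀ i k, A i k = A k i) (m : ℕ) :
    MemLp (fun ω => (∑ i ∈ Finset.range m, ∑ k ∈ Finset.range m, A i k * (X i ω * X k ω))
        - v * ∑ i ∈ Finset.range m, A i i) 2 P ∧
    ∫ ω, ((∑ i ∈ Finset.range m, ∑ k ∈ Finset.range m, A i k * (X i ω * X k ω))
        - v * ∑ i ∈ Finset.range m, A i i) ∂P = 0 ∧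
    ∫ ω, ((∑ i ∈ Finset.range m, ∑ k ∈ Finset.range m, A i k * (X i ω * X k ω))
        - v * ∑ i ∈ Finset.range m, A i i) ^ 2 ∂P
      ≤ 2 * v ^ 2 * (∑ i ∈ Finset.range m, ∑ k ∈ Finset.range m, A i k ^ 2)
        + κ * ∑ i ∈ Finset.range m, A i i ^ 2 := by
  have h2 : ∀ i, MemLp (X i) 2 P := fun i => (h4 i).mono_exponent (by norm_num)
  have hQ : ∀ m, MemLp (fun ω => (∑ i ∈ Finset.range m, ∑ k ∈ Finset.range m,
      A i k * (X i ω * X k ω)) - v * ∑ i ∈ Finset.range m, A i i) 2 P := fun m =>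
    (memLp_finsetSum _ fun i _ => memLp_finsetSum _ fun k _ =>
      (memLp_mul_of_four (h4 i) (h4 k)).const_mul _).sub (memLp_const _)
  refine ⟨hQ m, ?_⟩
  induction m with
  | zero => simp
  | succ m ih =>
    obtain ⟨ih0, ih⟩ := ih
    set Q : Ω → ℝ := fun ω => (∑ i ∈ Finset.range m, ∑ k ∈ Finset.range m, A i k * (X i ω * X k ω))
        - v * ∑ i ∈ Finset.range m, A i i with hQdef
    set L : Ω → ℝ := fun ω => ∑ i ∈ Finset.range m, A i m * X i ω with hLdef
    set α := A m m
    -- Adding the variable X_m changes the centred form by a martingale-type increment: a part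
    -- linear in X_m with coefficient L from the past, and the centred square of X_m.
    have hQ' : ∀ ω, (∑ i ∈ Finset.range (m + 1), ∑ k ∈ Finset.range (m + 1),
        A i k * (X i ω * X k ω)) - v * ∑ i ∈ Finset.range (m + 1), A i i
        = Q ω + 2 * (X m ω * L ω) + α * (X m ω ^ 2 - v) := by
      intro ω
      rw [sum_range_succ_sq_form A hA, Finset.sum_range_succ (fun i => A i i)]
      simp only [hQdef, hLdef]; ring
    simp_rw [hQ']
    have hLm : MemLp L 4 P := memLp_finsetSum _ fun i _ => (h4 i).const_mul _
    have hQm : MemLp Q 2 P := hQ m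
    -- independence of the past and the last variable
    have hI := iIndepFun.indepFun_initial hm hind m
    have hQL : ∃ q l : (Finset.range m → ℝ) → ℝ, Measurable q ∧ Measurable l ∧
        (∀ ω, Q ω = q fun i => X i ω) ∧ (∀ ω, L ω = l fun i => X i ω) := by
      refine ⟨fun z => (∑ i : Finset.range m, ∑ k : Finset.range m, A i k * (z i * z k))
        - v * ∑ i ∈ Finset.range m, A i i, fun z => ∑ i : Finset.range m, A i m * z i,
        by fun_prop, by fun_prop, fun ω => ?_, fun ω => ?_⟩
      · simp only [hQdef]
        congr 1
        rw [← Finset.sum_coe_sort]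
        refine Finset.sum_congr rfl fun i _ => ?_
        rw [← Finset.sum_coe_sort]
      · simp only [hLdef]
        rw [← Finset.sum_coe_sort]
    obtain ⟨q, l, hqm, hlm, hq, hl⟩ := hQL
    have hprod : ∀ (F : (Finset.range m → ℝ) → ℝ) (G : ℝ → ℝ), Measurable F → Measurable G →
        ∫ ω, F (fun i => X i ω) * G (X m ω) ∂P
          = (∫ ω, F (fun i => X i ω) ∂P) * ∫ ω, G (X m ω) ∂P := fun F G hF hG =>
      (hI.comp hF hG).integral_fun_mul_eq_mul_integral
        (hF.comp (measurable_pi_lambda _ fun i => hm i)).aestronglyMeasurable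
        (hG.comp (hm m)).aestronglyMeasurable
    have hi2 : Integrable (fun ω => X m ω ^ 2) P := (h2 m).integrable_sq
    have hi4 : Integrable (fun ω => X m ω ^ 4) P := MemLp.integrable_pow_four (h4 m)
    have hXL : MemLp (fun ω => X m ω * L ω) 2 P := memLp_mul_of_four (h4 m) hLm
    have hXX : MemLp (fun ω => X m ω ^ 2 - v) 2 P := by
      have := (memLp_mul_of_four (h4 m) (h4 m)).sub (memLp_const v)
      refine this.ae_eq (Eventually.of_forall fun ω => ?_)
      simp only [Pi.sub_apply]; ring
    have eLint : ∫ ω, L ω ∂P = 0 := by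
      simp only [hLdef]
      rw [integral_finsetSum _ fun i _ => ((h2 i).integrable (by norm_num)).const_mul _]
      simp [integral_const_mul, h0]
    have eL2 : ∫ ω, L ω ^ 2 ∂P = v * ∑ i ∈ Finset.range m, A i m ^ 2 :=
      integral_indep_linear_sq hm hind h2 h0 hv _ m
    have eXv : ∫ ω, (X m ω ^ 2 - v) ∂P = 0 := by
      rw [integral_sub hi2 (integrable_const _), hv]; simp
    have eXL : ∫ ω, X m ω * L ω ∂P = 0 := by
      have := hprod l id hlm measurable_id
      simp only [← hl, id] at this
      simp_rw [mul_comm (X m _)]; rw [this, eLint]; simp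
    constructor
    · rw [integral_add, integral_add, ih0, integral_const_mul, integral_const_mul, eXL, eXv]
      · simp
      · exact hQm.integrable (by norm_num)
      · exact (hXL.integrable (by norm_num)).const_mul _
      · exact (hQm.integrable (by norm_num)).add ((hXL.integrable (by norm_num)).const_mul _)
      · exact (hXX.integrable (by norm_num)).const_mul _
    -- All three cross terms vanish, for different reasons: E X_m = 0, then E(X_m² - v) = 0, and
    -- finally E L = 0. The last one is needed because X_m may have a nonzero third moment.
    have e1 : ∫ ω, Q ω * (X m ω * L ω) ∂P = 0 := by
      have := hprod (fun z => q z * l z) id (hqm.mul hlm) measurable_id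
      simp only [← hl, ← hq, id, h0, mul_zero] at this
      rw [← this]; congr 1; ext; ring
    have e2 : ∫ ω, Q ω * (X m ω ^ 2 - v) ∂P = 0 := by
      have := hprod q (fun x => x ^ 2 - v) hqm (by fun_prop)
      simp only [← hq, eXv, mul_zero] at this
      exact this
    have e3 : ∫ ω, (X m ω * L ω) * (X m ω ^ 2 - v) ∂P = 0 := by
      have := hprod l (fun x => x * (x ^ 2 - v)) hlm (by fun_prop)
      simp only [← hl, eLint, zero_mul] at this
      rw [← this]; congr 1; ext; ring
    have e4 : ∫ ω, (X m ω * L ω) ^ 2 ∂P = v * (v * ∑ i ∈ Finset.range m, A i m ^ 2) := by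
      have := hprod (fun z => l z ^ 2) (fun x => x ^ 2) (by fun_prop) (by fun_prop)
      simp only [← hl, hv, eL2] at this
      rw [mul_comm v, ← this]; congr 1; ext; ring
    have e5 : ∫ ω, (X m ω ^ 2 - v) ^ 2 ∂P ≤ κ - v ^ 2 := by
      have : (fun ω => (X m ω ^ 2 - v) ^ 2) = fun ω => X m ω ^ 4 - 2 * v * X m ω ^ 2 + v ^ 2 := by
        ext; ring
      have i24 : Integrable (fun ω => X m ω ^ 4 - 2 * v * X m ω ^ 2) P :=
        hi4.sub (hi2.const_mul _)
      rw [this, integral_add i24 (integrable_const _),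
        integral_sub hi4 (hi2.const_mul _), integral_const_mul, hv]
      simp only [integral_const, probReal_univ, one_smul]
      linarith [hκ m]
    have key : ∫ ω, (Q ω + 2 * (X m ω * L ω) + α * (X m ω ^ 2 - v)) ^ 2 ∂P
        = (∫ ω, Q ω ^ 2 ∂P) + 4 * (∫ ω, (X m ω * L ω) ^ 2 ∂P)
          + α ^ 2 * (∫ ω, (X m ω ^ 2 - v) ^ 2 ∂P) + 4 * (∫ ω, Q ω * (X m ω * L ω) ∂P)
          + 2 * α * (∫ ω, Q ω * (X m ω ^ 2 - v) ∂P)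
          + 4 * α * (∫ ω, (X m ω * L ω) * (X m ω ^ 2 - v) ∂P) := by
      have i1 := hQm.integrable_sq
      have i2 := hXL.integrable_sq
      have i3 := hXX.integrable_sq
      have i4 : Integrable (fun ω => Q ω * (X m ω * L ω)) P := hQm.integrable_mul hXL
      have i5 : Integrable (fun ω => Q ω * (X m ω ^ 2 - v)) P := hQm.integrable_mul hXX
      have i6 : Integrable (fun ω => (X m ω * L ω) * (X m ω ^ 2 - v)) P := hXL.integrable_mul hXX
      rw [← integral_const_mul, ← integral_const_mul, ← integral_const_mul, ← integral_const_mul,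
        ← integral_const_mul, ← integral_add, ← integral_add, ← integral_add, ← integral_add,
        ← integral_add]
      · congr 1; ext; ring
      all_goals fun_prop
    rw [key, e1, e2, e3, e4]
    have hs : ∑ i ∈ Finset.range (m + 1), ∑ k ∈ Finset.range (m + 1), A i k ^ 2
        = (∑ i ∈ Finset.range m, ∑ k ∈ Finset.range m, A i k ^ 2)
          + 2 * ∑ i ∈ Finset.range m, A i m ^ 2 + α ^ 2 := by
      have := sum_range_succ_sq_form (fun i k => A i k ^ 2) (fun i k => by rw [hA]) (fun _ => 1) m
      simpa using this
    rw [hs, Finset.sum_range_succ (fun i => A i i ^ 2)]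
    simp only [α] at *
    -- The new diagonal entry costs at most (κ - v²)α² while the bound grants (κ + 2v²)α²; the
    -- off-diagonal entries match exactly.
    nlinarith

end QuadraticForm

/-! ### Independence by conditioning -/

section Conditioning

variable {Ω : Type*} [MeasurableSpace Ω] {P : Measure Ω}

/-- Fubini for the joint law, which is a product by independence. This is the form of conditioning
on B used below. -/
lemma measure_pair_mem {α β : Type*} [MeasurableSpace α] [MeasurableSpace β] {A : Ω → α}
    {B : Ω → β} [IsProbabilityMeasure P] (hA : Measurable A) (hB : Measurable B)
    (hAB : IndepFun A B P) {D : Set (α × β)} (hD : MeasurableSet D) :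
    P {ω | (A ω, B ω) ∈ D} = ∫⁻ ω, P {ω' | (A ω', B ω) ∈ D} ∂P := by
  have h1 : P {ω | (A ω, B ω) ∈ D} = P.map (fun ω => (A ω, B ω)) D := by
    rw [Measure.map_apply (hA.prodMk hB) hD]; rfl
  rw [h1, (indepFun_iff_map_prod_eq_prod_map_map hA.aemeasurable hB.aemeasurable).1 hAB,
    Measure.prod_apply_symm hD, lintegral_map (measurable_measure_prodMk_right hD) hB]
  refine lintegral_congr fun ω => ?_
  rw [Measure.map_apply hA (measurable_prodMk_right hD)]; rfl

/-- If, with the second argument frozen, the variables `Φ i (A, b)` are independent with laws that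
depend on `b` only through `K i b`, and the `K i B` are independent, then so are the
`Φ i (A, B)`. -/
theorem iIndepFun_of_indepFun {α β γ : Type*} [MeasurableSpace α] [MeasurableSpace β]
    [MeasurableSpace γ] [IsProbabilityMeasure P] {A : Ω → α} {B : Ω → β} (hA : Measurable A)
    (hB : Measurable B) (hAB : IndepFun A B P) {Φ : ℕ → α × β → ℝ} (hΦ : ∀ i, Measurable (Φ i))
    {K : ℕ → β → γ} (hK : ∀ i, Measurable (K i)) (hKB : iIndepFun (fun i ω => K i (B ω)) P)
    (h1 : ∀ b, iIndepFun (fun i ω => Φ i (A ω, b)) P) (G : ℕ → Set ℝ → γ → ℝ≥0∞)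
    (hG : ∀ i C, MeasurableSet C → Measurable (G i C))
    (h2 : ∀ i C b, MeasurableSet C → P {ω | Φ i (A ω, b) ∈ C} = G i C (K i b)) :
    iIndepFun (fun i ω => Φ i (A ω, B ω)) P := by
  rw [iIndepFun_iff_measure_inter_preimage_eq_mul]
  intro S C hC
  -- Only the sets with index in S matter; the others may be replaced by ∅, so that all of them are
  -- measurable.
  wlog hC' : ∀ i, MeasurableSet (C i) generalizing C
  · have := this (C := fun i => if i ∈ S then C i else ∅) (fun i hi => by simpa [hi] using hC i hi)
      (fun i => by by_cases h : i ∈ S <;> simp [h, hC])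
    rw [Finset.prod_congr rfl fun i hi => by rw [if_pos hi]] at this
    rw [← this]; congr 1; ext ω; simp +contextual
  have hD : MeasurableSet (⋂ i ∈ S, Φ i ⁻¹' C i) :=
    S.measurableSet_biInter fun i _ => hΦ i (hC' i)
  have e1 := measure_pair_mem hA hB hAB hD
  have e2 : ∀ i, P ((fun ω => Φ i (A ω, B ω)) ⁻¹' C i) = ∫⁻ ω, G i (C i) (K i (B ω)) ∂P := by
    intro i
    have := measure_pair_mem hA hB hAB (hΦ i (hC' i))
    refine Eq.trans ?_ (this.trans (lintegral_congr fun ω => h2 i (C i) (B ω) (hC' i)))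
    rfl
  simp_rw [e2]
  -- Given B the probability of the intersection is the product of the G i (C i) (K i B). These
  -- factors are independent functions of ω, so the expectation of their product factorizes too.
  rw [← lintegral_prod_eq_prod_lintegral_of_indepFun S (fun i ω => G i (C i) (K i (B ω)))
    (hKB.comp (fun i => G i (C i)) fun i => hG i _ (hC' i))
    fun i => (hG i _ (hC' i)).comp ((hK i).comp hB)]
  refine Eq.trans (by congr 1; ext ω; simp) (e1.trans (lintegral_congr fun ω => ?_))
  have := (h1 (B ω)).measure_inter_preimage_eq_mul S (sets := C) fun i _ => hC' i
  refine Eq.trans (by congr 1; ext ω; simp) (this.trans (Finset.prod_congr rfl fun i _ => ?_))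
  exact h2 i (C i) (B ω) (hC' i)

/-- Groups of an independent family are independent of each other. -/
lemma iIndepFun_curry {ι : Type*} {κ : ι → Type*} [IsProbabilityMeasure P]
    {X : (i : ι) → κ i → Ω → ℝ} (mX : ∀ i j, Measurable (X i j))
    (h : iIndepFun (fun (p : (i : ι) × κ i) ω => X p.1 p.2 ω) P) :
    iIndepFun (fun i ω => (X i · ω)) P := by
  have : ∀ i j, IsProbabilityMeasure (P.map (X i j)) :=
    fun i j ↦ Measure.isProbabilityMeasure_map (mX i j).aemeasurable
  have hc : (MeasurableEquiv.piCurry (fun (i : ι) (_ : κ i) => ℝ)) ∘ (fun ω p ↦ X p.1 p.2 ω)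
      = fun ω i j ↦ X i j ω := by
    ext; simp [Sigma.curry]
  rw [iIndepFun_iff_map_fun_eq_infinitePi_map (by fun_prop)]
  rw [← hc, ← Measure.map_map (by fun_prop) (by fun_prop),
    (iIndepFun_iff_map_fun_eq_infinitePi_map (by fun_prop)).1 h,
    Measure.infinitePi_map_piCurry (fun i j ↦ P.map (X i j))]
  congr 1
  funext i
  have hi : iIndepFun (X i) P := h.precomp (g := fun j : κ i => ⟨i, j⟩) sigma_mk_injective
  rw [(iIndepFun_iff_map_fun_eq_infinitePi_map (by fun_prop)).1 hi]

end Conditioning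

/-! ### Moments of the Poisson law -/

/-- The factor k cancels against k!, and a shift of the index by one returns the exponential series.
-/
lemma hasSum_poisson_cast (r : ℝ≥0) :
    HasSum (fun k : ℕ => (Real.exp (-r) * r ^ k / k.factorial) * (k : ℝ)) r := by
  have h := (hasSum_one_poissonMeasure r).mul_left (r : ℝ)
  rw [← hasSum_nat_add_iff' 1]
  simp only [Finset.range_one, Finset.sum_singleton, Nat.cast_zero, mul_zero, sub_zero]
  convert! h using 1
  · funext k
    rw [Nat.factorial_succ]
    push_cast
    field_simp
    ring
  · simp

/-- The factorial moment of k(k - 1), obtained by a shift of two, is r²; adding the mean gives the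
second moment. -/
lemma hasSum_poisson_cast_sq (r : ℝ≥0) :
    HasSum (fun k : ℕ => (Real.exp (-r) * r ^ k / k.factorial) * (k : ℝ) ^ 2) (r + r ^ 2) := by
  have h := (hasSum_one_poissonMeasure r).mul_left ((r : ℝ) ^ 2)
  have h2 : HasSum (fun k : ℕ => (Real.exp (-r) * r ^ k / k.factorial) * ((k : ℝ) * (k - 1)))
      ((r : ℝ) ^ 2) := by
    rw [← hasSum_nat_add_iff' 2]
    simp only [Finset.sum_range_succ, Finset.range_zero, Finset.sum_empty, Nat.cast_zero,
      Nat.cast_one, zero_mul, sub_self, mul_zero, add_zero, sub_zero]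
    convert! h using 1
    · funext k
      rw [Nat.factorial_succ, Nat.factorial_succ]
      push_cast
      field_simp
      ring
    · simp
  convert! (hasSum_poisson_cast r).add h2 using 1
  funext k; ring

lemma integrable_poisson_cast (r : ℝ≥0) : Integrable (fun k : ℕ => (k : ℝ)) (poissonMeasure r) := by
  rw [integrable_poissonMeasure_iff]
  simpa using (hasSum_poisson_cast r).summable

lemma integrable_poisson_cast_sq (r : ℝ≥0) :
    Integrable (fun k : ℕ => (k : ℝ) ^ 2) (poissonMeasure r) := by
  rw [integrable_poissonMeasure_iff]
  simpa using (hasSum_poisson_cast_sq r).summable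

lemma integral_poisson_cast (r : ℝ≥0) : ∫ k : ℕ, (k : ℝ) ∂(poissonMeasure r) = r :=
  (hasSum_integral_poissonMeasure (integrable_poisson_cast r)).unique
    (by simpa using hasSum_poisson_cast r)

lemma integral_poisson_cast_sq (r : ℝ≥0) :
    ∫ k : ℕ, (k : ℝ) ^ 2 ∂(poissonMeasure r) = r + r ^ 2 :=
  (hasSum_integral_poissonMeasure (integrable_poisson_cast_sq r)).unique
    (by simpa using hasSum_poisson_cast_sq r)

/-! ### Block sums of the jumps -/

/-- The sum of the `i`-th block of `y` when the blocks have the sizes `b 0, b 1, …`. -/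
def blockSum (i : ℕ) (p : (ℕ → ℝ) × (ℕ → ℕ)) : ℝ :=
  ∑ j ∈ Finset.range (p.2 i), p.1 ((∑ k ∈ Finset.range i, p.2 k) + j)

lemma measurable_blockSum (i : ℕ) : Measurable (blockSum i) := by
  have h : Measurable fun q : (ℕ → ℝ) × (ℕ × ℕ) => ∑ j ∈ Finset.range q.2.1, q.1 (q.2.2 + j) :=
    measurable_from_prod_countable_left fun q =>
      Finset.measurable_sum (Finset.range q.1) fun j _ => measurable_pi_apply (q.2 + j)
  exact h.comp (measurable_fst.prodMk (((measurable_pi_apply i).comp measurable_snd).prodMk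
    (Finset.measurable_sum (Finset.range i) fun k _ => (measurable_pi_apply k).comp measurable_snd)))

lemma blockStart_mono (b : ℕ → ℕ) {i i' : ℕ} (h : i < i') :
    (∑ k ∈ Finset.range i, b k) + b i ≤ ∑ k ∈ Finset.range i', b k := by
  rw [← Finset.sum_range_succ]
  exact Finset.sum_le_sum_of_subset (Finset.range_mono h)

section Jumps

variable {Ω : Type*} [MeasurableSpace Ω] {P : Measure Ω}

/-- For fixed sizes the blocks occupy disjoint sets of indices, so the independent family of jumps
splits into independent groups. -/
lemma iIndepFun_blockSum [IsProbabilityMeasure P] {Y : ℕ → Ω → ℝ} (hm : ∀ j, Measurable (Y j))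
    (hY : iIndepFun Y P)
    (b : ℕ → ℕ) : iIndepFun (fun i ω => blockSum i (fun j => Y j ω, b)) P := by
  set c : ℕ → ℕ := fun i => ∑ k ∈ Finset.range i, b k with hc
  have hinj : Function.Injective (fun p : (i : ℕ) × Fin (b i) => c p.1 + p.2) := by
    rintro ⟨i, j⟩ ⟨i', j'⟩ h
    simp only at h
    rcases lt_trichotomy i i' with hi | hi | hi
    · have := blockStart_mono b hi; simp only [hc] at h; omega
    · subst hi
      have : j = j' := Fin.ext (by omega)
      rw [this]
    · have := blockStart_mono b hi; simp only [hc] at h; omega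
  have h1 := hY.precomp hinj
  have h2 := iIndepFun_curry (X := fun (i : ℕ) (j : Fin (b i)) => Y (c i + j))
    (fun i j => hm _) h1
  have h3 := h2.comp (fun i (z : Fin (b i) → ℝ) => ∑ j, z j) fun i => by fun_prop
  convert h3 using 2 with i
  funext ω
  simp only [blockSum, Function.comp, hc]
  rw [Finset.sum_range]

/-- A shifted i.i.d. sequence has the law of the original one, so the starting point of a block is
irrelevant. Hence the conditional law of a block depends on the counts only through its own size. -/
lemma identDistrib_blockSum {Y : ℕ → Ω → ℝ} (hY : IsJumpSequence P Y) (i : ℕ) (b : ℕ → ℕ) :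
    IdentDistrib (fun ω => blockSum i (fun j => Y j ω, b))
      (fun ω => ∑ j ∈ Finset.range (b i), Y j ω) P P := by
  have h := IdentDistrib.pi (X := fun j : ℕ => Y ((∑ k ∈ Finset.range i, b k) + j)) (Y := Y)
    (fun j => (hY.identDistrib _).trans (hY.identDistrib j).symm)
    (hY.indep.precomp (add_right_injective _)) hY.indep
  exact h.comp (u := fun z : ℕ → ℝ => ∑ j ∈ Finset.range (b i), z j) (by fun_prop)

lemma IsJumpSequence.memLp {Y : ℕ → Ω → ℝ} (hY : IsJumpSequence P Y) (j : ℕ) :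
    MemLp (Y j) 4 P := by
  rw [← integrable_norm_rpow_iff (hY.measurable j).aestronglyMeasurable (by norm_num) (by simp)]
  convert hY.fourth_moment j using 2 with ω
  rw [show (4 : ℝ≥0∞).toReal = ((4 : ℕ) : ℝ) by simp, Real.rpow_natCast, Real.norm_eq_abs,
    Even.pow_abs (by decide)]

lemma IsJumpSequence.integral_pow_four {Y : ℕ → Ω → ℝ} (hY : IsJumpSequence P Y) (j : ℕ) :
    ∫ ω, Y j ω ^ 4 ∂P = ∫ ω, Y 0 ω ^ 4 ∂P :=
  ((hY.identDistrib j).comp (u := fun x : ℝ => x ^ 4) (by fun_prop)).integral_eq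

/-- Expand E(Y² - 1)² ≥ 0. At the end this lets the fourth moment absorb additive constants. -/
lemma IsJumpSequence.one_le_fourth [IsProbabilityMeasure P] {Y : ℕ → Ω → ℝ}
    (hY : IsJumpSequence P Y) :
    1 ≤ ∫ ω, Y 0 ω ^ 4 ∂P := by
  have h2 : Integrable (fun ω => Y 0 ω ^ 2) P :=
    ((hY.memLp 0).mono_exponent (by norm_num)).integrable_sq
  have h : 0 ≤ ∫ ω, (Y 0 ω ^ 4 - (2 * Y 0 ω ^ 2 - 1)) ∂P :=
    integral_nonneg fun ω => by
      have := sq_nonneg (Y 0 ω ^ 2 - 1)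
      simp only [Pi.zero_apply]; nlinarith
  have h3 : Integrable (fun ω => 2 * Y 0 ω ^ 2 - 1) P := (h2.const_mul 2).sub (integrable_const 1)
  rw [integral_sub (hY.fourth_moment 0) h3, integral_sub (h2.const_mul 2) (integrable_const 1),
    integral_const_mul, hY.second_moment] at h
  simp only [integral_const, probReal_univ, one_smul] at h
  linarith

lemma IsJumpSequence.memLp_sum {Y : ℕ → Ω → ℝ} (hY : IsJumpSequence P Y) (l : ℕ) :
    MemLp (fun ω => ∑ j ∈ Finset.range l, Y j ω) 4 P :=
  memLp_finsetSum _ fun j _ => hY.memLp j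

lemma IsJumpSequence.integral_sum [IsProbabilityMeasure P] {Y : ℕ → Ω → ℝ}
    (hY : IsJumpSequence P Y) (l : ℕ) :
    ∫ ω, (∑ j ∈ Finset.range l, Y j ω) ∂P = 0 := by
  rw [integral_finsetSum _ fun j _ => (hY.memLp j).integrable (by norm_num)]
  simp [hY.mean]

lemma IsJumpSequence.integral_sum_sq [IsProbabilityMeasure P] {Y : ℕ → Ω → ℝ}
    (hY : IsJumpSequence P Y) (l : ℕ) :
    ∫ ω, (∑ j ∈ Finset.range l, Y j ω) ^ 2 ∂P = l := by
  have := integral_indep_linear_sq hY.measurable hY.indep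
    (fun j => (hY.memLp j).mono_exponent (by norm_num)) hY.mean hY.second_moment (fun _ => 1) l
  simpa using this

/-- The square of the sum is the quadratic form with all entries 1. Its variance is at most 2l² + l
E Y⁴, and the squared mean l² is added back. -/
lemma IsJumpSequence.integral_sum_pow_four_le [IsProbabilityMeasure P] {Y : ℕ → Ω → ℝ}
    (hY : IsJumpSequence P Y) (l : ℕ) :
    ∫ ω, (∑ j ∈ Finset.range l, Y j ω) ^ 4 ∂P ≤ (∫ ω, Y 0 ω ^ 4 ∂P) * l + 3 * (l : ℝ) ^ 2 := by
  have h := (integral_quadForm_sq_le hY.measurable hY.indep hY.memLp hY.mean hY.second_moment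
    (fun j => (hY.integral_pow_four j).le) (fun _ _ => 1) (fun _ _ => rfl) l).2.2
  simp only [one_mul, ← Finset.sum_mul_sum, Finset.sum_const, Finset.card_range, nsmul_eq_mul,
    mul_one, one_pow, ← pow_two] at h
  have i4 := MemLp.integrable_pow_four (hY.memLp_sum l)
  have i2 : Integrable (fun ω => (∑ j ∈ Finset.range l, Y j ω) ^ 2) P :=
    ((hY.memLp_sum l).mono_exponent (by norm_num)).integrable_sq
  have e : (fun ω => ((∑ j ∈ Finset.range l, Y j ω) ^ 2 - (l : ℝ)) ^ 2)
      = fun ω => (∑ j ∈ Finset.range l, Y j ω) ^ 4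
        - (2 * l * (∑ j ∈ Finset.range l, Y j ω) ^ 2 - (l : ℝ) ^ 2) := by ext; ring
  have i3 : Integrable (fun ω => 2 * l * (∑ j ∈ Finset.range l, Y j ω) ^ 2 - (l : ℝ) ^ 2) P :=
    (i2.const_mul _).sub (integrable_const _)
  rw [e, integral_sub i4 i3, integral_sub (i2.const_mul _) (integrable_const _), integral_const_mul,
    hY.integral_sum_sq] at h
  simp only [integral_const, probReal_univ, one_smul] at h
  linarith

/-- The moments of a compound Poisson variable. -/
theorem compound_moments [IsProbabilityMeasure P] {Y : ℕ → Ω → ℝ} (hY : IsJumpSequence P Y)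
    {K : Ω → ℕ → ℕ}
    (hK : Measurable K) (hKY : IndepFun (fun ω j => Y j ω) K P) {r : ℝ≥0} (i : ℕ)
    (hlaw : HasLaw (fun ω => K ω i) (poissonMeasure r) P) :
    MemLp (fun ω => blockSum i (fun j => Y j ω, K ω)) 4 P ∧
    ∫ ω, blockSum i (fun j => Y j ω, K ω) ∂P = 0 ∧
    ∫ ω, blockSum i (fun j => Y j ω, K ω) ^ 2 ∂P = r ∧
    ∫ ω, blockSum i (fun j => Y j ω, K ω) ^ 4 ∂P
      ≤ (∫ ω, Y 0 ω ^ 4 ∂P) * r + 3 * (r + r ^ 2) := by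
  set A : Ω → ℕ → ℝ := fun ω j => Y j ω with hAdef
  have hA : Measurable A := measurable_pi_lambda _ fun j => hY.measurable j
  have hAK : P.map (fun ω => (A ω, K ω)) = (P.map A).prod (P.map K) :=
    (indepFun_iff_map_prod_eq_prod_map_map hA.aemeasurable hK.aemeasurable).1 hKY
  have hAKm : Measurable fun ω => (A ω, K ω) := hA.prodMk hK
  -- conditionally on the block sizes
  have fm : ∀ (f : ℝ → ℝ), Measurable f → ∀ b : ℕ → ℕ,
      AEStronglyMeasurable (fun y => f (blockSum i (y, b))) (P.map A) := fun f hf b =>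
    (hf.comp ((measurable_blockSum i).comp measurable_prodMk_right)).aestronglyMeasurable
  have fr : ∀ (f : ℝ → ℝ), Measurable f → ∀ b : ℕ → ℕ,
      ∫ y, f (blockSum i (y, b)) ∂(P.map A) = ∫ ω, f (∑ j ∈ Finset.range (b i), Y j ω) ∂P := by
    intro f hf b
    rw [integral_map hA.aemeasurable (fm f hf b)]
    exact ((identDistrib_blockSum hY i b).comp hf).integral_eq
  have fri : ∀ (f : ℝ → ℝ), Measurable f → ∀ b : ℕ → ℕ,
      Integrable (fun ω => f (∑ j ∈ Finset.range (b i), Y j ω)) P →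
      Integrable (fun y => f (blockSum i (y, b))) (P.map A) := by
    intro f hf b h
    rw [integrable_map_measure (fm f hf b) hA.aemeasurable]
    exact ((identDistrib_blockSum hY i b).comp hf).integrable_iff.2 h
  -- integrals of functions of the block size
  have km : ∀ f : ℕ → ℝ, AEStronglyMeasurable (fun b : ℕ → ℕ => f (b i)) (P.map K) := fun f =>
    ((measurable_from_nat (f := f)).comp (measurable_pi_apply i)).aestronglyMeasurable
  have pois : ∀ f : ℕ → ℝ, ∫ b, f (b i) ∂(P.map K) = ∫ k, f k ∂(poissonMeasure r) := by
    intro f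
    rw [integral_map hK.aemeasurable (km f)]
    exact hlaw.integral_comp (f := f) (by fun_prop)
  have poisi : ∀ f : ℕ → ℝ, Integrable f (poissonMeasure r) →
      Integrable (fun b => f (b i)) (P.map K) := by
    intro f hf
    rw [integrable_map_measure (km f) hK.aemeasurable]
    rw [← hlaw.map_eq, integrable_map_measure (by fun_prop) hlaw.aemeasurable] at hf
    exact hf
  have i1 := integrable_poisson_cast r
  have i2 := integrable_poisson_cast_sq r
  have hbd : Integrable (fun k : ℕ => (∫ ω, Y 0 ω ^ 4 ∂P) * k + 3 * (k : ℝ) ^ 2)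
      (poissonMeasure r) := (i1.const_mul _).add (i2.const_mul _)
  have hm4 : Measurable fun x : ℝ => x ^ 4 := by fun_prop
  -- The conditional fourth moment is at most linear plus quadratic in the block size, and a Poisson
  -- variable has two moments.
  have hint4 : Integrable (fun p => blockSum i p ^ 4) ((P.map A).prod (P.map K)) := by
    rw [integrable_prod_iff' ((measurable_blockSum i).pow_const 4).aestronglyMeasurable]
    refine ⟨Eventually.of_forall fun b => fri _ hm4 b
      (MemLp.integrable_pow_four (hY.memLp_sum _)), ?_⟩
    refine (poisi _ hbd).mono' ?_ (Eventually.of_forall fun b => ?_)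
    · exact (((measurable_blockSum i).pow_const 4).norm.stronglyMeasurable.integral_prod_left'
        ).aestronglyMeasurable
    · rw [Real.norm_of_nonneg (integral_nonneg fun _ => norm_nonneg _)]
      have : ∀ y, ‖blockSum i (y, b) ^ 4‖ = blockSum i (y, b) ^ 4 := fun y =>
        Real.norm_of_nonneg (by positivity)
      simp_rw [this]
      rw [fr _ hm4 b]
      exact hY.integral_sum_pow_four_le _
  have hZm : Measurable fun ω => blockSum i (A ω, K ω) := (measurable_blockSum i).comp hAKm
  have hZ4 : MemLp (fun ω => blockSum i (A ω, K ω)) 4 P := by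
    rw [← integrable_norm_rpow_iff hZm.aestronglyMeasurable (by norm_num) (by simp)]
    have : Integrable (fun ω => blockSum i (A ω, K ω) ^ 4) P := by
      rw [← hAK, integrable_map_measure ((measurable_blockSum i).pow_const 4).aestronglyMeasurable
        hAKm.aemeasurable] at hint4
      exact hint4
    convert this using 2 with ω
    rw [show (4 : ℝ≥0∞).toReal = ((4 : ℕ) : ℝ) by simp, Real.rpow_natCast, Real.norm_eq_abs,
      Even.pow_abs (by decide)]
  have fub : ∀ (f : ℝ → ℝ), Measurable f → Integrable (fun ω => f (blockSum i (A ω, K ω))) P →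
      ∫ ω, f (blockSum i (A ω, K ω)) ∂P
        = ∫ b, (∫ ω, f (∑ j ∈ Finset.range (b i), Y j ω) ∂P) ∂(P.map K) := by
    intro f hf hi
    have hfm : Measurable fun p => f (blockSum i p) := hf.comp (measurable_blockSum i)
    have hi' : Integrable (fun p => f (blockSum i p)) ((P.map A).prod (P.map K)) := by
      rw [← hAK, integrable_map_measure hfm.aestronglyMeasurable hAKm.aemeasurable]
      exact hi
    calc ∫ ω, f (blockSum i (A ω, K ω)) ∂P
        = ∫ p, f (blockSum i p) ∂((P.map A).prod (P.map K)) := by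
          rw [← hAK, integral_map hAKm.aemeasurable hfm.aestronglyMeasurable]
      _ = _ := by
          rw [integral_prod_symm _ hi']
          exact integral_congr_ae (Eventually.of_forall fun b => fr f hf b)
  refine ⟨hZ4, ?_, ?_, ?_⟩
  · rw [fub (fun x => x) measurable_id (hZ4.integrable (by norm_num))]
    simp [hY.integral_sum]
  · rw [fub (fun x => x ^ 2) (by fun_prop) (hZ4.mono_exponent (by norm_num)).integrable_sq]
    simp_rw [hY.integral_sum_sq]
    rw [pois fun k => (k : ℝ), integral_poisson_cast]
  · rw [fub (fun x => x ^ 4) hm4 (MemLp.integrable_pow_four hZ4)]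
    calc _ ≤ ∫ b, ((∫ ω, Y 0 ω ^ 4 ∂P) * (b i : ℝ) + 3 * (b i : ℝ) ^ 2) ∂(P.map K) := by
          refine integral_mono_of_nonneg
            (Eventually.of_forall fun b => integral_nonneg fun ω => by positivity)
            (poisi _ hbd) (Eventually.of_forall fun b => hY.integral_sum_pow_four_le _)
      _ = _ := by
          rw [pois fun k => (∫ ω, Y 0 ω ^ 4 ∂P) * (k : ℝ) + 3 * (k : ℝ) ^ 2,
            integral_add (i1.const_mul _) (i2.const_mul _), integral_const_mul, integral_const_mul,
            integral_poisson_cast, integral_poisson_cast_sq]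

end Jumps

/-! ### Increments of the driving process -/

section Increments

variable {Ω : Type*} [MeasurableSpace Ω] {P : Measure Ω}

lemma sum_range_sub_of_monotone {f : ℕ → ℕ} (hf : Monotone f) (h0 : f 0 = 0) (i : ℕ) :
    ∑ k ∈ Finset.range i, (f (k + 1) - f k) = f i := by
  rw [Finset.sum_range_tsub hf, h0, Nat.sub_zero]

variable {lam : ℝ≥0} {r₁ r₂ a : ℝ} {w : ℝ≥0 → Ω → ℝ} {N : ℝ≥0 → Ω → ℕ} {Y : ℕ → Ω → ℝ}
  {ξ : ℝ≥0 → Ω → ℝ}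

lemma measurable_compoundPoisson (hN : ∀ t, Measurable (N t)) (hY : ∀ j, Measurable (Y j))
    (t : ℝ≥0) : Measurable (compoundPoisson N Y t) := by
  have h : Measurable fun q : Ω × ℕ => ∑ j ∈ Finset.range q.2, Y j q.1 :=
    measurable_from_prod_countable_left fun k => Finset.measurable_sum (Finset.range k) fun j _ => hY j
  exact h.comp (measurable_id.prodMk (hN t))

lemma IsOUNoise.measurable_driving (h : IsOUNoise P a lam r₁ r₂ w N Y ξ) (t : ℝ≥0) :
    Measurable (drivingProcess r₁ r₂ w N Y t) :=
  ((h.brownian_measurable t).const_mul _).add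
    ((measurable_compoundPoisson h.poisson.measurable h.jumps.measurable t).const_mul _)

/-- Along a grid, the increments of the compound Poisson process are block sums of the jumps. -/
lemma compoundPoisson_increment (hN : IsPoissonProcess P lam N) {t : ℕ → ℝ≥0} (ht : Monotone t)
    (ht0 : t 0 = 0) :
    ∀ᵐ ω ∂P, ∀ i, compoundPoisson N Y (t (i + 1)) ω - compoundPoisson N Y (t i) ω
      = blockSum i (fun j => Y j ω, fun k => N (t (k + 1)) ω - N (t k) ω) := by
  filter_upwards [hN.zero, hN.monotone] with ω h0 hmono i
  have hm : Monotone fun k => N (t k) ω := fun k l hkl => hmono (ht hkl)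
  have hz : N (t 0) ω = 0 := by rw [ht0, h0]
  simp only [blockSum, compoundPoisson]
  rw [sum_range_sub_of_monotone hm hz i]
  obtain ⟨d, hd⟩ := Nat.exists_eq_add_of_le (hm (Nat.le_succ i))
  simp only [Nat.succ_eq_add_one] at hd
  rw [hd, Finset.sum_range_add, Nat.add_sub_cancel_left]
  ring

lemma gaussianReal_memLp_four (v : ℝ≥0) : MemLp (fun x : ℝ => x) 4 (gaussianReal 0 v) :=
  memLp_id_gaussianReal (μ := 0) (v := v) 4

/-- Scaling suffices: only the order v² matters, since this contribution disappears when the mesh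
tends to zero. -/
lemma integral_pow_four_gaussianReal (v : ℝ≥0) :
    ∫ x, x ^ 4 ∂(gaussianReal 0 v) = (v : ℝ) ^ 2 * ∫ x, x ^ 4 ∂(gaussianReal 0 1) := by
  have h : gaussianReal 0 v = (gaussianReal 0 1).map (fun x => √v * x) := by
    rw [gaussianReal_map_const_mul]
    congr 1
    · simp
    · ext; simp
  rw [h, integral_map (by fun_prop) (by fun_prop), ← integral_const_mul]
  congr 1
  funext x
  rw [mul_pow, show (√(v:ℝ)) ^ 4 = (√(v:ℝ) ^ 2) ^ 2 by ring, Real.sq_sqrt v.coe_nonneg]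

/-- Independence and the moments of the increments of the driving process along a uniform grid. -/
theorem IsOUNoise.increments [IsProbabilityMeasure P] (h : IsOUNoise P a lam r₁ r₂ w N Y ξ) :
    ∃ C : ℝ, 0 ≤ C ∧ ∀ (δ : ℝ≥0) (t : ℕ → ℝ≥0), t 0 = 0 → (∀ i, t (i + 1) = t i + δ) →
      iIndepFun (fun i ω => drivingProcess r₁ r₂ w N Y (t (i + 1)) ω
        - drivingProcess r₁ r₂ w N Y (t i) ω) P ∧
      ∀ i, MemLp (fun ω => drivingProcess r₁ r₂ w N Y (t (i + 1)) ω
          - drivingProcess r₁ r₂ w N Y (t i) ω) 4 P ∧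
        ∫ ω, (drivingProcess r₁ r₂ w N Y (t (i + 1)) ω
          - drivingProcess r₁ r₂ w N Y (t i) ω) ∂P = 0 ∧
        ∫ ω, (drivingProcess r₁ r₂ w N Y (t (i + 1)) ω
          - drivingProcess r₁ r₂ w N Y (t i) ω) ^ 2 ∂P = rhoStar lam r₁ r₂ * δ ∧
        ∫ ω, (drivingProcess r₁ r₂ w N Y (t (i + 1)) ω
          - drivingProcess r₁ r₂ w N Y (t i) ω) ^ 4 ∂P
          ≤ ((∫ ω, Y 0 ω ^ 4 ∂P) + 3) * lam * r₂ ^ 4 * δ + C * δ ^ 2 := by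
  set g4 : ℝ := ∫ x, x ^ 4 ∂(gaussianReal 0 1) with hg4
  -- The coefficients of δ² in the fourth moment: the Gaussian part, the mixed term 6 E W² E Z², and
  -- the quadratic part of the compound Poisson bound. The term linear in δ is due to single jumps.
  refine ⟨r₁ ^ 4 * g4 + 6 * r₁ ^ 2 * r₂ ^ 2 * lam + 3 * r₂ ^ 4 * lam ^ 2, by positivity, ?_⟩
  intro δ t ht0 ht
  have htm : Monotone t := monotone_nat_of_le_succ fun i => by rw [ht]; exact le_self_add
  have htd : ∀ i, t (i + 1) - t i = δ := fun i => by rw [ht, add_tsub_cancel_left]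
  have hBr := h.brownian.toIsPreBrownianReal
  -- the Brownian increments, the counts and the jumps
  set W : Ω → ℕ → ℝ := fun ω i => w (t (i + 1)) ω - w (t i) ω with hW
  set K : Ω → ℕ → ℕ := fun ω k => N (t (k + 1)) ω - N (t k) ω with hK
  set Z : ℕ → Ω → ℝ := fun i ω => blockSum i (fun j => Y j ω, K ω) with hZ
  have hWm : Measurable W := measurable_pi_lambda _ fun i =>
    (h.brownian_measurable _).sub (h.brownian_measurable _)
  have hKi : ∀ i, Measurable fun ω => K ω i := fun i =>
    (h.poisson.measurable _).sub (h.poisson.measurable _)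
  have hKm : Measurable K := measurable_pi_lambda _ hKi
  have hYm : Measurable fun ω j => Y j ω := measurable_pi_lambda _ h.jumps.measurable
  have hZi : ∀ i, Measurable (Z i) := fun i => (measurable_blockSum i).comp (hYm.prodMk hKm)
  have hKY : IndepFun (fun ω j => Y j ω) K P := by
    have := h.indep_poisson.symm
    exact this.comp (φ := id) (ψ := fun (f : ℝ≥0 → ℕ) k => f (t (k + 1)) - f (t k)) measurable_id
      (measurable_pi_lambda _ fun k => (measurable_pi_apply _).sub (measurable_pi_apply _))
  have hWZ : IndepFun W (fun ω i => Z i ω) P := by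
    refine h.indep_brownian.comp (φ := fun (f : ℝ≥0 → ℝ) i => f (t (i + 1)) - f (t i))
      (ψ := fun p : (ℝ≥0 → ℕ) × (ℕ → ℝ) => fun i =>
        blockSum i (p.2, fun k => p.1 (t (k + 1)) - p.1 (t k))) ?_ ?_
    · exact measurable_pi_lambda _ fun k => (measurable_pi_apply _).sub (measurable_pi_apply _)
    · refine measurable_pi_lambda _ fun i => (measurable_blockSum i).comp (measurable_snd.prodMk ?_)
      exact measurable_pi_lambda _ fun k => ((measurable_pi_apply _).comp measurable_fst).sub
        ((measurable_pi_apply _).comp measurable_fst)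
  -- The independent increments are those of the real-valued process; by monotonicity the truncated
  -- differences in ℕ are true differences, and the floor recovers them.
  have hKind : iIndepFun (fun i ω => K ω i) P := by
    have h1 := h.poisson.indep_increments.nat htm
    have h2 := h1.comp (fun _ x => ⌊x⌋₊) fun _ => Nat.measurable_floor
    refine h2.congr fun i => ?_
    filter_upwards [h.poisson.monotone] with ω hm
    have := hm (htm (Nat.le_succ i))
    simp only [Function.comp, hK, Nat.succ_eq_add_one] at this ⊢
    rw [← Nat.cast_sub this, Nat.floor_natCast]
  have hKlaw : ∀ i, HasLaw (fun ω => K ω i) (poissonMeasure (lam * δ)) P := fun i => by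
    have := h.poisson.law_increments _ _ (htm (Nat.le_succ i))
    rwa [Nat.succ_eq_add_one, htd] at this
  -- Condition on the counts: the blocks become independent, each with a law determined by its own
  -- count, and the counts are independent.
  have hZind : iIndepFun Z P :=
    iIndepFun_of_indepFun (A := fun ω j => Y j ω) (B := K) (Φ := blockSum)
      (K := fun i b => b i) hYm hKm hKY measurable_blockSum measurable_pi_apply hKind
      (iIndepFun_blockSum h.jumps.measurable h.jumps.indep)
      (fun _ C l => P {ω | ∑ j ∈ Finset.range l, Y j ω ∈ C}) (fun _ _ _ => measurable_from_nat)
      (fun i C b hC => (identDistrib_blockSum h.jumps i b).measure_mem_eq hC)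
  have hWind : iIndepFun (fun i ω => W ω i) P := hBr.hasIndepIncrements.nat htm
  have hWlaw : ∀ i, HasLaw (fun ω => W ω i) (gaussianReal 0 δ) P := fun i => by
    have := hBr.hasLaw_sub (t (i + 1)) (t i)
    have hd : nndist (t (i + 1) : ℝ) (t i) = δ := by
      ext; rw [coe_nndist, Real.dist_eq, ht]; simp
    have hg := congrArg (gaussianReal 0) hd
    exact ⟨this.aemeasurable, this.map_eq.trans hg⟩
  -- A second conditioning, now with the compound Poisson increments frozen and the Brownian
  -- increments random.
  have hUind : iIndepFun (fun i ω => r₁ * W ω i + r₂ * Z i ω) P := by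
    refine iIndepFun_of_indepFun (A := W) (B := fun ω i => Z i ω)
      (Φ := fun i p => r₁ * p.1 i + r₂ * p.2 i) (K := fun i b => b i) hWm
      (measurable_pi_lambda _ hZi) hWZ (fun i => ?_) measurable_pi_apply hZind (fun b => ?_)
      (fun i C z => P {ω | r₁ * W ω i + r₂ * z ∈ C}) (fun i C hC => ?_) (fun i C b _ => rfl)
    · exact (((measurable_pi_apply i).comp measurable_fst).const_mul _).add
        (((measurable_pi_apply i).comp measurable_snd).const_mul _)
    · exact hWind.comp (fun i x => r₁ * x + r₂ * b i) fun i => by fun_prop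
    · have hWi : Measurable fun ω => W ω i := (measurable_pi_apply i).comp hWm
      have : MeasurableSet {p : ℝ × Ω | r₁ * W p.2 i + r₂ * p.1 ∈ C} :=
        (((hWi.comp measurable_snd).const_mul _).add (measurable_fst.const_mul _)) hC
      exact measurable_measure_prodMk_left this
  have hU : ∀ᵐ ω ∂P, ∀ i, r₁ * W ω i + r₂ * Z i ω = drivingProcess r₁ r₂ w N Y (t (i + 1)) ω
      - drivingProcess r₁ r₂ w N Y (t i) ω := by
    filter_upwards [compoundPoisson_increment (Y := Y) h.poisson htm ht0] with ω hω i
    simp only [hZ, hK, ← hω i, drivingProcess, hW]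
    ring
  have hUi : ∀ i, (fun ω => r₁ * W ω i + r₂ * Z i ω) =ᵐ[P]
      fun ω => drivingProcess r₁ r₂ w N Y (t (i + 1)) ω - drivingProcess r₁ r₂ w N Y (t i) ω :=
    fun i => by filter_upwards [hU] with ω hω using hω i
  refine ⟨hUind.congr hUi, fun i => ?_⟩
  obtain ⟨z4, z1, z2, z3⟩ := compound_moments h.jumps hKm hKY i (hKlaw i)
  have w4 : MemLp (fun ω => W ω i) 4 P := by
    have := gaussianReal_memLp_four δ
    rw [← (hWlaw i).map_eq] at this
    exact this.comp_of_map (hWlaw i).aemeasurable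
  have w1 : ∫ ω, W ω i ∂P = 0 := by
    have := (hWlaw i).integral_comp (f := fun x : ℝ => x) (by fun_prop)
    simpa [Function.comp_def, integral_id_gaussianReal] using this
  have w2 : ∫ ω, W ω i ^ 2 ∂P = δ := by
    have h1 := (hWlaw i).integral_comp (f := fun x : ℝ => x ^ 2) (by fun_prop)
    have h2 := variance_fun_id_gaussianReal (μ := 0) (v := δ)
    rw [variance_of_integral_eq_zero (by fun_prop) integral_id_gaussianReal] at h2
    rw [← h2, ← h1]; rfl
  have w3 : ∫ ω, W ω i ^ 4 ∂P = δ ^ 2 * g4 := by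
    rw [hg4, ← integral_pow_four_gaussianReal]
    exact (hWlaw i).integral_comp (f := fun x : ℝ => x ^ 4) (by fun_prop)
  have hind : IndepFun (fun ω => W ω i) (Z i) P :=
    hWZ.comp (measurable_pi_apply i) (measurable_pi_apply i)
  have hWi : Measurable fun ω => W ω i := (measurable_pi_apply i).comp hWm
  have prod : ∀ k l : ℕ, ∫ ω, W ω i ^ k * Z i ω ^ l ∂P
      = (∫ ω, W ω i ^ k ∂P) * ∫ ω, Z i ω ^ l ∂P := fun k l =>
    (hind.comp (φ := fun x => x ^ k) (ψ := fun x => x ^ l) (by fun_prop)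
      (by fun_prop)).integral_fun_mul_eq_mul_integral (hWi.pow_const k).aestronglyMeasurable
      ((hZi i).pow_const l).aestronglyMeasurable
  change MemLp (Z i) 4 P at z4
  change ∫ ω, Z i ω ∂P = 0 at z1
  change ∫ ω, Z i ω ^ 2 ∂P = _ at z2
  change ∫ ω, Z i ω ^ 4 ∂P ≤ _ at z3
  have w4' : MemLp (fun ω => W ω i) 2 P := w4.mono_exponent (by norm_num)
  have z4' : MemLp (Z i) 2 P := z4.mono_exponent (by norm_num)
  have hUL : MemLp (fun ω => r₁ * W ω i + r₂ * Z i ω) 4 P := (w4.const_mul _).add (z4.const_mul _)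
  have iw2 := w4'.integrable_sq
  have iz2 := z4'.integrable_sq
  have iwz : Integrable (fun ω => W ω i * Z i ω) P := w4'.integrable_mul z4'
  have mwz := memLp_mul_of_four w4 z4
  have mww := memLp_mul_of_four w4 w4
  have mzz := memLp_mul_of_four z4 z4
  have iw4 := MemLp.integrable_pow_four w4
  have iz4 := MemLp.integrable_pow_four z4
  have i31 : Integrable (fun ω => W ω i ^ 3 * Z i ω ^ 1) P :=
    (mww.integrable_mul mwz).congr (Eventually.of_forall fun ω => by simp only [Pi.mul_apply]; ring)
  have i22 : Integrable (fun ω => W ω i ^ 2 * Z i ω ^ 2) P :=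
    (mwz.integrable_mul mwz).congr (Eventually.of_forall fun ω => by simp only [Pi.mul_apply]; ring)
  have i13 : Integrable (fun ω => W ω i ^ 1 * Z i ω ^ 3) P :=
    (mwz.integrable_mul mzz).congr (Eventually.of_forall fun ω => by simp only [Pi.mul_apply]; ring)
  refine ⟨hUL.ae_eq (hUi i), ?_, ?_, ?_⟩
  · rw [← integral_congr_ae (hUi i), integral_add ((w4.integrable (by norm_num)).const_mul _)
      ((z4.integrable (by norm_num)).const_mul _), integral_const_mul, integral_const_mul, w1, z1]
    simp
  · refine (integral_congr_ae ((hUi i).fun_comp (· ^ 2))).symm.trans ?_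
    have e : (fun ω => (r₁ * W ω i + r₂ * Z i ω) ^ 2) = fun ω => r₁ ^ 2 * W ω i ^ 2
        + 2 * r₁ * r₂ * (W ω i * Z i ω) + r₂ ^ 2 * Z i ω ^ 2 := by ext; ring
    have p11 := prod 1 1
    simp only [pow_one, w1, zero_mul] at p11
    simp only [Function.comp_def] at e ⊢
    rw [e, integral_add, integral_add, integral_const_mul, integral_const_mul, integral_const_mul,
      w2, z2, p11]
    · simp only [rhoStar, NNReal.coe_mul]; ring
    all_goals fun_prop
  · refine (integral_congr_ae ((hUi i).fun_comp (· ^ 4))).symm.trans_le ?_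
    have e : (fun ω => (r₁ * W ω i + r₂ * Z i ω) ^ 4) = fun ω => r₁ ^ 4 * W ω i ^ 4
        + 4 * r₁ ^ 3 * r₂ * (W ω i ^ 3 * Z i ω ^ 1) + 6 * r₁ ^ 2 * r₂ ^ 2 * (W ω i ^ 2 * Z i ω ^ 2)
        + 4 * r₁ * r₂ ^ 3 * (W ω i ^ 1 * Z i ω ^ 3) + r₂ ^ 4 * Z i ω ^ 4 := by ext; ring
    have p31 := prod 3 1
    have p13 := prod 1 3
    have p22 := prod 2 2
    simp only [pow_one, w1, zero_mul] at p13
    simp only [pow_one, z1, mul_zero] at p31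
    rw [w2, z2] at p22
    simp only [pow_one] at i31 i13
    simp only [Function.comp_def, pow_one] at e ⊢
    rw [e, integral_add, integral_add, integral_add, integral_add, integral_const_mul,
      integral_const_mul, integral_const_mul, integral_const_mul, integral_const_mul, w3, p31, p13,
      p22]
    · have := mul_le_mul_of_nonneg_left z3 (show 0 ≤ r₂ ^ 4 by positivity)
      push_cast at this ⊢
      linarith
    all_goals fun_prop

end Increments

/-! ### Riemann sums against càdlàg paths -/

/-- The left-point Riemann sum of `∫_0^n f dy` over the uniform partition of `[0, n]`. -/
noncomputable def riemannSum (f : ℝ → ℝ) (y : ℝ≥0 → ℝ) (n m : ℕ) : ℝ :=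
  ∑ i ∈ Finset.range m,
    f (n * i / m) * (y ((n : ℝ≥0) * (i + 1) / m) - y ((n : ℝ≥0) * i / m))

lemma pathIntegral_eq_of_tendsto {f : ℝ → ℝ} {y : ℝ≥0 → ℝ} {n : ℕ} {l : ℝ}
    (h : Tendsto (riemannSum f y n) atTop (𝓝 l)) : pathIntegral f y n = l :=
  h.limUnder_eq

/-- Near each point the path is bounded, on the left by the left limit and on the right by right
continuity; compactness makes the bound global. -/
lemma IsCadlag.exists_bound {y : ℝ≥0 → ℝ} (hy : IsCadlag y) (b : ℝ≥0) :
    ∃ M, ∀ t ≤ b, |y t| ≤ M := by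
  have hK : IsCompact (Set.Icc 0 b) := isCompact_Icc
  have : ∃ M, ∀ t ∈ Set.Icc 0 b, |y t| ≤ M := by
    refine hK.induction_on (p := fun s => ∃ M, ∀ t ∈ s, |y t| ≤ M) ⟨0, by simp⟩
      (fun s t hst ⟨M, hM⟩ => ⟨M, fun x hx => hM x (hst hx)⟩)
      (fun s t ⟨M, hM⟩ ⟨M', hM'⟩ => ⟨max M M', ?_⟩) (fun t _ => ?_)
    · rintro x (hx | hx)
      · exact (hM x hx).trans (le_max_left _ _)
      · exact (hM' x hx).trans (le_max_right _ _)
    · obtain ⟨h1, l, h2⟩ := hy t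
      have e1 : ∀ᶠ x in 𝓝[≥] t, |y x| ≤ |y t| + 1 :=
        (h1.abs.eventually (gt_mem_nhds (lt_add_one _))).mono fun _ h => h.le
      have e2 : ∀ᶠ x in 𝓝[<] t, |y x| ≤ |l| + 1 :=
        (h2.abs.eventually (gt_mem_nhds (lt_add_one _))).mono fun _ h => h.le
      have e : ∀ᶠ x in 𝓝 t, |y x| ≤ max (|y t| + 1) (|l| + 1) := by
        rw [← nhdsLT_sup_nhdsGE, eventually_sup]
        exact ⟨e2.mono fun _ h => h.trans (le_max_right _ _),
          e1.mono fun _ h => h.trans (le_max_left _ _)⟩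
      exact ⟨_, mem_nhdsWithin_of_mem_nhds e, _, fun _ hx => hx⟩
  obtain ⟨M, hM⟩ := this
  exact ⟨M, fun t ht => hM t ⟨zero_le, ht⟩⟩

/-- The first point of the partition of `[0, n]` into `m` intervals that is at least `t`. -/
noncomputable def gridCeil (n m : ℕ) (t : ℝ) : ℝ≥0 := (n : ℝ≥0) * (⌈t / n * m⌉₊ : ℝ≥0) / m

lemma le_gridCeil {n m : ℕ} (hn : 0 < n) (hm : 0 < m) (t : ℝ) : t.toNNReal ≤ gridCeil n m t := by
  rw [← NNReal.coe_le_coe, gridCeil]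
  push_cast
  have hn' : (0 : ℝ) < n := by exact_mod_cast hn
  have hm' : (0 : ℝ) < m := by exact_mod_cast hm
  rw [Real.coe_toNNReal']
  refine max_le ?_ (by positivity)
  rw [le_div_iff₀ hm']
  have := mul_le_mul_of_nonneg_left (Nat.le_ceil (t / n * m)) hn'.le
  calc t * m = n * (t / n * m) := by field_simp
    _ ≤ _ := this

/-- The grid points approach t from the right, t included, which is the side on which a càdlàg path
is continuous. -/
lemma tendsto_gridCeil {n : ℕ} (hn : 0 < n) (t : ℝ) :
    Tendsto (fun m : ℕ => gridCeil n m t) atTop (𝓝[≥] t.toNNReal) := by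
  rw [tendsto_nhdsWithin_iff]
  refine ⟨?_, (eventually_gt_atTop 0).mono fun m hm => le_gridCeil hn hm t⟩
  rw [← NNReal.tendsto_coe]
  have hn' : (0 : ℝ) < n := by exact_mod_cast hn
  rw [Real.coe_toNNReal']
  rcases le_total 0 t with ht | ht
  · have h := (tendsto_nat_ceil_mul_div_atTop (R := ℝ) (a := t / n) (by positivity)).comp
      tendsto_natCast_atTop_atTop
    have h2 := h.const_mul (n : ℝ)
    rw [mul_div_cancel₀ _ hn'.ne'] at h2
    rw [max_eq_left ht]
    refine h2.congr fun m => ?_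
    simp only [Function.comp, gridCeil]
    push_cast
    ring
  · rw [max_eq_right ht]
    refine tendsto_const_nhds.congr fun m => ?_
    have : ⌈t / n * m⌉₊ = 0 := Nat.ceil_eq_zero.2
      (mul_nonpos_of_nonpos_of_nonneg (div_nonpos_of_nonpos_of_nonneg ht hn'.le) (by positivity))
    simp [gridCeil, this]

lemma measurable_comp_gridCeil (y : ℝ≥0 → ℝ) (n m : ℕ) :
    Measurable fun t => y (gridCeil n m t) :=
  (measurable_from_nat (f := fun k : ℕ => y ((n : ℝ≥0) * (k : ℝ≥0) / m))).comp
    (Nat.measurable_ceil.comp (by fun_prop))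

lemma IsCadlag.tendsto_comp_gridCeil {y : ℝ≥0 → ℝ} (hy : IsCadlag y) {n : ℕ} (hn : 0 < n) (t : ℝ) :
    Tendsto (fun m : ℕ => y (gridCeil n m t)) atTop (𝓝 (y t.toNNReal)) :=
  (hy t.toNNReal).1.tendsto.comp (tendsto_gridCeil hn t)

lemma IsCadlag.measurable {y : ℝ≥0 → ℝ} (hy : IsCadlag y) : Measurable fun t : ℝ => y t.toNNReal :=
  measurable_of_tendsto_metrizable (fun m => measurable_comp_gridCeil y 1 m)
    (tendsto_pi_nhds.2 fun t => hy.tendsto_comp_gridCeil one_pos t)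

lemma IsCadlag.intervalIntegrable {y : ℝ≥0 → ℝ} (hy : IsCadlag y) {b : ℝ} (hb : 0 ≤ b) :
    IntervalIntegrable (fun t : ℝ => y t.toNNReal) volume 0 b := by
  obtain ⟨M, hM⟩ := hy.exists_bound b.toNNReal
  rw [intervalIntegrable_iff_integrableOn_Ioc_of_le hb]
  refine Measure.integrableOn_of_bounded (M := M) (by simp) hy.measurable.aestronglyMeasurable ?_
  filter_upwards [ae_restrict_mem measurableSet_Ioc] with t ht
  exact hM _ (Real.toNNReal_le_toNNReal ht.2)

lemma grid_mono {n m i j : ℕ} (h : i ≤ j) : (n * i / m : ℝ) ≤ n * j / m := by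
  gcongr

lemma gridCeil_of_mem {n m i : ℕ} (hn : 0 < n) (hm : 0 < m) {t : ℝ}
    (ht : t ∈ Set.Ioc (n * i / m : ℝ) (n * (i + 1 : ℕ) / m)) :
    gridCeil n m t = (n : ℝ≥0) * (i + 1) / m := by
  have hn' : (0 : ℝ) < n := by exact_mod_cast hn
  have hm' : (0 : ℝ) < m := by exact_mod_cast hm
  have : ⌈t / n * m⌉₊ = i + 1 := by
    rw [Nat.ceil_eq_iff (by simp)]
    obtain ⟨h1, h2⟩ := ht
    rw [div_lt_iff₀ hm'] at h1
    rw [le_div_iff₀ hm'] at h2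
    constructor
    · simp only [Nat.add_sub_cancel]
      rw [div_mul_eq_mul_div, lt_div_iff₀ hn']; linarith
    · rw [div_mul_eq_mul_div, div_le_iff₀ hn']; linarith
  rw [gridCeil, this]; push_cast; rfl

/-- Step approximations of a càdlàg path, integrated against an integrable function. -/
theorem IsCadlag.tendsto_step_sum {y : ℝ≥0 → ℝ} (hy : IsCadlag y) {n : ℕ} (hn : 0 < n) {g : ℝ → ℝ}
    (hg : IntervalIntegrable g volume 0 n) :
    Tendsto (fun m : ℕ => ∑ i ∈ Finset.range m, y ((n : ℝ≥0) * (i + 1) / m) *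
      ∫ t in (n * i / m : ℝ)..(n * (i + 1 : ℕ) / m), g t) atTop
      (𝓝 (∫ t in (0 : ℝ)..n, y t.toNNReal * g t)) := by
  have hn' : (0 : ℝ) < n := by exact_mod_cast hn
  obtain ⟨M, hM⟩ := hy.exists_bound n
  have hbd : ∀ m : ℕ, 0 < m → ∀ t ∈ Set.uIoc (0 : ℝ) n, |y (gridCeil n m t)| ≤ M := by
    intro m hm t ht
    rw [Set.uIoc_of_le hn'.le] at ht
    have hm' : (0 : ℝ) < m := by exact_mod_cast hm
    refine hM _ ?_
    have : ⌈t / n * m⌉₊ ≤ m := by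
      rw [Nat.ceil_le]
      exact mul_le_of_le_one_left hm'.le ((div_le_one hn').2 ht.2)
    rw [gridCeil]
    apply div_le_of_le_mul₀ zero_le zero_le
    gcongr
  have hint : ∀ m : ℕ, 0 < m → IntervalIntegrable (fun t => y (gridCeil n m t) * g t) volume 0 n := by
    intro m hm
    rw [intervalIntegrable_iff] at hg ⊢
    refine Integrable.bdd_mul hg (measurable_comp_gridCeil y n m).aestronglyMeasurable (c := M) ?_
    filter_upwards [ae_restrict_mem measurableSet_uIoc] with t ht using hbd m hm t ht
  have hsum : ∀ m : ℕ, 0 < m → ∑ i ∈ Finset.range m, y ((n : ℝ≥0) * (i + 1) / m) *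
      ∫ t in (n * i / m : ℝ)..(n * (i + 1 : ℕ) / m), g t
      = ∫ t in (0 : ℝ)..n, y (gridCeil n m t) * g t := by
    intro m hm
    have h0 : (0 : ℝ) = n * (0 : ℕ) / m := by simp
    have h1 : (n : ℝ) = n * m / m := by field_simp
    have e : ∫ t in (0 : ℝ)..n, y (gridCeil n m t) * g t
        = ∫ t in (n * (0 : ℕ) / m : ℝ)..(n * (m : ℕ) / m), y (gridCeil n m t) * g t := by
      rw [← h0, ← h1]
    rw [e, ← intervalIntegral.sum_integral_adjacent_intervals (a := fun k : ℕ => (n * k / m : ℝ))]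
    · refine Finset.sum_congr rfl fun i _ => ?_
      rw [← intervalIntegral.integral_const_mul]
      refine intervalIntegral.integral_congr_ae (Eventually.of_forall fun t ht => ?_)
      rw [Set.uIoc_of_le (grid_mono (Nat.le_succ i))] at ht
      rw [gridCeil_of_mem hn hm ht]
    · intro k hk
      refine (hint m hm).mono_set ?_
      rw [Set.uIcc_of_le (grid_mono (Nat.le_succ k)), Set.uIcc_of_le hn'.le, h0]
      refine Set.Icc_subset_Icc (grid_mono (Nat.zero_le _)) ?_
      calc (n * (k + 1 : ℕ) / m : ℝ) ≤ n * m / m := grid_mono hk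
        _ = n := h1.symm
  -- The sum is the integral of the step function built from right endpoints. It converges at every
  -- t, and dominated convergence applies because the path is bounded.
  refine Tendsto.congr' ((eventually_gt_atTop 0).mono fun m hm => (hsum m hm).symm) ?_
  refine intervalIntegral.tendsto_integral_filter_of_dominated_convergence (fun t => M * |g t|)
    ?_ ?_ (hg.abs.const_mul M) ?_
  · filter_upwards [eventually_gt_atTop 0] with m hm
    exact (intervalIntegrable_iff.1 (hint m hm)).aestronglyMeasurable
  · filter_upwards [eventually_gt_atTop 0] with m hm
    refine Eventually.of_forall fun t ht => ?_
    rw [Real.norm_eq_abs, abs_mul]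
    exact mul_le_mul_of_nonneg_right (hbd m hm t ht) (abs_nonneg _)
  · exact Eventually.of_forall fun t _ => (hy.tendsto_comp_gridCeil hn t).mul_const _

/-- The Riemann sums of `∫ f dy` converge, to the expression given by integration by parts. -/
theorem IsCadlag.tendsto_riemannSum {y : ℝ≥0 → ℝ} (hy : IsCadlag y) {n : ℕ} (hn : 0 < n)
    {f f' : ℝ → ℝ} (hf : ∀ x, HasDerivAt f (f' x) x) (hf' : Continuous f') :
    Tendsto (riemannSum f y n) atTop
      (𝓝 (f n * y n - f 0 * y 0 - ∫ t in (0 : ℝ)..n, y t.toNNReal * f' t)) := by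
  have h := (hy.tendsto_step_sum hn (hf'.intervalIntegrable 0 n)).const_sub
    (f n * y n - f 0 * y 0)
  refine h.congr' ((eventually_gt_atTop 0).mono fun m hm => ?_)
  have hm' : (m : ℝ) ≠ 0 := by positivity
  have hm'' : (m : ℝ≥0) ≠ 0 := by positivity
  have e : ∀ i : ℕ, ∫ t in (n * i / m : ℝ)..(n * (i + 1 : ℕ) / m), f' t
      = f (n * (i + 1 : ℕ) / m) - f (n * i / m) := fun i =>
    intervalIntegral.integral_eq_sub_of_hasDerivAt (fun x _ => hf x) (hf'.intervalIntegrable _ _)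
  -- Summation by parts: f_i(y_{i+1} - y_i) = (f_{i+1}y_{i+1} - f_iy_i) - y_{i+1}(f_{i+1} - f_i).
  -- Left points for f become right points for y, as the step approximation requires.
  have tel := Finset.sum_range_sub
    (fun i : ℕ => f (n * i / m) * y ((n : ℝ≥0) * i / m)) m
  simp only [Nat.cast_zero, mul_zero, zero_div, mul_div_cancel_right₀ _ hm',
    mul_div_cancel_right₀ _ hm''] at tel
  rw [← tel, riemannSum, ← Finset.sum_sub_distrib]
  refine Finset.sum_congr rfl fun i _ => ?_
  rw [e]
  push_cast
  ring

lemma riemannSum_add (f : ℝ → ℝ) (y z : ℝ≥0 → ℝ) (n m : ℕ) :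
    riemannSum f (fun t => y t + z t) n m = riemannSum f y n m + riemannSum f z n m := by
  simp only [riemannSum, ← Finset.sum_add_distrib]
  exact Finset.sum_congr rfl fun i _ => by ring

/-- Integration by parts against an indefinite integral. -/
lemma integral_mul_eq_parts {f f' S : ℝ → ℝ} (hf : ∀ x, HasDerivAt f (f' x) x)
    (hf' : Continuous f') {b : ℝ} (hS : IntervalIntegrable S volume 0 b) :
    ∫ t in (0 : ℝ)..b, f t * S t
      = f b * (∫ t in (0 : ℝ)..b, S t) - ∫ t in (0 : ℝ)..b, (∫ s in (0 : ℝ)..t, S s) * f' t := by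
  have hd : deriv f = f' := funext fun x => (hf x).deriv
  have hfc : ContDiff ℝ 1 f := contDiff_one_iff_deriv.2 ⟨fun x => (hf x).differentiableAt, hd ▸ hf'⟩
  -- S is merely integrable, so its primitive is only absolutely continuous, with derivative S
  -- almost everywhere.
  have h := AbsolutelyContinuousOnInterval.integral_mul_deriv_eq_deriv_mul
    (hfc.contDiffOn.absolutelyContinuousOnInterval (a := 0) (b := b))
    (hS.absolutelyContinuousOnInterval_intervalIntegral (c := 0) (by simp))
  simp only [intervalIntegral.integral_same, mul_zero, sub_zero, hd] at h
  rw [show (∫ t in (0 : ℝ)..b, (∫ s in (0 : ℝ)..t, S s) * f' t)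
    = ∫ t in (0 : ℝ)..b, f' t * (∫ s in (0 : ℝ)..t, S s) by simp_rw [mul_comm], ← h]
  refine intervalIntegral.integral_congr_ae ?_
  filter_upwards [hS.ae_hasDerivAt_integral] with x hx hxm
  rw [(hx (Set.uIoc_subset_uIcc hxm) 0 (by simp)).deriv]

lemma isCadlag_of_continuous {y : ℝ≥0 → ℝ} (hy : Continuous y) : IsCadlag y := fun t =>
  ⟨hy.continuousWithinAt, y t, (hy.tendsto t).mono_left nhdsWithin_le_nhds⟩

lemma continuous_primitive_toNNReal {S : ℝ → ℝ} (hS : ∀ b, IntervalIntegrable S volume 0 b) :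
    Continuous fun t : ℝ => ∫ s in (0 : ℝ)..t, S s :=
  intervalIntegral.continuous_primitive (fun a b => (hS a).symm.trans (hS b)) 0

/-- The Riemann sums against a primitive converge to the ordinary integral. -/
theorem tendsto_riemannSum_primitive {S : ℝ → ℝ} (hS : ∀ b, IntervalIntegrable S volume 0 b)
    {n : ℕ} (hn : 0 < n) {f f' : ℝ → ℝ} (hf : ∀ x, HasDerivAt f (f' x) x) (hf' : Continuous f') :
    Tendsto (riemannSum f (fun t => ∫ s in (0 : ℝ)..t, S s) n) atTop
      (𝓝 (∫ t in (0 : ℝ)..n, f t * S t)) := by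
  have hc : Continuous fun t : ℝ≥0 => ∫ s in (0 : ℝ)..t, S s :=
    (continuous_primitive_toNNReal hS).comp NNReal.continuous_coe
  have h := (isCadlag_of_continuous hc).tendsto_riemannSum hn hf hf'
  rw [integral_mul_eq_parts hf hf' (hS n)]
  convert! h using 2
  simp only [NNReal.coe_zero, intervalIntegral.integral_same, mul_zero, sub_zero,
    NNReal.coe_natCast]
  congr 1
  refine intervalIntegral.integral_congr fun t ht => ?_
  rw [Set.uIcc_of_le (by positivity)] at ht
  simp only [Real.coe_toNNReal t ht.1]

/-! ### The Ornstein–Uhlenbeck filter -/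

/-- `∫_s^b e^{a (t - s)} f(t) dt`. -/
noncomputable def backKernel (a b : ℝ) (f : ℝ → ℝ) (s : ℝ) : ℝ :=
  Real.exp (-(a * s)) * ∫ t in s..b, Real.exp (a * t) * f t

/-- The integrand `g` for which `∫_0^b f dξ = ∫_0^b g du`. -/
noncomputable def ouFilter (a b : ℝ) (f : ℝ → ℝ) (s : ℝ) : ℝ := f s + a * backKernel a b f s

section Filter

variable {a b : ℝ} {f f' : ℝ → ℝ}

lemma backKernel_end : backKernel a b f b = 0 := by simp [backKernel]

lemma ouFilter_end : ouFilter a b f b = f b := by simp [ouFilter, backKernel_end]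

lemma hasDerivAt_backKernel (hf : Continuous f) (s : ℝ) :
    HasDerivAt (backKernel a b f) (-f s - a * backKernel a b f s) s := by
  have hc : Continuous fun t => Real.exp (a * t) * f t := by fun_prop
  have h1 : HasDerivAt (fun s => ∫ t in s..b, Real.exp (a * t) * f t)
      (-(Real.exp (a * s) * f s)) s :=
    intervalIntegral.integral_hasDerivAt_left (hc.intervalIntegrable _ _)
      (hc.stronglyMeasurableAtFilter _ _) hc.continuousAt
  have h2 : HasDerivAt (fun s => Real.exp (-(a * s))) (Real.exp (-(a * s)) * (-(a * 1))) s :=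
    (((hasDerivAt_id s).const_mul a).neg).exp
  convert! h2.mul h1 using 1
  have : Real.exp (-(a * s)) * Real.exp (a * s) = 1 := by rw [← Real.exp_add]; simp
  simp only [backKernel]
  linear_combination (f s) * this

lemma continuous_backKernel (hf : Continuous f) : Continuous (backKernel a b f) :=
  continuous_iff_continuousAt.2 fun s => (hasDerivAt_backKernel hf s).continuousAt

lemma continuous_ouFilter (hf : Continuous f) : Continuous (ouFilter a b f) :=
  hf.add ((continuous_backKernel hf).const_mul a)

lemma hasDerivAt_ouFilter (hf : ∀ x, HasDerivAt f (f' x) x) (s : ℝ) :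
    HasDerivAt (ouFilter a b f) (f' s - a * ouFilter a b f s) s := by
  have hc : Continuous f := continuous_iff_continuousAt.2 fun s => (hf s).continuousAt
  convert! (hf s).add ((hasDerivAt_backKernel (a := a) (b := b) hc s).const_mul a) using 1
  simp only [ouFilter]; ring

/-- The integral of `f` against an Ornstein–Uhlenbeck path is the integral of the filtered function
against the driving path. -/
theorem exists_tendsto_riemannSum_ou {ξ u : ℝ≥0 → ℝ} (hξ : IsCadlag ξ) (h0 : ξ 0 = 0)
    (heq : ∀ t : ℝ≥0, ξ t = a * (∫ s in (0 : ℝ)..t, ξ s.toNNReal) + u t)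
    (hf : ∀ x, HasDerivAt f (f' x) x) (hf' : Continuous f') {n : ℕ} (hn : 0 < n) :
    ∃ I, Tendsto (riemannSum f ξ n) atTop (𝓝 I) ∧
      Tendsto (riemannSum (ouFilter a n f) u n) atTop (𝓝 I) := by
  have hn' : (0 : ℝ) ≤ n := by positivity
  have hint : ∀ b : ℝ, 0 ≤ b → IntervalIntegrable (fun t : ℝ => ξ t.toNNReal) volume 0 b :=
    fun b hb => hξ.intervalIntegrable hb
  have hint' : ∀ b : ℝ, IntervalIntegrable (fun t : ℝ => ξ t.toNNReal) volume 0 b := by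
    intro b
    rcases le_total 0 b with hb | hb
    · exact hint b hb
    -- On the negative half-line `toNNReal` is zero, so the extended path is constant there.
    · refine (intervalIntegrable_const (c := ξ 0)).congr ?_
      intro t ht
      rw [Set.uIoc_of_ge hb] at ht
      simp [Real.toNNReal_of_nonpos ht.2]
  set X : ℝ → ℝ := fun t => ∫ s in (0 : ℝ)..t, ξ s.toNNReal with hX
  have hXc : Continuous X := continuous_primitive_toNNReal hint'
  have hu : u = fun t => ξ t - a * X t := funext fun t => by
    have := heq t
    simp only [hX]; linarith
  have huc : IsCadlag u := by
    intro t
    obtain ⟨h1, l, h2⟩ := hξ t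
    have hXt : ContinuousAt (fun t : ℝ≥0 => a * X t) t :=
      ((hXc.comp NNReal.continuous_coe).const_mul a).continuousAt
    rw [hu]
    exact ⟨h1.sub hXt.continuousWithinAt, l - a * X t,
      h2.sub (hXt.tendsto.mono_left nhdsWithin_le_nhds)⟩
  have hfc : Continuous f := continuous_iff_continuousAt.2 fun s => (hf s).continuousAt
  have hgc := continuous_ouFilter (a := a) (b := n) hfc
  have hgd := hasDerivAt_ouFilter (a := a) (b := n) hf
  have hgc' : Continuous fun s => f' s - a * ouFilter a n f s := hf'.sub (hgc.const_mul a)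
  refine ⟨_, hξ.tendsto_riemannSum hn hf hf', ?_⟩
  convert! huc.tendsto_riemannSum hn hgd hgc' using 2
  -- With g' = f' - a g, u = ξ - aX and X' = ξ almost everywhere, this turns ∫ u g' into ∫ ξ f' - a
  -- g(n)X(n). Since g(n) = f(n), the boundary terms of the two integrations by parts then agree.
  have hparts := integral_mul_eq_parts hgd hgc' (hint' n)
  have hu0 : u 0 = 0 := by rw [hu]; simp [h0, hX]
  have hXi : IntervalIntegrable (fun t => X t * (f' t - a * ouFilter a n f t)) volume 0 n :=
    (hXc.mul hgc').intervalIntegrable _ _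
  have e : ∫ t in (0 : ℝ)..n, u t.toNNReal * (f' t - a * ouFilter a n f t)
      = ∫ t in (0 : ℝ)..n, (ξ t.toNNReal * f' t - a * (ouFilter a n f t * ξ t.toNNReal)
        - a * (X t * (f' t - a * ouFilter a n f t))) := by
    refine intervalIntegral.integral_congr fun t ht => ?_
    rw [Set.uIcc_of_le hn'] at ht
    simp only [hu, Real.coe_toNNReal t ht.1]
    ring
  have i1 : IntervalIntegrable (fun t : ℝ => ξ t.toNNReal * f' t) volume 0 n :=
    (hint' n).mul_continuousOn hf'.continuousOn
  have i2 : IntervalIntegrable (fun t : ℝ => ouFilter a n f t * ξ t.toNNReal) volume 0 n :=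
    (hint' n).continuousOn_mul hgc.continuousOn
  rw [e, intervalIntegral.integral_sub (i1.sub (i2.const_mul a)) (hXi.const_mul a),
    intervalIntegral.integral_sub i1 (i2.const_mul a), intervalIntegral.integral_const_mul,
    intervalIntegral.integral_const_mul, hparts, ouFilter_end, h0, hu0, hu]
  simp only [hX, NNReal.coe_natCast]
  ring

lemma backKernel_add_const_mul {F : ℕ+ → ℝ → ℝ} (hF : ∀ j, Continuous (F j)) (c : ℕ+ → ℝ)
    (T : Finset ℕ+) (s : ℝ) : backKernel a b (fun t => ∑ j ∈ T, c j * F j t) s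
      = ∑ j ∈ T, c j * backKernel a b (F j) s := by
  simp only [backKernel, Finset.mul_sum]
  rw [intervalIntegral.integral_finsetSum]
  · rw [Finset.mul_sum]
    refine Finset.sum_congr rfl fun j _ => ?_
    rw [← intervalIntegral.integral_const_mul, ← intervalIntegral.integral_const_mul,
      ← intervalIntegral.integral_const_mul]
    congr 1; funext t; ring
  · intro j _
    exact Continuous.intervalIntegrable (by fun_prop) _ _

lemma ouFilter_sum {F : ℕ+ → ℝ → ℝ} (hF : ∀ j, Continuous (F j)) (c : ℕ+ → ℝ)
    (T : Finset ℕ+) (s : ℝ) : ouFilter a b (fun t => ∑ j ∈ T, c j * F j t) s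
      = ∑ j ∈ T, c j * ouFilter a b (F j) s := by
  simp only [ouFilter, backKernel_add_const_mul hF, Finset.mul_sum, ← Finset.sum_add_distrib]
  exact Finset.sum_congr rfl fun j _ => by ring

/-- The energy lost by the filter. -/
theorem integral_ouFilter_sq (hf : Continuous f) :
    ∫ s in (0 : ℝ)..b, f s ^ 2 = (∫ s in (0 : ℝ)..b, ouFilter a b f s ^ 2)
      + a ^ 2 * (∫ s in (0 : ℝ)..b, backKernel a b f s ^ 2) - a * backKernel a b f 0 ^ 2 := by
  have hk := continuous_backKernel (a := a) (b := b) hf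
  have hg := continuous_ouFilter (a := a) (b := b) hf
  -- The kernel term k satisfies k' = -g and k(b) = 0, so the cross term in f² = (g - a k)² is a
  -- multiple of (k²)' and integrates to a boundary value.
  have h : ∫ s in (0 : ℝ)..b, 2 * backKernel a b f s * (-ouFilter a b f s)
      = backKernel a b f b ^ 2 - backKernel a b f 0 ^ 2 := by
    refine intervalIntegral.integral_eq_sub_of_hasDerivAt (f := fun s => backKernel a b f s ^ 2)
      (fun s _ => ?_) (Continuous.intervalIntegrable (by fun_prop) _ _)
    convert! (hasDerivAt_backKernel (a := a) (b := b) hf s).pow 2 using 1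
    simp only [ouFilter]; push_cast; ring
  rw [backKernel_end] at h
  have e : (fun s => f s ^ 2) = fun s => ouFilter a b f s ^ 2 + a ^ 2 * backKernel a b f s ^ 2
      + a * (2 * backKernel a b f s * (-ouFilter a b f s)) := by
    funext s; simp only [ouFilter]; ring
  rw [e, intervalIntegral.integral_add, intervalIntegral.integral_add,
    intervalIntegral.integral_const_mul, intervalIntegral.integral_const_mul, h]
  · ring
  all_goals exact Continuous.intervalIntegrable (by fun_prop) _ _

/-- Both correction terms of the energy identity have a favourable sign when a ≤ 0: the filter is a
contraction of L²[0,b]. -/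
lemma integral_ouFilter_sq_le (ha : a ≤ 0) (hb : 0 ≤ b) (hf : Continuous f) :
    ∫ s in (0 : ℝ)..b, ouFilter a b f s ^ 2 ≤ ∫ s in (0 : ℝ)..b, f s ^ 2 := by
  rw [integral_ouFilter_sq (a := a) hf]
  have h1 : 0 ≤ ∫ s in (0 : ℝ)..b, backKernel a b f s ^ 2 :=
    intervalIntegral.integral_nonneg hb fun _ _ => sq_nonneg _
  have h2 : 0 ≤ a ^ 2 * ∫ s in (0 : ℝ)..b, backKernel a b f s ^ 2 := by positivity
  have h3 : 0 ≤ -a * backKernel a b f 0 ^ 2 := mul_nonneg (by linarith) (sq_nonneg _)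
  linarith

/-- Integrate by parts. For a ≤ 0 the weight e^{at} is monotone, so its variation e^{as} - e^{ab}
and the two boundary values add up to 2e^{as}. The bound depends neither on the length of the
interval nor on a. -/
lemma abs_backKernel_le_of_primitive {F : ℝ → ℝ} (hF : ∀ x, HasDerivAt F (f x) x)
    (hf : Continuous f) {M : ℝ} (hM : ∀ x, |F x| ≤ M) (ha : a ≤ 0) {s : ℝ} (hs : s ≤ b) :
    |backKernel a b f s| ≤ 2 * M := by
  have hFc : Continuous F := continuous_iff_continuousAt.2 fun s => (hF s).continuousAt
  have hE : ∀ t, HasDerivAt (fun t => Real.exp (a * t)) (a * Real.exp (a * t)) t := fun t => by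
    convert! ((hasDerivAt_id t).const_mul a).exp using 1
    simp; ring
  have hp := intervalIntegral.integral_mul_deriv_eq_deriv_mul (a := s) (b := b)
    (fun t _ => hE t) (fun t _ => hF t)
    (Continuous.intervalIntegrable (by fun_prop) _ _) (hf.intervalIntegrable _ _)
  have hi : |∫ t in s..b, a * Real.exp (a * t) * F t| ≤ (Real.exp (a * s) - Real.exp (a * b)) * M := by
    have h1 : ∫ t in s..b, -(a * Real.exp (a * t)) * M = (Real.exp (a * s) - Real.exp (a * b)) * M := by
      rw [intervalIntegral.integral_mul_const, intervalIntegral.integral_neg,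
        intervalIntegral.integral_eq_sub_of_hasDerivAt (fun t _ => hE t)
          (Continuous.intervalIntegrable (by fun_prop) _ _)]
      ring
    rw [← h1]
    refine (intervalIntegral.abs_integral_le_integral_abs hs).trans ?_
    refine intervalIntegral.integral_mono_on hs (Continuous.intervalIntegrable (by fun_prop) _ _)
      (Continuous.intervalIntegrable (by fun_prop) _ _) fun t _ => ?_
    rw [abs_mul, abs_mul, abs_of_nonpos ha, abs_of_pos (Real.exp_pos _)]
    have := mul_nonneg (neg_nonneg.2 ha) (Real.exp_pos (a * t)).le
    rw [← neg_mul]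
    exact mul_le_mul_of_nonneg_left (hM t) this
  have hmain : |∫ t in s..b, Real.exp (a * t) * f t| ≤ Real.exp (a * s) * (2 * M) := by
    rw [hp]
    have e1 : |Real.exp (a * b) * F b| ≤ Real.exp (a * b) * M := by
      rw [abs_mul, abs_of_pos (Real.exp_pos _)]
      exact mul_le_mul_of_nonneg_left (hM b) (Real.exp_pos _).le
    have e2 : |Real.exp (a * s) * F s| ≤ Real.exp (a * s) * M := by
      rw [abs_mul, abs_of_pos (Real.exp_pos _)]
      exact mul_le_mul_of_nonneg_left (hM s) (Real.exp_pos _).le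
    calc _ ≤ |Real.exp (a * b) * F b - Real.exp (a * s) * F s|
          + |∫ t in s..b, a * Real.exp (a * t) * F t| := abs_sub _ _
      _ ≤ (|Real.exp (a * b) * F b| + |Real.exp (a * s) * F s|)
          + |∫ t in s..b, a * Real.exp (a * t) * F t| := by gcongr; exact abs_sub _ _
      _ ≤ _ := by linarith
  rw [backKernel, abs_mul, abs_of_pos (Real.exp_pos _)]
  calc _ ≤ Real.exp (-(a * s)) * (Real.exp (a * s) * (2 * M)) :=
        mul_le_mul_of_nonneg_left hmain (Real.exp_pos _).le
    _ = 2 * M := by rw [← mul_assoc, ← Real.exp_add]; simp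

/-- The kernel |a|e^{a(t-s)} has total mass at most 1 on [s, b], so the correction never exceeds the
sup norm of f. -/
lemma abs_ouFilter_le (hf : Continuous f) {M : ℝ} (hM : ∀ x, |f x| ≤ M) (ha : a ≤ 0) {s : ℝ}
    (hs : s ≤ b) : |ouFilter a b f s| ≤ 2 * M := by
  have hMnn : 0 ≤ M := (abs_nonneg _).trans (hM 0)
  have hE : ∀ t, HasDerivAt (fun t => Real.exp (a * t)) (a * Real.exp (a * t)) t := fun t => by
    convert! ((hasDerivAt_id t).const_mul a).exp using 1
    simp; ring
  have hi : |∫ t in s..b, -a * (Real.exp (a * t) * f t)|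
      ≤ (Real.exp (a * s) - Real.exp (a * b)) * M := by
    have h1 : ∫ t in s..b, -(a * Real.exp (a * t)) * M = (Real.exp (a * s) - Real.exp (a * b)) * M := by
      rw [intervalIntegral.integral_mul_const, intervalIntegral.integral_neg,
        intervalIntegral.integral_eq_sub_of_hasDerivAt (fun t _ => hE t)
          (Continuous.intervalIntegrable (by fun_prop) _ _)]
      ring
    rw [← h1]
    refine (intervalIntegral.abs_integral_le_integral_abs hs).trans ?_
    refine intervalIntegral.integral_mono_on hs (Continuous.intervalIntegrable (by fun_prop) _ _)
      (Continuous.intervalIntegrable (by fun_prop) _ _) fun t _ => ?_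
    have := mul_nonneg (neg_nonneg.2 ha) (Real.exp_pos (a * t)).le
    rw [abs_mul, abs_mul, abs_neg, abs_of_nonpos ha, abs_of_pos (Real.exp_pos _), ← mul_assoc,
      ← neg_mul]
    exact mul_le_mul_of_nonneg_left (hM t) this
  rw [intervalIntegral.integral_const_mul] at hi
  have hk : |a * backKernel a b f s| ≤ M := by
    have e : a * backKernel a b f s
        = -(Real.exp (-(a * s)) * (-a * ∫ t in s..b, Real.exp (a * t) * f t)) := by
      simp only [backKernel]; ring
    rw [e, abs_neg, abs_mul, abs_of_pos (Real.exp_pos _)]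
    calc _ ≤ Real.exp (-(a * s)) * ((Real.exp (a * s) - Real.exp (a * b)) * M) :=
          mul_le_mul_of_nonneg_left hi (Real.exp_pos _).le
      _ ≤ Real.exp (-(a * s)) * (Real.exp (a * s) * M) := by
          have := (Real.exp_pos (a * b)).le
          gcongr; linarith
      _ = M := by rw [← mul_assoc, ← Real.exp_add]; simp
  calc |ouFilter a b f s| ≤ |f s| + |a * backKernel a b f s| := abs_add_le _ _
    _ ≤ 2 * M := by linarith [hM s]

end Filter

/-! ### The trigonometric basis -/

lemma trigBasis_cases (j : ℕ+) :
    (trigBasis j = fun _ => 1) ∨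
    (∃ l : ℕ, 0 < l ∧ (j : ℕ) = 2 * l ∧
      trigBasis j = fun x => √2 * Real.cos (2 * Real.pi * l * x)) ∨
    (∃ l : ℕ, 0 < l ∧ (j : ℕ) = 2 * l + 1 ∧
      trigBasis j = fun x => √2 * Real.sin (2 * Real.pi * l * x)) := by
  have hj := j.pos
  by_cases h1 : j = 1
  · left; funext x; simp [trigBasis, h1]
  right
  have hj1 : (j : ℕ) ≠ 1 := fun h => h1 (PNat.coe_eq_one_iff.1 h)
  rcases Nat.even_or_odd' (j : ℕ) with ⟨l, hl | hl⟩
  · left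
    refine ⟨l, by omega, hl, ?_⟩
    have : Even (j : ℕ) := ⟨l, by omega⟩
    funext x
    rw [trigBasis, if_neg h1, if_pos this, show (j : ℕ) / 2 = l by omega]
  · right
    refine ⟨l, by omega, hl, ?_⟩
    have : ¬ Even (j : ℕ) := by rw [Nat.not_even_iff_odd]; exact ⟨l, hl⟩
    funext x
    rw [trigBasis, if_neg h1, if_neg this, show (j : ℕ) / 2 = l by omega]

lemma hasDerivAt_sin_mul (c x : ℝ) :
    HasDerivAt (fun x => Real.sin (c * x)) (c * Real.cos (c * x)) x := by
  convert! ((hasDerivAt_id x).const_mul c).sin using 1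
  simp; ring

lemma hasDerivAt_cos_mul (c x : ℝ) :
    HasDerivAt (fun x => Real.cos (c * x)) (-(c * Real.sin (c * x))) x := by
  convert! ((hasDerivAt_id x).const_mul c).cos using 1
  simp; ring

lemma exists_hasDerivAt_trigBasis (j : ℕ+) :
    ∃ f' : ℝ → ℝ, (∀ x, HasDerivAt (trigBasis j) (f' x) x) ∧ Continuous f' := by
  rcases trigBasis_cases j with h | ⟨l, _, _, h⟩ | ⟨l, _, _, h⟩ <;> rw [h]
  · exact ⟨fun _ => 0, fun x => hasDerivAt_const x 1, continuous_const⟩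
  · exact ⟨_, fun x => (hasDerivAt_cos_mul _ x).const_mul _, by fun_prop⟩
  · exact ⟨_, fun x => (hasDerivAt_sin_mul _ x).const_mul _, by fun_prop⟩

lemma continuous_trigBasis (j : ℕ+) : Continuous (trigBasis j) := by
  obtain ⟨f', h, _⟩ := exists_hasDerivAt_trigBasis j
  exact continuous_iff_continuousAt.2 fun s => (h s).continuousAt

lemma abs_trigBasis_le (j : ℕ+) (x : ℝ) : |trigBasis j x| ≤ √2 := by
  rcases trigBasis_cases j with h | ⟨l, _, _, h⟩ | ⟨l, _, _, h⟩ <;> rw [h]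
  · simp
  · rw [abs_mul, abs_of_nonneg (Real.sqrt_nonneg _)]
    exact mul_le_of_le_one_right (Real.sqrt_nonneg _) (Real.abs_cos_le_one _)
  · rw [abs_mul, abs_of_nonneg (Real.sqrt_nonneg _)]
    exact mul_le_of_le_one_right (Real.sqrt_nonneg _) (Real.abs_sin_le_one _)

lemma periodic_trigBasis (j : ℕ+) : Function.Periodic (trigBasis j) 1 := by
  intro x
  rcases trigBasis_cases j with h | ⟨l, _, _, h⟩ | ⟨l, _, _, h⟩ <;> rw [h]
  · have : 2 * Real.pi * l * (x + 1) = 2 * Real.pi * l * x + l * (2 * Real.pi) := by ring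
    simp only [this, Real.cos_add_nat_mul_two_pi]
  · have : 2 * Real.pi * l * (x + 1) = 2 * Real.pi * l * x + l * (2 * Real.pi) := by ring
    simp only [this, Real.sin_add_nat_mul_two_pi]

lemma integral_periodic_nat {f : ℝ → ℝ} (hf : Function.Periodic f 1)
    (hi : ∀ a b, IntervalIntegrable f volume a b) (n : ℕ) :
    ∫ t in (0 : ℝ)..n, f t = n * ∫ t in (0 : ℝ)..1, f t := by
  have := hf.intervalIntegral_add_zsmul_eq n 0 hi
  simpa using this

lemma integral_cos_int (k : ℤ) (hk : k ≠ 0) :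
    ∫ x in (0 : ℝ)..1, Real.cos (2 * Real.pi * k * x) = 0 := by
  have hc : (2 * Real.pi * k : ℝ) ≠ 0 := by
    positivity
  rw [intervalIntegral.integral_comp_mul_left (fun x => Real.cos x) hc, integral_cos]
  have : Real.sin (2 * Real.pi * k * 1) = 0 := by
    rw [show 2 * Real.pi * k * 1 = ((2 * k : ℤ) : ℝ) * Real.pi by push_cast; ring]
    exact Real.sin_int_mul_pi _
  rw [mul_one] at this
  simp [this]

lemma integral_sin_int (k : ℤ) :
    ∫ x in (0 : ℝ)..1, Real.sin (2 * Real.pi * k * x) = 0 := by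
  by_cases hk : k = 0
  · simp [hk]
  have hc : (2 * Real.pi * k : ℝ) ≠ 0 := by
    positivity
  rw [intervalIntegral.integral_comp_mul_left (fun x => Real.sin x) hc, integral_sin]
  have : Real.cos (2 * Real.pi * k * 1) = 1 := by
    rw [show 2 * Real.pi * k * 1 = (k : ℝ) * (2 * Real.pi) by ring]
    exact Real.cos_int_mul_two_pi _
  rw [mul_one] at this
  simp [this]

lemma integral_cos_int' (k : ℤ) :
    ∫ x in (0 : ℝ)..1, Real.cos (2 * Real.pi * k * x) = if k = 0 then 1 else 0 := by
  split_ifs with h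
  · simp [h]
  · exact integral_cos_int k h

/-- The trigonometric basis is orthonormal in `L₂[0,1]`. -/
theorem integral_trigBasis_mul (i j : ℕ+) :
    ∫ x in (0 : ℝ)..1, trigBasis i x * trigBasis j x = if i = j then 1 else 0 := by
  have hs : √2 * √2 = (2 : ℝ) := Real.mul_self_sqrt (by norm_num)
  have inj : ∀ {i j : ℕ+}, (i : ℕ) ≠ j → i ≠ j := fun h h' => h (by rw [h'])
  have hcc : ∀ k l : ℕ, ∫ x in (0 : ℝ)..1, √2 * Real.cos (2 * Real.pi * k * x)
      * (√2 * Real.cos (2 * Real.pi * l * x))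
      = (if (k - l : ℤ) = 0 then 1 else 0) + if (k + l : ℤ) = 0 then 1 else 0 := by
    intro k l
    rw [← integral_cos_int', ← integral_cos_int', ← intervalIntegral.integral_add]
    · refine intervalIntegral.integral_congr fun x _ => ?_
      have e1 : 2 * Real.pi * ((k - l : ℤ) : ℝ) * x
          = 2 * Real.pi * k * x - 2 * Real.pi * l * x := by push_cast; ring
      have e2 : 2 * Real.pi * ((k + l : ℤ) : ℝ) * x
          = 2 * Real.pi * k * x + 2 * Real.pi * l * x := by push_cast; ring
      simp only [e1, e2, Real.cos_add, Real.cos_sub]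
      linear_combination (Real.cos (2 * Real.pi * k * x) * Real.cos (2 * Real.pi * l * x)) * hs
    all_goals exact Continuous.intervalIntegrable (by fun_prop) _ _
  have hss : ∀ k l : ℕ, ∫ x in (0 : ℝ)..1, √2 * Real.sin (2 * Real.pi * k * x)
      * (√2 * Real.sin (2 * Real.pi * l * x))
      = (if (k - l : ℤ) = 0 then 1 else 0) - if (k + l : ℤ) = 0 then 1 else 0 := by
    intro k l
    rw [← integral_cos_int', ← integral_cos_int', ← intervalIntegral.integral_sub]
    · refine intervalIntegral.integral_congr fun x _ => ?_
      have e1 : 2 * Real.pi * ((k - l : ℤ) : ℝ) * x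
          = 2 * Real.pi * k * x - 2 * Real.pi * l * x := by push_cast; ring
      have e2 : 2 * Real.pi * ((k + l : ℤ) : ℝ) * x
          = 2 * Real.pi * k * x + 2 * Real.pi * l * x := by push_cast; ring
      simp only [e1, e2, Real.cos_add, Real.cos_sub]
      linear_combination (Real.sin (2 * Real.pi * k * x) * Real.sin (2 * Real.pi * l * x)) * hs
    all_goals exact Continuous.intervalIntegrable (by fun_prop) _ _
  have hsc : ∀ k l : ℕ, ∫ x in (0 : ℝ)..1, √2 * Real.sin (2 * Real.pi * k * x)
      * (√2 * Real.cos (2 * Real.pi * l * x)) = 0 := by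
    intro k l
    have : (∫ x in (0 : ℝ)..1, Real.sin (2 * Real.pi * ((k - l : ℤ) : ℝ) * x))
        + (∫ x in (0 : ℝ)..1, Real.sin (2 * Real.pi * ((k + l : ℤ) : ℝ) * x)) = 0 := by
      rw [integral_sin_int, integral_sin_int, add_zero]
    refine Eq.trans ?_ this
    rw [← intervalIntegral.integral_add]
    · refine intervalIntegral.integral_congr fun x _ => ?_
      have e1 : 2 * Real.pi * ((k - l : ℤ) : ℝ) * x
          = 2 * Real.pi * k * x - 2 * Real.pi * l * x := by push_cast; ring
      have e2 : 2 * Real.pi * ((k + l : ℤ) : ℝ) * x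
          = 2 * Real.pi * k * x + 2 * Real.pi * l * x := by push_cast; ring
      simp only [e1, e2, Real.sin_add, Real.sin_sub]
      linear_combination (Real.sin (2 * Real.pi * k * x) * Real.cos (2 * Real.pi * l * x)) * hs
    all_goals exact Continuous.intervalIntegrable (by fun_prop) _ _
  have hc1 : ∀ l : ℕ, 0 < l → ∫ x in (0 : ℝ)..1, √2 * Real.cos (2 * Real.pi * l * x) = 0 := by
    intro l hl
    rw [intervalIntegral.integral_const_mul]
    have := integral_cos_int l (by exact_mod_cast hl.ne')
    rw [Int.cast_natCast] at this
    rw [this, mul_zero]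
  have hs1 : ∀ l : ℕ, ∫ x in (0 : ℝ)..1, √2 * Real.sin (2 * Real.pi * l * x) = 0 := by
    intro l
    rw [intervalIntegral.integral_const_mul]
    have := integral_sin_int l
    rw [Int.cast_natCast] at this
    rw [this, mul_zero]
  have one_ne : ∀ j : ℕ+, (j : ℕ) ≠ 1 → (1 : ℕ+) ≠ j := fun j h h' => h (by rw [← h']; rfl)
  -- At the origin the other basis functions take the values √2 and 0, never 1.
  have val : ∀ j : ℕ+, (trigBasis j = fun _ => 1) → j = 1 := by
    intro j h
    by_contra hj
    have hz := congrFun h 0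
    rw [trigBasis, if_neg hj] at hz
    split_ifs at hz
    · simp at hz
    · simp at hz
  rcases trigBasis_cases i with h | ⟨k, hk, hik, h⟩ | ⟨k, hk, hik, h⟩ <;>
  rcases trigBasis_cases j with h' | ⟨l, hl, hjl, h'⟩ | ⟨l, hl, hjl, h'⟩
  · rw [val i h, val j h', if_pos rfl, ← val i h, h]; simp
  · rw [val i h, if_neg (one_ne j (by omega)), ← val i h, h, h']
    simpa using hc1 l hl
  · rw [val i h, if_neg (one_ne j (by omega)), ← val i h, h, h']
    simpa using hs1 l
  · rw [val j h', if_neg (one_ne i (by omega)).symm, ← val j h', h, h']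
    simpa using hc1 k hk
  · rw [h, h', hcc]
    rw [if_neg (by omega : ¬ (k + l : ℤ) = 0), add_zero]
    refine if_congr ⟨fun e => PNat.coe_injective (by omega), fun e => ?_⟩ rfl rfl
    rw [e] at hik; omega
  · rw [h, h', if_neg (inj (by omega))]
    refine Eq.trans (intervalIntegral.integral_congr fun x _ => ?_) (hsc l k)
    ring
  · rw [val j h', if_neg (one_ne i (by omega)).symm, ← val j h', h, h']
    simpa using hs1 k
  · rw [h, h', if_neg (inj (by omega)), hsc]
  · rw [h, h', hss]
    rw [if_neg (by omega : ¬ (k + l : ℤ) = 0), sub_zero]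
    refine if_congr ⟨fun e => PNat.coe_injective (by omega), fun e => ?_⟩ rfl rfl
    rw [e] at hik; omega

lemma integral_trigBasis_mul_nat (n : ℕ) (i j : ℕ+) :
    ∫ x in (0 : ℝ)..n, trigBasis i x * trigBasis j x = if i = j then (n : ℝ) else 0 := by
  have h := integral_periodic_nat ((periodic_trigBasis i).mul (periodic_trigBasis j))
    (fun a b => ((continuous_trigBasis i).mul (continuous_trigBasis j)).intervalIntegrable a b) n
  simp only [Pi.mul_apply, integral_trigBasis_mul] at h
  rw [h]; split_ifs <;> simp

lemma integral_sum_trigBasis_sq {b : ℝ} {w : ℝ}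
    (h : ∀ i j, ∫ x in (0 : ℝ)..b, trigBasis i x * trigBasis j x = if i = j then w else 0)
    (T : Finset ℕ+) (c : ℕ+ → ℝ) :
    ∫ x in (0 : ℝ)..b, (∑ j ∈ T, c j * trigBasis j x) ^ 2 = w * ∑ j ∈ T, c j ^ 2 := by
  have hcont := continuous_trigBasis
  simp_rw [pow_two, Finset.sum_mul_sum]
  rw [intervalIntegral.integral_finsetSum]
  · rw [Finset.mul_sum]
    refine Finset.sum_congr rfl fun i hi => ?_
    rw [intervalIntegral.integral_finsetSum]
    · have : ∀ j, ∫ x in (0 : ℝ)..b, c i * trigBasis i x * (c j * trigBasis j x)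
          = if i = j then w * (c i * c i) else 0 := by
        intro j
        rw [show (fun x => c i * trigBasis i x * (c j * trigBasis j x))
          = fun x => (c i * c j) * (trigBasis i x * trigBasis j x) by funext x; ring,
          intervalIntegral.integral_const_mul, h]
        split_ifs with e
        · subst e; ring
        · ring
      simp [this, hi]
    · intro j _
      exact Continuous.intervalIntegrable (by fun_prop) _ _
  · intro i _
    exact Continuous.intervalIntegrable (by fun_prop) _ _

/-! ### The filtered basis -/

/-- The filtered and normalized basis functions: `ξ_{j,n} = ∫_0^n h_j du`. -/
noncomputable def filteredBasis (a : ℝ) (n : ℕ) (j : ℕ+) (s : ℝ) : ℝ :=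
  (1 / √n) * ouFilter a n (trigBasis j) s

section FilteredBasis

variable {a : ℝ} {n : ℕ}

lemma continuous_filteredBasis (j : ℕ+) : Continuous (filteredBasis a n j) :=
  (continuous_ouFilter (continuous_trigBasis j)).const_mul _

/-- The filter is linear and contracts, and the φ_j are orthogonal on [0, n] with squared norm n. As
quadratic forms, the Gram matrix is at most the identity. -/
lemma integral_sum_filteredBasis_sq_le (ha : a ≤ 0) (hn : 0 < n) (T : Finset ℕ+) (c : ℕ+ → ℝ) :
    ∫ s in (0 : ℝ)..n, (∑ j ∈ T, c j * filteredBasis a n j s) ^ 2 ≤ ∑ j ∈ T, c j ^ 2 := by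
  have hn' : (0 : ℝ) < n := by exact_mod_cast hn
  have hF : Continuous fun t => ∑ j ∈ T, c j * trigBasis j t :=
    continuous_finsetSum _ fun j _ => (continuous_trigBasis j).const_mul _
  have h := integral_ouFilter_sq_le ha hn'.le hF
  rw [integral_sum_trigBasis_sq (integral_trigBasis_mul_nat n)] at h
  have e : ∀ s, (∑ j ∈ T, c j * filteredBasis a n j s) ^ 2
      = (1 / n) * ouFilter a n (fun t => ∑ j ∈ T, c j * trigBasis j t) s ^ 2 := by
    intro s
    rw [ouFilter_sum continuous_trigBasis]
    simp only [filteredBasis]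
    rw [show ∑ j ∈ T, c j * (1 / √n * ouFilter a n (trigBasis j) s)
      = (1 / √n) * ∑ j ∈ T, c j * ouFilter a n (trigBasis j) s by
        rw [Finset.mul_sum]; exact Finset.sum_congr rfl fun j _ => by ring]
    rw [mul_pow, div_pow, Real.sq_sqrt hn'.le, one_pow]
  simp_rw [e]
  rw [intervalIntegral.integral_const_mul]
  calc _ ≤ 1 / (n : ℝ) * (n * ∑ j ∈ T, c j ^ 2) := by gcongr
    _ = _ := by field_simp

/-- The Gram matrix of the filtered basis. -/
noncomputable def filteredGram (a : ℝ) (n : ℕ) (i j : ℕ+) : ℝ :=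
  ∫ s in (0 : ℝ)..n, filteredBasis a n i s * filteredBasis a n j s

lemma filteredGram_self_le (ha : a ≤ 0) (hn : 0 < n) (j : ℕ+) : filteredGram a n j j ≤ 1 := by
  have := integral_sum_filteredBasis_sq_le ha hn {j} (fun _ => 1)
  simpa [filteredGram, pow_two] using this

lemma filteredGram_self_nonneg (j : ℕ+) : 0 ≤ filteredGram a n j j :=
  intervalIntegral.integral_nonneg (by positivity) fun _ _ => mul_self_nonneg _

/-- A Bessel argument with c_j = G_ij: from 2⟨h_i, ∑c_jh_j⟩ ≤ ‖h_i‖² + ‖∑c_jh_j‖² one gets 2|c|² ≤ 1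
+ |c|². -/
lemma sum_filteredGram_sq_le (ha : a ≤ 0) (hn : 0 < n) (T : Finset ℕ+) (i : ℕ+) :
    ∑ j ∈ T, filteredGram a n i j ^ 2 ≤ 1 := by
  set c := filteredGram a n i with hc
  have hcont := fun j => continuous_filteredBasis (a := a) (n := n) j
  have h1 := integral_sum_filteredBasis_sq_le ha hn T c
  have h2 := filteredGram_self_le ha hn i
  have h3 : ∫ s in (0 : ℝ)..n, filteredBasis a n i s * ∑ j ∈ T, c j * filteredBasis a n j s
      = ∑ j ∈ T, c j ^ 2 := by
    simp_rw [Finset.mul_sum]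
    rw [intervalIntegral.integral_finsetSum]
    · refine Finset.sum_congr rfl fun j _ => ?_
      rw [show (fun s => filteredBasis a n i s * (c j * filteredBasis a n j s))
        = fun s => c j * (filteredBasis a n i s * filteredBasis a n j s) by funext s; ring,
        intervalIntegral.integral_const_mul, pow_two]
      rfl
    · intro j _
      exact Continuous.intervalIntegrable (by fun_prop) _ _
  have h4 : ∫ s in (0 : ℝ)..n, 2 * (filteredBasis a n i s * ∑ j ∈ T, c j * filteredBasis a n j s)
      ≤ ∫ s in (0 : ℝ)..n, (filteredBasis a n i s * filteredBasis a n i s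
        + (∑ j ∈ T, c j * filteredBasis a n j s) ^ 2) := by
    refine intervalIntegral.integral_mono_on (by positivity)
      (Continuous.intervalIntegrable (by fun_prop) _ _)
      (Continuous.intervalIntegrable (by fun_prop) _ _) fun s _ => ?_
    nlinarith [sq_nonneg (filteredBasis a n i s - ∑ j ∈ T, c j * filteredBasis a n j s)]
  rw [intervalIntegral.integral_const_mul, h3, intervalIntegral.integral_add] at h4
  · change _ ≤ filteredGram a n i i + _ at h4
    linarith
  · have := hcont i
    exact Continuous.intervalIntegrable (by fun_prop) _ _
  · exact Continuous.intervalIntegrable (by fun_prop) _ _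

/-- Schur's test for the symmetric matrix of the squares G_ij², whose row sums are at most 1. -/
lemma sum_mul_filteredGram_sq_le (ha : a ≤ 0) (hn : 0 < n) (T : Finset ℕ+) (x : ℕ+ → ℝ) :
    ∑ i ∈ T, ∑ j ∈ T, x i * x j * filteredGram a n i j ^ 2 ≤ ∑ i ∈ T, x i ^ 2 := by
  have hsymm : ∀ i j, filteredGram a n i j = filteredGram a n j i := fun i j => by
    simp only [filteredGram, mul_comm]
  have h1 : ∑ i ∈ T, ∑ j ∈ T, x i * x j * filteredGram a n i j ^ 2
      ≤ ∑ i ∈ T, ∑ j ∈ T, (x i ^ 2 * filteredGram a n i j ^ 2 / 2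
        + x j ^ 2 * filteredGram a n i j ^ 2 / 2) := by
    refine Finset.sum_le_sum fun i _ => Finset.sum_le_sum fun j _ => ?_
    nlinarith [mul_nonneg (sq_nonneg (x i - x j)) (sq_nonneg (filteredGram a n i j))]
  have h2 : ∑ i ∈ T, ∑ j ∈ T, x i ^ 2 * filteredGram a n i j ^ 2 / 2 ≤ (∑ i ∈ T, x i ^ 2) / 2 := by
    rw [Finset.sum_div]
    refine Finset.sum_le_sum fun i _ => ?_
    rw [← Finset.sum_div, ← Finset.mul_sum]
    have := mul_le_mul_of_nonneg_left (sum_filteredGram_sq_le ha hn T i) (sq_nonneg (x i))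
    linarith
  have h3 : ∑ i ∈ T, ∑ j ∈ T, x j ^ 2 * filteredGram a n i j ^ 2 / 2
      = ∑ i ∈ T, ∑ j ∈ T, x i ^ 2 * filteredGram a n i j ^ 2 / 2 := by
    rw [Finset.sum_comm]
    exact Finset.sum_congr rfl fun i _ => Finset.sum_congr rfl fun j _ => by rw [hsymm]
  simp_rw [Finset.sum_add_distrib] at h1
  linarith

lemma filteredBasis_sq_le (ha : a ≤ 0) (hn : 0 < n) (j : ℕ+) {s : ℝ} (hs : s ≤ n) :
    filteredBasis a n j s ^ 2 ≤ 8 / n := by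
  have hn' : (0 : ℝ) < n := by exact_mod_cast hn
  have h := abs_ouFilter_le (a := a) (continuous_trigBasis j) (abs_trigBasis_le j) ha hs
  rw [filteredBasis, mul_pow, div_pow, Real.sq_sqrt hn'.le, one_pow, one_div_mul_eq_div]
  gcongr
  calc _ = |ouFilter a n (trigBasis j) s| ^ 2 := (sq_abs _).symm
    _ ≤ (2 * √2) ^ 2 := by gcongr
    _ = 8 := by rw [mul_pow, Real.sq_sqrt (by norm_num)]; norm_num

/-- Pointwise Cauchy–Schwarz with at most n terms of size 8/n gives 64|x|²/n, and the interval has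
length n. It controls the contribution of the jumps, and is where the restriction #(x) ≤ n enters.
-/
lemma integral_sum_filteredBasis_sq_sq_le (ha : a ≤ 0) (hn : 0 < n) (T : Finset ℕ+)
    (hT : T.card ≤ n) (x : ℕ+ → ℝ) :
    ∫ s in (0 : ℝ)..n, (∑ j ∈ T, x j * filteredBasis a n j s ^ 2) ^ 2 ≤ 64 * ∑ j ∈ T, x j ^ 2 := by
  have hn' : (0 : ℝ) < n := by exact_mod_cast hn
  have hcont := fun j => continuous_filteredBasis (a := a) (n := n) j
  have hpt : ∀ s ∈ Set.Icc (0 : ℝ) n, (∑ j ∈ T, x j * filteredBasis a n j s ^ 2) ^ 2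
      ≤ 64 / n * ∑ j ∈ T, x j ^ 2 := by
    intro s hs
    have h1 := Finset.sum_mul_sq_le_sq_mul_sq T x (fun j => filteredBasis a n j s ^ 2)
    have h2 : ∑ j ∈ T, (filteredBasis a n j s ^ 2) ^ 2 ≤ ∑ _j ∈ T, (8 / n : ℝ) ^ 2 :=
      Finset.sum_le_sum fun j _ => by
        have := filteredBasis_sq_le ha hn j hs.2
        gcongr
    rw [Finset.sum_const, nsmul_eq_mul] at h2
    have h3 : (T.card : ℝ) * (8 / n : ℝ) ^ 2 ≤ 64 / n := by
      calc (T.card : ℝ) * (8 / n : ℝ) ^ 2 ≤ n * (8 / n : ℝ) ^ 2 := by gcongr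
        _ = (64 : ℝ) / n := by field_simp; norm_num
    calc _ ≤ _ := h1
      _ ≤ (∑ j ∈ T, x j ^ 2) * (64 / n) := by
        gcongr
        exact h2.trans h3
      _ = _ := by ring
  calc _ ≤ ∫ _s in (0 : ℝ)..n, 64 / n * ∑ j ∈ T, x j ^ 2 :=
        intervalIntegral.integral_mono_on hn'.le
          (Continuous.intervalIntegrable (by fun_prop) _ _) (by simp) hpt
    _ = _ := by
        rw [intervalIntegral.integral_const, smul_eq_mul]; field_simp; norm_num

end FilteredBasis

/-! ### Moments of the stochastic integrals -/

/-- Left-point Riemann sums of a continuous function converge. -/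
lemma tendsto_leftSum {F : ℝ → ℝ} (hF : Continuous F) {n : ℕ} (hn : 0 < n) :
    Tendsto (fun m : ℕ => (n / m : ℝ) * ∑ i ∈ Finset.range m, F (n * i / m)) atTop
      (𝓝 (∫ t in (0 : ℝ)..n, F t)) := by
  have hn' : (0 : ℝ) ≤ n := by positivity
  have hy : IsCadlag fun t : ℝ≥0 => F t :=
    isCadlag_of_continuous (hF.comp NNReal.continuous_coe)
  have h := hy.tendsto_step_sum hn (g := fun _ => 1) (by simp)
  -- The step sums use right endpoints; changing to left endpoints costs a telescoping term of the
  -- order of the mesh.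
  have h2 : Tendsto (fun m : ℕ => (n / m : ℝ) * (F n - F 0)) atTop (𝓝 0) := by
    have := (tendsto_const_div_atTop_nhds_zero_nat (n : ℝ)).mul_const (F n - F 0)
    simpa using this
  have h3 := h.sub h2
  have e : ∫ t in (0 : ℝ)..n, F (t.toNNReal : ℝ) * 1 = ∫ t in (0 : ℝ)..n, F t := by
    refine intervalIntegral.integral_congr fun t ht => ?_
    rw [Set.uIcc_of_le hn'] at ht
    simp only [Real.coe_toNNReal t ht.1, mul_one]
  rw [e, sub_zero] at h3
  refine h3.congr' ((eventually_gt_atTop 0).mono fun m hm => ?_)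
  have hm' : (m : ℝ) ≠ 0 := by positivity
  have tel := Finset.sum_range_sub (fun i : ℕ => F (n * i / m)) m
  simp only [Nat.cast_zero, mul_zero, zero_div, mul_div_cancel_right₀ _ hm'] at tel
  simp only [← tel, Finset.mul_sum, ← Finset.sum_sub_distrib]
  refine Finset.sum_congr rfl fun i _ => ?_
  rw [intervalIntegral.integral_const]
  push_cast
  simp only [smul_eq_mul]
  ring

lemma sum_sum_sum_mul (T : Finset ℕ+) (s : Finset ℕ) (x : ℕ+ → ℝ) (B : ℕ+ → ℕ → ℕ → ℝ)
    (D : ℕ → ℕ → ℝ) : ∑ i ∈ s, ∑ k ∈ s, (∑ j ∈ T, x j * B j i k) * D i k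
      = ∑ j ∈ T, x j * ∑ i ∈ s, ∑ k ∈ s, B j i k * D i k := by
  simp_rw [Finset.sum_mul, Finset.mul_sum]
  rw [Finset.sum_congr rfl fun i _ => Finset.sum_comm, Finset.sum_comm]
  simp_rw [mul_assoc]

/-- The quadratic form of the matrix A = ∑ x_j φ_j ⊗ φ_j, evaluated at X. -/
lemma sum_sum_mul_sq (T : Finset ℕ+) (s : Finset ℕ) (x : ℕ+ → ℝ) (φ : ℕ+ → ℕ → ℝ) (X : ℕ → ℝ) :
    ∑ i ∈ s, ∑ k ∈ s, (∑ j ∈ T, x j * (φ j i * φ j k)) * (X i * X k)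
      = ∑ j ∈ T, x j * (∑ i ∈ s, φ j i * X i) ^ 2 := by
  rw [sum_sum_sum_mul T s x (fun j i k => φ j i * φ j k) fun i k => X i * X k]
  refine Finset.sum_congr rfl fun j _ => ?_
  rw [pow_two, Finset.sum_mul_sum]
  congr 1
  exact Finset.sum_congr rfl fun i _ => Finset.sum_congr rfl fun k _ => by ring

/-- The squared Hilbert–Schmidt norm of A = ∑ x_j φ_j ⊗ φ_j in terms of the Gram matrix of the φ_j.
-/
lemma sum_sum_sum_sq (T : Finset ℕ+) (s : Finset ℕ) (x : ℕ+ → ℝ) (φ : ℕ+ → ℕ → ℝ) :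
    ∑ i ∈ s, ∑ k ∈ s, (∑ j ∈ T, x j * (φ j i * φ j k)) ^ 2
      = ∑ j ∈ T, ∑ l ∈ T, x j * x l * (∑ i ∈ s, φ j i * φ l i) ^ 2 := by
  simp_rw [pow_two (∑ j ∈ T, _)]
  rw [sum_sum_sum_mul T s x (fun j i k => φ j i * φ j k)
    fun i k => ∑ j ∈ T, x j * (φ j i * φ j k)]
  refine Finset.sum_congr rfl fun j _ => ?_
  have := sum_sum_mul_sq T s x φ (φ j)
  rw [Finset.sum_congr rfl fun i _ => Finset.sum_congr rfl fun k _ =>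
    mul_comm (φ j i * φ j k) _, this, Finset.mul_sum]
  refine Finset.sum_congr rfl fun l _ => ?_
  simp_rw [mul_comm (φ l _)]
  ring

section Fatou

variable {Ω : Type*} [MeasurableSpace Ω] {P : Measure Ω}

/-- Fatou's lemma for integrals of nonnegative real functions. -/
lemma integral_le_of_tendsto {F : ℕ → Ω → ℝ} {G : Ω → ℝ} {c : ℕ → ℝ} {c₀ : ℝ}
    (hF : ∀ m, Integrable (F m) P) (h0 : ∀ m ω, 0 ≤ F m ω)
    (hlim : ∀ᵐ ω ∂P, Tendsto (fun m => F m ω) atTop (𝓝 (G ω)))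
    (hc : ∀ᶠ m in atTop, ∫ ω, F m ω ∂P ≤ c m) (hcl : Tendsto c atTop (𝓝 c₀)) :
    Integrable G P ∧ ∫ ω, G ω ∂P ≤ c₀ := by
  have hG0 : 0 ≤ᵐ[P] G := by
    filter_upwards [hlim] with ω hω using ge_of_tendsto' hω fun m => h0 m ω
  have hGm : AEStronglyMeasurable G P :=
    aestronglyMeasurable_of_tendsto_ae atTop (fun m => (hF m).aestronglyMeasurable) hlim
  have hc0 : 0 ≤ c₀ := ge_of_tendsto hcl (hc.mono fun m hm => (integral_nonneg (h0 m)).trans hm)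
  have hle : ∫⁻ ω, ENNReal.ofReal (G ω) ∂P ≤ ENNReal.ofReal c₀ := by
    calc ∫⁻ ω, ENNReal.ofReal (G ω) ∂P
        = ∫⁻ ω, liminf (fun m => ENNReal.ofReal (F m ω)) atTop ∂P := by
          refine lintegral_congr_ae ?_
          filter_upwards [hlim] with ω hω
          exact ((ENNReal.continuous_ofReal.tendsto _).comp hω).liminf_eq.symm
      _ ≤ liminf (fun m => ∫⁻ ω, ENNReal.ofReal (F m ω) ∂P) atTop :=
          lintegral_liminf_le' fun m => (hF m).aemeasurable.ennreal_ofReal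
      _ ≤ liminf (fun m => ENNReal.ofReal (c m)) atTop := by
          refine liminf_le_liminf (hc.mono fun m hm => ?_)
          rw [← ofReal_integral_eq_lintegral_ofReal (hF m) (Eventually.of_forall (h0 m))]
          exact ENNReal.ofReal_le_ofReal hm
      _ = ENNReal.ofReal c₀ := ((ENNReal.continuous_ofReal.tendsto _).comp hcl).liminf_eq
  have hGi : Integrable G P := ⟨hGm, by
    rw [hasFiniteIntegral_iff_ofReal hG0]
    exact hle.trans_lt ENNReal.ofReal_lt_top⟩
  refine ⟨hGi, ?_⟩
  rw [← ofReal_integral_eq_lintegral_ofReal hGi hG0] at hle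
  exact (ENNReal.ofReal_le_ofReal_iff hc0).1 hle

end Fatou

section Moments

variable {Ω : Type*} [MeasurableSpace Ω] {P : Measure Ω} [IsProbabilityMeasure P]
  {lam : ℝ≥0} {r₁ r₂ a : ℝ} {w : ℝ≥0 → Ω → ℝ} {N : ℝ≥0 → Ω → ℕ} {Y : ℕ → Ω → ℝ}
  {ξ : ℝ≥0 → Ω → ℝ}

/-- The Riemann sums of the filtered basis functions against the driving process. -/
noncomputable def drivingSum (r₁ r₂ : ℝ) (w : ℝ≥0 → Ω → ℝ) (N : ℝ≥0 → Ω → ℕ) (Y : ℕ → Ω → ℝ)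
    (a : ℝ) (n m : ℕ) (j : ℕ+) (ω : Ω) : ℝ :=
  riemannSum (filteredBasis a n j) (fun t => drivingProcess r₁ r₂ w N Y t ω) n m

lemma rhoStar_nonneg (lam : ℝ≥0) (r₁ r₂ : ℝ) : 0 ≤ rhoStar lam r₁ r₂ := by
  unfold rhoStar; positivity

/-- The bound for the excess of the fourth moment of the increments. -/
noncomputable def jumpConst (P : Measure Ω) (lam : ℝ≥0) (r₂ : ℝ) (Y : ℕ → Ω → ℝ) : ℝ :=
  ((∫ ω, Y 0 ω ^ 4 ∂P) + 3) * lam * r₂ ^ 4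

lemma jumpConst_nonneg : 0 ≤ jumpConst P lam r₂ Y := by
  unfold jumpConst; positivity

/-- Moments of the Riemann sums. -/
theorem IsOUNoise.drivingSum_moments (h : IsOUNoise P a lam r₁ r₂ w N Y ξ) :
    ∃ C : ℝ, 0 ≤ C ∧ ∀ n m : ℕ, 0 < m →
      (∀ j, MemLp (drivingSum r₁ r₂ w N Y a n m j) 4 P) ∧
      (∀ (T : Finset ℕ+) (c : ℕ+ → ℝ),
        ∫ ω, (∑ j ∈ T, c j * drivingSum r₁ r₂ w N Y a n m j ω) ^ 2 ∂P
          = rhoStar lam r₁ r₂ * ((n / m : ℝ) * ∑ i ∈ Finset.range m,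
              (∑ j ∈ T, c j * filteredBasis a n j (n * i / m)) ^ 2)) ∧
      ∀ (T : Finset ℕ+) (x : ℕ+ → ℝ),
        ∫ ω, ((∑ j ∈ T, x j * drivingSum r₁ r₂ w N Y a n m j ω ^ 2)
          - rhoStar lam r₁ r₂ * ∑ j ∈ T, x j * ((n / m : ℝ) * ∑ i ∈ Finset.range m,
              filteredBasis a n j (n * i / m) * filteredBasis a n j (n * i / m))) ^ 2 ∂P
          ≤ 2 * rhoStar lam r₁ r₂ ^ 2 * (∑ j ∈ T, ∑ l ∈ T, x j * x l *
              ((n / m : ℝ) * ∑ i ∈ Finset.range m,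
                filteredBasis a n j (n * i / m) * filteredBasis a n l (n * i / m)) ^ 2)
            + (jumpConst P lam r₂ Y + C * (n / m)) * ((n / m : ℝ) * ∑ i ∈ Finset.range m,
                (∑ j ∈ T, x j * filteredBasis a n j (n * i / m) ^ 2) ^ 2) := by
  obtain ⟨C, hC, hinc⟩ := h.increments
  refine ⟨C, hC, fun n m hm => ?_⟩
  obtain ⟨hind, hmom⟩ := hinc ((n : ℝ≥0) / m) (fun i : ℕ => (n : ℝ≥0) * i / m) (by simp)
    (fun i => by push_cast; ring)
  set s := rhoStar lam r₁ r₂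
  set κ := jumpConst P lam r₂ Y with hκdef
  set X : ℕ → Ω → ℝ := fun i ω => drivingProcess r₁ r₂ w N Y ((n : ℝ≥0) * (i + 1 : ℕ) / m) ω
    - drivingProcess r₁ r₂ w N Y ((n : ℝ≥0) * i / m) ω with hX
  set φ : ℕ+ → ℕ → ℝ := fun j i => filteredBasis a n j (n * i / m) with hφ
  set δ : ℝ := n / m with hδ
  have hSum : ∀ j ω, drivingSum r₁ r₂ w N Y a n m j ω = ∑ i ∈ Finset.range m, φ j i * X i ω := by
    intro j ω
    simp only [drivingSum, riemannSum, hφ, hX, Nat.cast_add, Nat.cast_one]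
  have hXm : ∀ i, Measurable (X i) := fun i => (h.measurable_driving _).sub (h.measurable_driving _)
  have h4 : ∀ i, MemLp (X i) 4 P := fun i => (hmom i).1
  have h1 : ∀ i, ∫ ω, X i ω ∂P = 0 := fun i => (hmom i).2.1
  have h2 : ∀ i, ∫ ω, X i ω ^ 2 ∂P = s * δ := fun i => by
    have := (hmom i).2.2.1
    simpa only [hX, hδ, NNReal.coe_div, NNReal.coe_natCast] using this
  have h3 : ∀ i, ∫ ω, X i ω ^ 4 ∂P ≤ κ * δ + C * δ ^ 2 := fun i => by
    have := (hmom i).2.2.2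
    simpa only [hX, hδ, hκdef, jumpConst, NNReal.coe_div, NNReal.coe_natCast] using this
  refine ⟨fun j => ?_, fun T c => ?_, fun T x => ?_⟩
  · rw [show drivingSum r₁ r₂ w N Y a n m j = fun ω => ∑ i ∈ Finset.range m, φ j i * X i ω from
      funext (hSum j)]
    exact memLp_finsetSum _ fun i _ => (h4 i).const_mul _
  · have e : ∀ ω, ∑ j ∈ T, c j * drivingSum r₁ r₂ w N Y a n m j ω
        = ∑ i ∈ Finset.range m, (∑ j ∈ T, c j * φ j i) * X i ω := by
      intro ω
      simp_rw [hSum, Finset.mul_sum, Finset.sum_mul]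
      rw [Finset.sum_comm]
      exact Finset.sum_congr rfl fun i _ => Finset.sum_congr rfl fun j _ => by ring
    simp_rw [e]
    rw [integral_indep_linear_sq hXm hind (fun i => (h4 i).mono_exponent (by norm_num)) h1 h2]
    ring
  -- The variance bound for quadratic forms is applied with v = sδ and fourth moment κδ + Cδ². The
  -- powers of δ are then distributed so that each sum becomes a Riemann sum.
  · set A : ℕ → ℕ → ℝ := fun i k => ∑ j ∈ T, x j * (φ j i * φ j k) with hA
    have hq := (integral_quadForm_sq_le hXm hind h4 h1 h2 h3 A
      (fun i k => Finset.sum_congr rfl fun j _ => by ring) m).2.2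
    have e1 : ∀ ω, ∑ i ∈ Finset.range m, ∑ k ∈ Finset.range m, A i k * (X i ω * X k ω)
        = ∑ j ∈ T, x j * drivingSum r₁ r₂ w N Y a n m j ω ^ 2 := by
      intro ω
      simp_rw [hSum, hA]
      exact sum_sum_mul_sq T (Finset.range m) x φ fun i => X i ω
    have e2 : s * δ * ∑ i ∈ Finset.range m, A i i
        = s * ∑ j ∈ T, x j * (δ * ∑ i ∈ Finset.range m, φ j i * φ j i) := by
      simp_rw [hA, Finset.mul_sum]
      rw [Finset.sum_comm]
      exact Finset.sum_congr rfl fun i _ => Finset.sum_congr rfl fun j _ => by ring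
    have e3 : ∑ i ∈ Finset.range m, ∑ k ∈ Finset.range m, A i k ^ 2
        = ∑ j ∈ T, ∑ l ∈ T, x j * x l * (∑ i ∈ Finset.range m, φ j i * φ l i) ^ 2 :=
      sum_sum_sum_sq T (Finset.range m) x φ
    have e4 : ∑ i ∈ Finset.range m, A i i ^ 2
        = ∑ i ∈ Finset.range m, (∑ j ∈ T, x j * φ j i ^ 2) ^ 2 := by
      simp_rw [hA, pow_two]
    simp_rw [e1] at hq
    rw [e2, e3, e4] at hq
    refine hq.trans (le_of_eq ?_)
    simp_rw [mul_pow δ, ← mul_assoc _ (δ ^ 2), mul_comm _ (δ ^ 2), mul_assoc (δ ^ 2),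
      ← Finset.mul_sum]
    ring

end Moments

/-! ### Passage from the Riemann sums to the stochastic integrals -/

section Coefficients

variable {Ω : Type*} [MeasurableSpace Ω] {P : Measure Ω} [IsProbabilityMeasure P]
  {lam : ℝ≥0} {r₁ r₂ a : ℝ} {w : ℝ≥0 → Ω → ℝ} {N : ℝ≥0 → Ω → ℕ} {Y : ℕ → Ω → ℝ}
  {ξ : ℝ≥0 → Ω → ℝ}

lemma riemannSum_const_mul (c : ℝ) (f : ℝ → ℝ) (y : ℝ≥0 → ℝ) (n m : ℕ) :
    riemannSum (fun s => c * f s) y n m = c * riemannSum f y n m := by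
  simp only [riemannSum, Finset.mul_sum]
  exact Finset.sum_congr rfl fun i _ => by ring

lemma IsOUNoise.start_zero (h : IsOUNoise P a lam r₁ r₂ w N Y ξ) : ∀ᵐ ω ∂P, ξ 0 ω = 0 := by
  filter_upwards [h.equation, h.brownian.toIsPreBrownianReal.eval_zero_ae_eq_zero,
    h.poisson.zero] with ω h1 h2 h3
  rw [h1 0]
  simp [drivingProcess, compoundPoisson, h2, h3]

/-- Almost surely the stochastic integrals are limits of Riemann sums, both in terms of `ξ` and in
terms of the driving process. -/
theorem IsOUNoise.tendsto_coeff (h : IsOUNoise P a lam r₁ r₂ w N Y ξ) {n : ℕ} (hn : 0 < n) :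
    ∀ᵐ ω ∂P, ∀ j,
      Tendsto (riemannSum (trigBasis j) (fun t => ξ t ω) n) atTop (𝓝 (√n * xiCoeff n ξ j ω)) ∧
      Tendsto (fun m => drivingSum r₁ r₂ w N Y a n m j ω) atTop (𝓝 (xiCoeff n ξ j ω)) := by
  filter_upwards [h.equation, h.cadlag, h.start_zero] with ω h1 h2 h3 j
  obtain ⟨f', hf, hf'⟩ := exists_hasDerivAt_trigBasis j
  obtain ⟨I, hI1, hI2⟩ := exists_tendsto_riemannSum_ou (a := a)
    (u := fun t => drivingProcess r₁ r₂ w N Y t ω) h2 h3 h1 hf hf' hn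
  have hn' : (0 : ℝ) < √n := Real.sqrt_pos.2 (by exact_mod_cast hn)
  have e : xiCoeff n ξ j ω = (1 / √n) * I := by
    rw [xiCoeff, pathIntegral_eq_of_tendsto hI1]
  constructor
  · rw [e, ← mul_assoc, mul_one_div_cancel hn'.ne', one_mul]
    exact hI1
  · rw [e]
    refine (hI2.const_mul (1 / √n)).congr fun m => ?_
    rw [← riemannSum_const_mul]; rfl

/-- Completing the square makes εx⁴ - x² nonnegative up to a constant, so Fatou's lemma also yields
a lower bound for second moments. -/
lemma sq_nonneg_form (ε x : ℝ) (hε : 0 < ε) :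
    ε * (x ^ 2 - 1 / (2 * ε)) ^ 2 = ε * x ^ 4 - x ^ 2 + 1 / (4 * ε) := by
  field_simp; ring

/-- The second moments of the stochastic integrals of the basis functions. -/
theorem IsOUNoise.xiCoeff_sq (h : IsOUNoise P a lam r₁ r₂ w N Y ξ) {n : ℕ} (hn : 0 < n) (j : ℕ+) :
    Integrable (fun ω => xiCoeff n ξ j ω ^ 2) P ∧
      ∫ ω, xiCoeff n ξ j ω ^ 2 ∂P = rhoStar lam r₁ r₂ * filteredGram a n j j := by
  obtain ⟨C, hC, hmom⟩ := h.drivingSum_moments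
  set s := rhoStar lam r₁ r₂
  set κ := jumpConst P lam r₂ Y
  -- The shift by one excludes the empty partition, for which the moment formulas are not available.
  set Z : ℕ → Ω → ℝ := fun m => drivingSum r₁ r₂ w N Y a n (m + 1) j with hZ
  set I : Ω → ℝ := xiCoeff n ξ j
  have hlim : ∀ᵐ ω ∂P, Tendsto (fun m => Z m ω) atTop (𝓝 (I ω)) := by
    filter_upwards [h.tendsto_coeff hn] with ω hω
    exact (tendsto_add_atTop_iff_nat (f := fun m => drivingSum r₁ r₂ w N Y a n m j ω) 1).2 (hω j).2
  have hcont := continuous_filteredBasis (a := a) (n := n) j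
  have shift : ∀ {F : ℝ → ℝ}, Continuous F → Tendsto (fun m : ℕ => (n / (m + 1 : ℕ) : ℝ) *
      ∑ i ∈ Finset.range (m + 1), F (n * i / (m + 1 : ℕ))) atTop (𝓝 (∫ t in (0 : ℝ)..n, F t)) :=
    fun {F} hF => (tendsto_add_atTop_iff_nat (f := fun m : ℕ => (n / m : ℝ) *
      ∑ i ∈ Finset.range m, F (n * i / m)) 1).2 (tendsto_leftSum hF hn)
  have shift₂ : ∀ i l, Tendsto (fun m : ℕ => (n / (m + 1 : ℕ) : ℝ) * ∑ k ∈ Finset.range (m + 1),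
      filteredBasis a n i (n * k / (m + 1 : ℕ)) * filteredBasis a n l (n * k / (m + 1 : ℕ)))
      atTop (𝓝 (filteredGram a n i l)) := fun i l =>
    shift ((continuous_filteredBasis i).mul (continuous_filteredBasis l))
  set b : ℕ → ℝ := fun m => s * ((n / (m + 1 : ℕ) : ℝ) * ∑ i ∈ Finset.range (m + 1),
    filteredBasis a n j (n * i / (m + 1 : ℕ)) * filteredBasis a n j (n * i / (m + 1 : ℕ))) with hb
  have hbl : Tendsto b atTop (𝓝 (s * filteredGram a n j j)) :=
    (shift₂ j j).const_mul s
  have hZ4 : ∀ m, MemLp (Z m) 4 P := fun m => (hmom n (m + 1) m.succ_pos).1 j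
  have hi2 : ∀ m, Integrable (fun ω => Z m ω ^ 2) P := fun m =>
    ((hZ4 m).mono_exponent (by norm_num)).integrable_sq
  have hi4 : ∀ m, Integrable (fun ω => Z m ω ^ 4) P := fun m => MemLp.integrable_pow_four (hZ4 m)
  have hZ2 : ∀ m, ∫ ω, Z m ω ^ 2 ∂P = b m := fun m => by
    have := (hmom n (m + 1) m.succ_pos).2.1 {j} (fun _ => 1)
    simp only [Finset.sum_singleton, one_mul] at this
    rw [this, hb]
    simp only [pow_two]
  -- the fourth moments are bounded
  obtain ⟨c, c₀, hcl, hc⟩ : ∃ (c : ℕ → ℝ) (c₀ : ℝ), Tendsto c atTop (𝓝 c₀) ∧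
      ∀ m, ∫ ω, Z m ω ^ 4 ∂P ≤ c m := by
    have h1 := (shift₂ j j).pow 2
    have h2 : Tendsto (fun m : ℕ => (n / (m + 1 : ℕ) : ℝ) * ∑ k ∈ Finset.range (m + 1),
        (filteredBasis a n j (n * k / (m + 1 : ℕ)) ^ 2) ^ 2) atTop
        (𝓝 (∫ t in (0 : ℝ)..n, (filteredBasis a n j t ^ 2) ^ 2)) := shift ((hcont.pow 2).pow 2)
    have h3 : Tendsto (fun m : ℕ => (n / (m + 1 : ℕ) : ℝ)) atTop (𝓝 0) :=
      (tendsto_add_atTop_iff_nat (f := fun m : ℕ => (n / m : ℝ)) 1).2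
        (tendsto_const_div_atTop_nhds_zero_nat (n : ℝ))
    have h4 := ((h1.const_mul (2 * s ^ 2)).add (((h3.const_mul C).const_add κ).mul h2)).add
      (hbl.pow 2)
    refine ⟨_, _, h4, fun m => ?_⟩
    have h5 := (hmom n (m + 1) m.succ_pos).2.2 {j} (fun _ => 1)
    simp only [Finset.sum_singleton, one_mul] at h5
    have e : (fun ω => (Z m ω ^ 2 - b m) ^ 2)
        = fun ω => Z m ω ^ 4 - (2 * b m * Z m ω ^ 2 - b m ^ 2) := by ext; ring
    have h6 : ∫ ω, (Z m ω ^ 2 - b m) ^ 2 ∂P = (∫ ω, Z m ω ^ 4 ∂P) - b m ^ 2 := by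
      have i3 : Integrable (fun ω => 2 * b m * Z m ω ^ 2 - b m ^ 2) P :=
        ((hi2 m).const_mul _).sub (integrable_const _)
      rw [e, integral_sub (hi4 m) i3,
        integral_sub ((hi2 m).const_mul _) (integrable_const _), integral_const_mul, hZ2]
      simp only [integral_const, probReal_univ, one_smul]
      ring
    have h7 : ∫ ω, (Z m ω ^ 2 - b m) ^ 2 ∂P ≤ _ := h5
    rw [h6] at h7
    linarith
  have up := integral_le_of_tendsto (F := fun m ω => Z m ω ^ 2) (G := fun ω => I ω ^ 2) hi2
    (fun m ω => sq_nonneg _) (hlim.mono fun ω hω => hω.pow 2)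
    (Eventually.of_forall fun m => (hZ2 m).le) hbl
  refine ⟨up.1, le_antisymm up.2 ?_⟩
  have up4 := integral_le_of_tendsto (F := fun m ω => Z m ω ^ 4) (G := fun ω => I ω ^ 4) hi4
    (fun m ω => by positivity) (hlim.mono fun ω hω => hω.pow 4) (Eventually.of_forall hc) hcl
  have hI4 : 0 ≤ ∫ ω, I ω ^ 4 ∂P := integral_nonneg fun ω => by positivity
  -- Fatou alone gives only an upper bound. Bounded fourth moments prevent a loss of mass: apply
  -- Fatou to the completed square and let ε tend to 0.
  have low : ∀ ε : ℝ, 0 < ε → s * filteredGram a n j j ≤ (∫ ω, I ω ^ 2 ∂P) + ε * c₀ := by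
    intro ε hε
    have key := integral_le_of_tendsto (P := P) (F := fun m ω => ε * (Z m ω ^ 2 - 1 / (2 * ε)) ^ 2)
      (G := fun ω => ε * (I ω ^ 2 - 1 / (2 * ε)) ^ 2)
      (c := fun m => ε * c m - b m + 1 / (4 * ε))
      (c₀ := ε * c₀ - s * filteredGram a n j j + 1 / (4 * ε))
      (fun m => ?_) (fun m ω => by positivity)
      (hlim.mono fun ω hω => (((hω.pow 2).sub_const _).pow 2).const_mul ε)
      (Eventually.of_forall fun m => ?_) (((hcl.const_mul ε).sub hbl).add_const _)
    · have := key.2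
      simp_rw [sq_nonneg_form ε _ hε] at this
      have i : Integrable (fun ω => ε * I ω ^ 4 - I ω ^ 2) P := (up4.1.const_mul ε).sub up.1
      rw [integral_add i (integrable_const _), integral_sub (up4.1.const_mul ε) up.1,
        integral_const_mul] at this
      simp only [integral_const, probReal_univ, one_smul] at this
      have := mul_nonneg hε.le hI4
      linarith
    · simp_rw [sq_nonneg_form ε _ hε]
      exact (((hi4 m).const_mul ε).sub (hi2 m)).add (integrable_const _)
    · simp_rw [sq_nonneg_form ε _ hε]
      have i : Integrable (fun ω => ε * Z m ω ^ 4 - Z m ω ^ 2) P :=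
        ((hi4 m).const_mul ε).sub (hi2 m)
      rw [integral_add i (integrable_const _), integral_sub ((hi4 m).const_mul ε) (hi2 m),
        integral_const_mul, hZ2]
      simp only [integral_const, probReal_univ, one_smul]
      have := mul_le_mul_of_nonneg_left (hc m) hε.le
      linarith
  have hl : Tendsto (fun ε : ℝ => (∫ ω, I ω ^ 2 ∂P) + ε * c₀) (𝓝[>] 0)
      (𝓝 ((∫ ω, I ω ^ 2 ∂P) + 0 * c₀)) :=
    ((continuous_const.add (continuous_id.mul continuous_const)).tendsto 0).mono_left
      nhdsWithin_le_nhds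
  rw [zero_mul, add_zero] at hl
  exact ge_of_tendsto hl (eventually_nhdsWithin_of_forall fun ε hε => low ε hε)

/-- The second moments of linear combinations of the stochastic integrals. -/
theorem IsOUNoise.integral_sum_xiCoeff_sq_le (h : IsOUNoise P a lam r₁ r₂ w N Y ξ) (ha : a ≤ 0)
    {n : ℕ} (hn : 0 < n) (T : Finset ℕ+) (c : ℕ+ → ℝ) :
    Integrable (fun ω => (∑ j ∈ T, c j * xiCoeff n ξ j ω) ^ 2) P ∧
      ∫ ω, (∑ j ∈ T, c j * xiCoeff n ξ j ω) ^ 2 ∂P ≤ rhoStar lam r₁ r₂ * ∑ j ∈ T, c j ^ 2 := by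
  obtain ⟨C, hC, hmom⟩ := h.drivingSum_moments
  have hcont : Continuous fun t => (∑ j ∈ T, c j * filteredBasis a n j t) ^ 2 :=
    (continuous_finsetSum _ fun j _ => (continuous_filteredBasis j).const_mul _).pow 2
  have key := integral_le_of_tendsto (P := P)
    (F := fun m ω => (∑ j ∈ T, c j * drivingSum r₁ r₂ w N Y a n (m + 1) j ω) ^ 2)
    (G := fun ω => (∑ j ∈ T, c j * xiCoeff n ξ j ω) ^ 2) (fun m => ?_) (fun m ω => sq_nonneg _) ?_
    (Eventually.of_forall fun m => ((hmom n (m + 1) m.succ_pos).2.1 T c).le)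
    (((tendsto_add_atTop_iff_nat 1).2 (tendsto_leftSum hcont hn)).const_mul _)
  · exact ⟨key.1, key.2.trans (mul_le_mul_of_nonneg_left
      (integral_sum_filteredBasis_sq_le ha hn T c) (rhoStar_nonneg _ _ _))⟩
  · exact MemLp.integrable_sq (memLp_finsetSum _ fun j _ =>
      (((hmom n (m + 1) m.succ_pos).1 j).mono_exponent (by norm_num)).const_mul _)
  · filter_upwards [h.tendsto_coeff hn] with ω hω
    refine (tendsto_finsetSum _ fun j _ => Tendsto.const_mul _ ?_).pow 2
    exact (tendsto_add_atTop_iff_nat (f := fun m => drivingSum r₁ r₂ w N Y a n m j ω) 1).2 (hω j).2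

/-- The variance of linear combinations of the squared stochastic integrals. -/
theorem IsOUNoise.integral_sum_xiCoeff_sq_sub_le (h : IsOUNoise P a lam r₁ r₂ w N Y ξ) (ha : a ≤ 0)
    {n : ℕ} (hn : 0 < n) (T : Finset ℕ+) (hT : T.card ≤ n) (x : ℕ+ → ℝ) :
    Integrable (fun ω =>
        (∑ j ∈ T, x j * (xiCoeff n ξ j ω ^ 2 - ∫ ω', xiCoeff n ξ j ω' ^ 2 ∂P)) ^ 2) P ∧
      ∫ ω, (∑ j ∈ T, x j * (xiCoeff n ξ j ω ^ 2 - ∫ ω', xiCoeff n ξ j ω' ^ 2 ∂P)) ^ 2 ∂P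
        ≤ (2 * rhoStar lam r₁ r₂ ^ 2 + 64 * jumpConst P lam r₂ Y) * ∑ j ∈ T, x j ^ 2 := by
  obtain ⟨C, hC, hmom⟩ := h.drivingSum_moments
  set s := rhoStar lam r₁ r₂
  set κ := jumpConst P lam r₂ Y
  have hcont := fun j => continuous_filteredBasis (a := a) (n := n) j
  have shift : ∀ {F : ℝ → ℝ}, Continuous F → Tendsto (fun m : ℕ => (n / (m + 1 : ℕ) : ℝ) *
      ∑ i ∈ Finset.range (m + 1), F (n * i / (m + 1 : ℕ))) atTop (𝓝 (∫ t in (0 : ℝ)..n, F t)) :=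
    fun {F} hF => (tendsto_add_atTop_iff_nat (f := fun m : ℕ => (n / m : ℝ) *
      ∑ i ∈ Finset.range m, F (n * i / m)) 1).2 (tendsto_leftSum hF hn)
  have shift₂ : ∀ i l, Tendsto (fun m : ℕ => (n / (m + 1 : ℕ) : ℝ) * ∑ k ∈ Finset.range (m + 1),
      filteredBasis a n i (n * k / (m + 1 : ℕ)) * filteredBasis a n l (n * k / (m + 1 : ℕ)))
      atTop (𝓝 (filteredGram a n i l)) := fun i l =>
    shift ((continuous_filteredBasis i).mul (continuous_filteredBasis l))
  have h3 : Tendsto (fun m : ℕ => (n / (m + 1 : ℕ) : ℝ)) atTop (𝓝 0) :=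
    (tendsto_add_atTop_iff_nat (f := fun m : ℕ => (n / m : ℝ)) 1).2
      (tendsto_const_div_atTop_nhds_zero_nat (n : ℝ))
  have hc4 : Continuous fun t => (∑ j ∈ T, x j * filteredBasis a n j t ^ 2) ^ 2 :=
    (continuous_finsetSum _ fun j _ => ((hcont j).pow 2).const_mul _).pow 2
  have hl1 := (tendsto_finsetSum T fun j _ => tendsto_finsetSum T fun l _ =>
    ((shift₂ j l).pow 2).const_mul (x j * x l)).const_mul (2 * s ^ 2)
  have hl2 := ((h3.const_mul C).const_add κ).mul (shift hc4)
  have key := integral_le_of_tendsto (P := P)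
    (F := fun m ω => ((∑ j ∈ T, x j * drivingSum r₁ r₂ w N Y a n (m + 1) j ω ^ 2)
      - s * ∑ j ∈ T, x j * ((n / (m + 1 : ℕ) : ℝ) * ∑ i ∈ Finset.range (m + 1),
        filteredBasis a n j (n * i / (m + 1 : ℕ)) * filteredBasis a n j (n * i / (m + 1 : ℕ)))) ^ 2)
    (G := fun ω => (∑ j ∈ T, x j * (xiCoeff n ξ j ω ^ 2 - ∫ ω', xiCoeff n ξ j ω' ^ 2 ∂P)) ^ 2)
    (fun m => ?_) (fun m ω => sq_nonneg _) ?_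
    (Eventually.of_forall fun m => (hmom n (m + 1) m.succ_pos).2.2 T x) (hl1.add hl2)
  · refine ⟨key.1, key.2.trans ?_⟩
    -- In the limit the Cδ term of the fourth moments disappears; only the linear part, caused by
    -- the jumps, remains.
    rw [mul_zero, add_zero]
    have b1 := mul_le_mul_of_nonneg_left (sum_mul_filteredGram_sq_le ha hn T x)
      (show 0 ≤ 2 * s ^ 2 by positivity)
    have b2 := mul_le_mul_of_nonneg_left (integral_sum_filteredBasis_sq_sq_le ha hn T hT x)
      (jumpConst_nonneg (P := P) (lam := lam) (r₂ := r₂) (Y := Y))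
    linarith
  · refine MemLp.integrable_sq (MemLp.sub (memLp_finsetSum _ fun j _ => MemLp.const_mul ?_ _)
      (memLp_const _))
    have := (hmom n (m + 1) m.succ_pos).1 j
    simpa only [pow_two] using memLp_mul_of_four this this
  · filter_upwards [h.tendsto_coeff hn] with ω hω
    have t1 := tendsto_finsetSum T fun j _ => (((tendsto_add_atTop_iff_nat
      (f := fun m => drivingSum r₁ r₂ w N Y a n m j ω) 1).2 (hω j).2).pow 2).const_mul (x j)
    have t2 := (tendsto_finsetSum T fun j _ =>
      (shift₂ j j).const_mul (x j)).const_mul s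
    convert! (t1.sub t2).pow 2 using 3
    rw [Finset.mul_sum, ← Finset.sum_sub_distrib]
    refine Finset.sum_congr rfl fun j _ => ?_
    rw [(h.xiCoeff_sq hn j).2]
    ring

end Coefficients

/-! ### The total variance deficit of the filtered basis -/

section Deficit

variable {a : ℝ} {n : ℕ}

lemma sum_inv_pnat_sq_le (T : Finset ℕ+) : ∑ j ∈ T, 1 / ((j : ℕ) : ℝ) ^ 2 ≤ 2 := by
  have h1 : ∑ j ∈ T, 1 / ((j : ℕ) : ℝ) ^ 2
      = ∑ k ∈ T.map ⟨fun j : ℕ+ => (j : ℕ), PNat.coe_injective⟩, 1 / (k : ℝ) ^ 2 := by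
    simp
  have h2 : ∑ k ∈ T.map ⟨fun j : ℕ+ => (j : ℕ), PNat.coe_injective⟩, 1 / (k : ℝ) ^ 2
      ≤ Real.pi ^ 2 / 6 := sum_le_hasSum _ (fun k _ => by positivity) hasSum_zeta_two
  have h3 : Real.pi ^ 2 ≤ 12 := by nlinarith [Real.pi_lt_d2, Real.pi_pos]
  linarith

/-- An energy loss estimate from a bounded primitive. -/
lemma one_sub_filteredGram_self_le_of_primitive (ha : a ≤ 0) (hn : 0 < n) {j : ℕ+} {F : ℝ → ℝ}
    (hF : ∀ x, HasDerivAt F (trigBasis j x) x) {M : ℝ} (hM : ∀ x, |F x| ≤ M) :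
    1 - filteredGram a n j j ≤ 4 * M ^ 2 * (a ^ 2 - a) := by
  have hn' : (1 : ℝ) ≤ n := by exact_mod_cast hn
  have hc := continuous_trigBasis j
  have hk : ∀ s ≤ (n : ℝ), backKernel a n (trigBasis j) s ^ 2 ≤ 4 * M ^ 2 := fun s hs => by
    have := abs_backKernel_le_of_primitive hF hc hM ha hs
    calc _ = |backKernel a n (trigBasis j) s| ^ 2 := (sq_abs _).symm
      _ ≤ (2 * M) ^ 2 := pow_le_pow_left₀ (abs_nonneg _) this 2
      _ = _ := by ring
  have h1 := integral_ouFilter_sq (a := a) (b := n) hc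
  have h2 : ∫ s in (0 : ℝ)..n, trigBasis j s ^ 2 = n := by
    have := integral_trigBasis_mul_nat n j j
    simpa [pow_two] using this
  have h3 : (n : ℝ) * filteredGram a n j j = ∫ s in (0 : ℝ)..n, ouFilter a n (trigBasis j) s ^ 2 := by
    rw [filteredGram, ← intervalIntegral.integral_const_mul]
    refine intervalIntegral.integral_congr fun s _ => ?_
    have : √(n : ℝ) ^ 2 = n := Real.sq_sqrt (by positivity)
    simp only [filteredBasis]
    field_simp
    rw [this]
  have h4 : ∫ s in (0 : ℝ)..n, backKernel a n (trigBasis j) s ^ 2 ≤ 4 * M ^ 2 * n := by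
    have hi := intervalIntegral.integral_mono_on (μ := volume) (by linarith : (0 : ℝ) ≤ n)
      ((continuous_backKernel hc).pow 2 |>.intervalIntegrable 0 n)
      (continuous_const.intervalIntegrable 0 n) fun s hs => hk s hs.2
    exact hi.trans (le_of_eq (by simp; ring))
  have h5 := hk 0 (by linarith)
  rw [h2, ← h3] at h1
  -- The boundary term -a k(0)² of the energy identity does not grow with n, and n ≥ 1 lets it be
  -- absorbed after division by n.
  have h8 : 0 ≤ -a * (4 * M ^ 2) * (n - 1) :=
    mul_nonneg (mul_nonneg (by linarith) (by positivity)) (by linarith)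
  have h9 : (n : ℝ) * (1 - filteredGram a n j j) ≤ n * (4 * M ^ 2 * (a ^ 2 - a)) := by
    nlinarith
  exact le_of_mul_le_mul_left h9 (by linarith)

/-- The primitive of a basis function of frequency l has amplitude √2/(2πl). Both j = 2l and j = 2l
+ 1 are at most 3l, hence at most πl. -/
lemma four_mul_sq_le_of_le {l j : ℕ} (hl : 0 < l) (hj : j ≤ 3 * l) (hj0 : 0 < j) :
    4 * (√2 / (2 * Real.pi * l)) ^ 2 ≤ 2 * (1 / (j : ℝ) ^ 2) := by
  have h2 : (0 : ℝ) < j := by exact_mod_cast hj0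
  have h3 : (j : ℝ) ≤ Real.pi * l := by
    have : (j : ℝ) ≤ 3 * l := by exact_mod_cast hj
    nlinarith [Real.pi_gt_three]
  have h4 : √(2 : ℝ) ^ 2 = 2 := Real.sq_sqrt (by norm_num)
  rw [div_pow, h4, mul_one_div, mul_div_assoc', div_le_div_iff₀ (by positivity) (by positivity)]
  nlinarith

/-- The energy losses of the basis functions. -/
lemma one_sub_filteredGram_self_le (ha : a ≤ 0) (hn : 0 < n) (j : ℕ+) :
    1 - filteredGram a n j j
      ≤ (if j = 1 then 1 else 0) + 2 * (a ^ 2 - a) * (1 / ((j : ℕ) : ℝ) ^ 2) := by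
  have hA : 0 ≤ a ^ 2 - a := by nlinarith
  by_cases hj : j = 1
  -- The constant function has no bounded primitive; its deficit is bounded trivially by 1.
  · have := filteredGram_self_nonneg (a := a) (n := n) j
    rw [if_pos hj]
    have : 0 ≤ 2 * (a ^ 2 - a) * (1 / ((j : ℕ) : ℝ) ^ 2) := by positivity
    linarith
  rw [if_neg hj, zero_add]
  have hfin : ∀ l : ℕ, 0 < l → (j : ℕ) ≤ 3 * l → ∀ F : ℝ → ℝ,
      (∀ x, HasDerivAt F (trigBasis j x) x) → (∀ x, |F x| ≤ √2 / (2 * Real.pi * l)) →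
      1 - filteredGram a n j j ≤ 2 * (a ^ 2 - a) * (1 / ((j : ℕ) : ℝ) ^ 2) := by
    intro l hl hjl F hF hM
    refine (one_sub_filteredGram_self_le_of_primitive ha hn hF hM).trans ?_
    have := mul_le_mul_of_nonneg_right (four_mul_sq_le_of_le hl hjl j.pos) hA
    linarith
  have habs : ∀ (l : ℕ) (y : ℝ), |y| ≤ 1 → |√2 / (2 * Real.pi * l) * y| ≤ √2 / (2 * Real.pi * l) := by
    intro l y hy
    have : 0 ≤ √2 / (2 * Real.pi * l) := by have := Real.pi_pos; positivity
    rw [abs_mul, abs_of_nonneg this]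
    exact mul_le_of_le_one_right this hy
  rcases trigBasis_cases j with h | ⟨l, hl, hjl, h⟩ | ⟨l, hl, hjl, h⟩
  · exfalso
    have h0 := integral_trigBasis_mul j 1
    rw [if_neg hj, h] at h0
    simp [trigBasis] at h0
  · have hl' : (2 * Real.pi * l : ℝ) ≠ 0 := by have := Real.pi_pos; positivity
    refine hfin l hl (by omega) (fun x => √2 / (2 * Real.pi * l) * Real.sin (2 * Real.pi * l * x))
      (fun x => ?_) fun x => habs l _ (Real.abs_sin_le_one _)
    convert! (hasDerivAt_sin_mul (2 * Real.pi * l) x).const_mul (√2 / (2 * Real.pi * l)) using 1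
    rw [h]; field_simp
  · have hl' : (2 * Real.pi * l : ℝ) ≠ 0 := by have := Real.pi_pos; positivity
    refine hfin l hl (by omega) (fun x => √2 / (2 * Real.pi * l) * -Real.cos (2 * Real.pi * l * x))
      (fun x => ?_) fun x => habs l _ (by rw [abs_neg]; exact Real.abs_cos_le_one _)
    convert! (hasDerivAt_cos_mul (2 * Real.pi * l) x).neg.const_mul (√2 / (2 * Real.pi * l)) using 1
    rw [h]; field_simp

/-- The total energy loss is bounded. -/
theorem sum_one_sub_filteredGram_le (ha : a ≤ 0) (hn : 0 < n) (T : Finset ℕ+) :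
    ∑ j ∈ T, (1 - filteredGram a n j j) ≤ 1 + 4 * (a ^ 2 - a) := by
  have hA : 0 ≤ a ^ 2 - a := by nlinarith
  refine (Finset.sum_le_sum fun j _ => one_sub_filteredGram_self_le ha hn j).trans ?_
  rw [Finset.sum_add_distrib, ← Finset.mul_sum]
  have h1 : ∑ j ∈ T, (if j = 1 then (1 : ℝ) else 0) ≤ 1 := by
    rw [Finset.sum_ite_eq']; split_ifs <;> norm_num
  have h2 := mul_le_mul_of_nonneg_left (sum_inv_pnat_sq_le T)
    (by positivity : 0 ≤ 2 * (a ^ 2 - a))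
  linarith

end Deficit

/-! ### Conditions C1 and C2 -/

section Conditions

variable {Ω : Type*} [MeasurableSpace Ω] {P : Measure Ω} [IsProbabilityMeasure P]
  {lam : ℝ≥0} {r₁ r₂ a : ℝ} {w : ℝ≥0 → Ω → ℝ} {N : ℝ≥0 → Ω → ℕ} {Y : ℕ → Ω → ℝ}
  {ξ : ℝ≥0 → Ω → ℝ}

/-- The indices of the nonzero terms of a sequence with finitely many of them. -/
lemma exists_support_of_numNonzero_le {x : ℕ+ → ℝ} {n : ℕ} (h : numNonzero x ≤ n) :
    ∃ T : Finset ℕ+, T.card ≤ n ∧ (T.card : ℕ∞) = numNonzero x ∧ ∀ j ∉ T, x j = 0 := by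
  have hf : {j | 0 < |x j|}.Finite :=
    Set.encard_lt_top_iff.1 (h.trans_lt (ENat.natCast_lt_top n))
  have e : (hf.toFinset.card : ℕ∞) = numNonzero x := (hf.encard_eq_coe_toFinset_card).symm
  refine ⟨hf.toFinset, ?_, e, fun j hj => ?_⟩
  · rw [← e] at h; exact_mod_cast h
  · simpa using hj

/-- Since 0 ≤ G_jj ≤ 1, each second moment differs from ϱ* by at most ϱ*, and there are at most n
terms. Finiteness is all that is asked here; the sharper bound on the total deficit serves the
oracle inequality. -/
theorem IsOUNoise.conditionC1 (h : IsOUNoise P a lam r₁ r₂ w N Y ξ) (ha : a ≤ 0)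
    (hs : 0 < rhoStar lam r₁ r₂) : ConditionC1 P ξ (rhoStar lam r₁ r₂) := by
  refine ⟨hs, fun n hn => ?_⟩
  refine lt_of_le_of_lt (b := ENNReal.ofReal (n * rhoStar lam r₁ r₂)) ?_ ENNReal.ofReal_lt_top
  refine iSup₂_le fun x hx => ENNReal.ofReal_le_ofReal ?_
  obtain ⟨T, hT, -, hx0⟩ := exists_support_of_numNonzero_le hx.2
  rw [tsum_eq_sum (s := T) fun j hj => by simp [hx0 j hj]]
  refine (Finset.abs_sum_le_sum_abs _ _).trans ?_
  have : ∀ j ∈ T, |x j * ((∫ ω, xiCoeff n ξ j ω ^ 2 ∂P) - rhoStar lam r₁ r₂)|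
      ≤ rhoStar lam r₁ r₂ := fun j _ => by
    rw [(h.xiCoeff_sq hn j).2, abs_mul]
    have h1 := filteredGram_self_le ha hn j
    have h2 := filteredGram_self_nonneg (a := a) (n := n) j
    have h3 : |rhoStar lam r₁ r₂ * filteredGram a n j j - rhoStar lam r₁ r₂| ≤ rhoStar lam r₁ r₂ := by
      rw [abs_le]; constructor <;> nlinarith
    have h4 : |x j| ≤ 1 := abs_le.2 (hx.1 j)
    calc _ ≤ 1 * rhoStar lam r₁ r₂ := mul_le_mul h4 h3 (abs_nonneg _) zero_le_one
      _ = _ := one_mul _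
  refine (Finset.sum_le_sum this).trans ?_
  rw [Finset.sum_const, nsmul_eq_mul]
  exact mul_le_mul_of_nonneg_right (by exact_mod_cast hT) hs.le

theorem IsOUNoise.conditionC2 (h : IsOUNoise P a lam r₁ r₂ w N Y ξ) (ha : a ≤ 0) :
    ConditionC2 P ξ := by
  intro n hn
  set K := 2 * rhoStar lam r₁ r₂ ^ 2 + 64 * jumpConst P lam r₂ Y
  have hK : 0 ≤ K := by
    have := jumpConst_nonneg (P := P) (lam := lam) (r₂ := r₂) (Y := Y)
    positivity
  refine lt_of_le_of_lt (b := ENNReal.ofReal K) ?_ ENNReal.ofReal_lt_top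
  refine iSup₂_le fun x hx => ?_
  obtain ⟨T, hT, -, hx0⟩ := exists_support_of_numNonzero_le hx.2
  have h1 := hx.1
  rw [tsum_eq_sum (s := T) fun j hj => by simp [hx0 j hj]] at h1
  have e : ∀ ω, ∑' j, x j * (xiCoeff n ξ j ω ^ 2 - ∫ ω', xiCoeff n ξ j ω' ^ 2 ∂P)
      = ∑ j ∈ T, x j * (xiCoeff n ξ j ω ^ 2 - ∫ ω', xiCoeff n ξ j ω' ^ 2 ∂P) := fun ω =>
    tsum_eq_sum fun j hj => by simp [hx0 j hj]
  simp_rw [e]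
  obtain ⟨hi, hle⟩ := h.integral_sum_xiCoeff_sq_sub_le ha hn T hT x
  rw [← ofReal_integral_eq_lintegral_ofReal hi (Eventually.of_forall fun ω => sq_nonneg _)]
  exact ENNReal.ofReal_le_ofReal (hle.trans (mul_le_of_le_one_right hK h1))

end Conditions

/-! ### Centring of the stochastic integrals -/

section Mean

variable {Ω : Type*} [MeasurableSpace Ω] {P : Measure Ω} [IsProbabilityMeasure P]
  {lam : ℝ≥0} {r₁ r₂ a : ℝ} {w : ℝ≥0 → Ω → ℝ} {N : ℝ≥0 → Ω → ℕ} {Y : ℕ → Ω → ℝ}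
  {ξ : ℝ≥0 → Ω → ℝ}

lemma IsOUNoise.integral_drivingSum (h : IsOUNoise P a lam r₁ r₂ w N Y ξ) (n m : ℕ) (j : ℕ+) :
    ∫ ω, drivingSum r₁ r₂ w N Y a n m j ω ∂P = 0 := by
  obtain ⟨C, hC, hinc⟩ := h.increments
  obtain ⟨-, hmom⟩ := hinc ((n : ℝ≥0) / m) (fun i : ℕ => (n : ℝ≥0) * i / m) (by simp)
    (fun i => by push_cast; ring)
  simp only [drivingSum, riemannSum]
  rw [integral_finsetSum]
  · refine Finset.sum_eq_zero fun i _ => ?_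
    have := (hmom i).2.1
    push_cast at this
    rw [integral_const_mul, this, mul_zero]
  · intro i _
    have := (hmom i).1.integrable (by norm_num)
    push_cast at this
    exact this.const_mul _

/-- The stochastic integrals are square integrable and centred. -/
theorem IsOUNoise.xiCoeff_mean (h : IsOUNoise P a lam r₁ r₂ w N Y ξ) {n : ℕ} (hn : 0 < n)
    (j : ℕ+) : MemLp (xiCoeff n ξ j) 2 P ∧ ∫ ω, xiCoeff n ξ j ω ∂P = 0 := by
  obtain ⟨C, hC, hmom⟩ := h.drivingSum_moments
  set Z : ℕ → Ω → ℝ := fun m => drivingSum r₁ r₂ w N Y a n (m + 1) j with hZ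
  set I : Ω → ℝ := xiCoeff n ξ j
  have hlim : ∀ᵐ ω ∂P, Tendsto (fun m => Z m ω) atTop (𝓝 (I ω)) := by
    filter_upwards [h.tendsto_coeff hn] with ω hω
    exact (tendsto_add_atTop_iff_nat (f := fun m => drivingSum r₁ r₂ w N Y a n m j ω) 1).2 (hω j).2
  have hZ2 : ∀ m, MemLp (Z m) 2 P := fun m =>
    ((hmom n (m + 1) m.succ_pos).1 j).mono_exponent (by norm_num)
  have hIm : AEStronglyMeasurable I P :=
    aestronglyMeasurable_of_tendsto_ae atTop (fun m => (hZ2 m).1) hlim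
  have hI2 : MemLp I 2 P := (memLp_two_iff_integrable_sq hIm).2 (h.xiCoeff_sq hn j).1
  refine ⟨hI2, ?_⟩
  have exp : ∀ {X : Ω → ℝ} (c : ℝ), MemLp X 2 P →
      ∫ ω, (X ω - c) ^ 2 ∂P = (∫ ω, X ω ^ 2 ∂P) - 2 * c * (∫ ω, X ω ∂P) + c ^ 2 := by
    intro X c hX
    have i1 : Integrable X P := hX.integrable (by norm_num)
    have i2 : Integrable (fun ω => X ω ^ 2) P := hX.integrable_sq
    have i3 : Integrable (fun ω => X ω ^ 2 - 2 * c * X ω) P := i2.sub (i1.const_mul _)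
    have e : ∀ ω, (X ω - c) ^ 2 = X ω ^ 2 - 2 * c * X ω + c ^ 2 := fun ω => by ring
    simp_rw [e]
    rw [integral_add i3 (integrable_const _), integral_sub i2 (i1.const_mul _), integral_const_mul]
    simp
  have hcont : Continuous fun t => (∑ j ∈ {j}, (fun _ => (1 : ℝ)) j * filteredBasis a n j t) ^ 2 :=
    (continuous_finsetSum _ fun j _ => (continuous_filteredBasis j).const_mul _).pow 2
  have hZ2l : Tendsto (fun m => ∫ ω, Z m ω ^ 2 ∂P) atTop (𝓝 (∫ ω, I ω ^ 2 ∂P)) := by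
    rw [(h.xiCoeff_sq hn j).2]
    have e1 : filteredGram a n j j = ∫ t in (0 : ℝ)..n,
        (∑ j ∈ {j}, (fun _ => (1 : ℝ)) j * filteredBasis a n j t) ^ 2 := by
      simp [filteredGram, pow_two]
    rw [e1]
    refine (((tendsto_add_atTop_iff_nat 1).2 (tendsto_leftSum hcont hn)).const_mul _).congr
      fun m => ?_
    have := (hmom n (m + 1) m.succ_pos).2.1 {j} (fun _ => 1)
    rw [← this]
    simp [hZ]
  -- Fatou for (Z - c)² and convergence of the second moments give E I² - 2c E I + c² ≤ E I² + c²
  -- for c of either sign, which forces E I = 0.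
  have key : ∀ c : ℝ, 0 ≤ 2 * c * ∫ ω, I ω ∂P := by
    intro c
    have := (integral_le_of_tendsto (P := P) (F := fun m ω => (Z m ω - c) ^ 2)
      (G := fun ω => (I ω - c) ^ 2) (fun m => ((hZ2 m).sub (memLp_const c)).integrable_sq)
      (fun m ω => sq_nonneg _) (hlim.mono fun ω hω => (hω.sub_const c).pow 2)
      (c := fun m => (∫ ω, Z m ω ^ 2 ∂P) + c ^ 2) (Eventually.of_forall fun m => by
        rw [exp c (hZ2 m), h.integral_drivingSum]; simp) (hZ2l.add_const _)).2
    rw [exp c hI2] at this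
    linarith
  have k1 := key 1
  have k2 := key (-1)
  linarith

end Mean

/-! ### The observations as a sequence model -/

section Observations

variable {S : ℝ → ℝ}

/-- The Fourier coefficients of the signal. -/
noncomputable def fourierCoefficient (S : ℝ → ℝ) (j : ℕ+) : ℝ :=
  ∫ t in (0 : ℝ)..1, trigBasis j t * S t

lemma intervalIntegrable_of_periodic (hper : Function.Periodic S 1)
    (hS : MemLp S 2 (volume.restrict (Set.Icc (0 : ℝ) 1))) (b c : ℝ) :
    IntervalIntegrable S volume b c := by
  refine hper.intervalIntegrable₀ one_ne_zero ?_ b c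
  rw [intervalIntegrable_iff_integrableOn_Icc_of_le zero_le_one]
  exact hS.integrable (by norm_num)

variable {Ω : Type*} [MeasurableSpace Ω] {P : Measure Ω} [IsProbabilityMeasure P]
  {lam : ℝ≥0} {r₁ r₂ a : ℝ} {w : ℝ≥0 → Ω → ℝ} {N : ℝ≥0 → Ω → ℕ} {Y : ℕ → Ω → ℝ}
  {ξ : ℝ≥0 → Ω → ℝ}

/-- The estimated Fourier coefficients are the Fourier coefficients plus noise. -/
theorem IsOUNoise.thetaHat_observed (h : IsOUNoise P a lam r₁ r₂ w N Y ξ)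
    (hper : Function.Periodic S 1) (hS : MemLp S 2 (volume.restrict (Set.Icc (0 : ℝ) 1)))
    {n : ℕ} (hn : 0 < n) :
    ∀ᵐ ω ∂P, ∀ j, thetaHat n (fun t => observed S ξ t ω) j
      = fourierCoefficient S j + xiCoeff n ξ j ω / √n := by
  have hi := intervalIntegrable_of_periodic hper hS
  filter_upwards [h.tendsto_coeff hn] with ω hω j
  obtain ⟨f', hf, hf'⟩ := exists_hasDerivAt_trigBasis j
  have h1 := (tendsto_riemannSum_primitive (fun b => hi 0 b) hn hf hf').add (hω j).1
  have h2 : Tendsto (riemannSum (trigBasis j) (fun t => observed S ξ t ω) n) atTop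
      (𝓝 ((∫ t in (0 : ℝ)..n, trigBasis j t * S t) + √n * xiCoeff n ξ j ω)) :=
    h1.congr fun m => (riemannSum_add _ _ _ _ _).symm
  have hp : Function.Periodic (fun t => trigBasis j t * S t) 1 := (periodic_trigBasis j).mul hper
  have h3 := integral_periodic_nat hp
    (fun b c => (hi b c).continuousOn_mul (continuous_trigBasis j).continuousOn) n
  have hn' : (0 : ℝ) < n := by exact_mod_cast hn
  have hs : √(n : ℝ) * √n = n := Real.mul_self_sqrt hn'.le
  have hs0 : 0 < √(n : ℝ) := Real.sqrt_pos.2 hn'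
  rw [thetaHat, pathIntegral_eq_of_tendsto h2, h3, fourierCoefficient, mul_add]
  congr 1
  · field_simp
  · rw [div_mul_eq_mul_div, one_mul, div_eq_div_iff hn'.ne' hs0.ne']
    linear_combination xiCoeff n ξ j ω * hs

/-- By orthonormality the error splits into the coefficient errors on T and a residual energy of S
independent of c. Completeness of the basis is not needed. -/
lemma integral_sq_sub_sum_trigBasis (hS : MemLp S 2 (volume.restrict (Set.Icc (0 : ℝ) 1)))
    (T : Finset ℕ+) (c : ℕ+ → ℝ) :
    Integrable (fun x => ((∑ j ∈ T, c j * trigBasis j x) - S x) ^ 2)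
        (volume.restrict (Set.Icc (0 : ℝ) 1)) ∧
      ∫ x in Set.Icc (0 : ℝ) 1, ((∑ j ∈ T, c j * trigBasis j x) - S x) ^ 2
        = (∑ j ∈ T, (c j - fourierCoefficient S j) ^ 2)
          + ((∫ x in Set.Icc (0 : ℝ) 1, S x ^ 2) - ∑ j ∈ T, fourierCoefficient S j ^ 2) := by
  set ν := volume.restrict (Set.Icc (0 : ℝ) 1)
  have hφ : ∀ j, MemLp (trigBasis j) 2 ν := fun j =>
    MemLp.of_bound (continuous_trigBasis j).aestronglyMeasurable (√2)
      (Eventually.of_forall fun x => abs_trigBasis_le j x)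
  have hsum : MemLp (fun x => ∑ j ∈ T, c j * trigBasis j x) 2 ν :=
    memLp_finsetSum _ fun j _ => (hφ j).const_mul _
  have hi : ∀ j, Integrable (fun x => trigBasis j x * S x) ν := fun j => (hφ j).integrable_mul hS
  have hi2 : Integrable (fun x => ∑ j ∈ T, c j * (trigBasis j x * S x)) ν :=
    integrable_finsetSum _ fun j _ => (hi j).const_mul _
  refine ⟨(hsum.sub hS).integrable_sq, ?_⟩
  have e : ∀ x, ((∑ j ∈ T, c j * trigBasis j x) - S x) ^ 2
      = (∑ j ∈ T, c j * trigBasis j x) ^ 2 - 2 * (∑ j ∈ T, c j * (trigBasis j x * S x)) + S x ^ 2 := by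
    intro x
    have : ∑ j ∈ T, c j * (trigBasis j x * S x) = (∑ j ∈ T, c j * trigBasis j x) * S x := by
      rw [Finset.sum_mul]; exact Finset.sum_congr rfl fun j _ => by ring
    rw [this]; ring
  have toInt : ∀ f : ℝ → ℝ, ∫ x, f x ∂ν = ∫ x in (0 : ℝ)..1, f x := fun f => by
    rw [intervalIntegral.integral_of_le zero_le_one, integral_Icc_eq_integral_Ioc]
  have i1 : Integrable (fun x => (∑ j ∈ T, c j * trigBasis j x) ^ 2
      - 2 * (∑ j ∈ T, c j * (trigBasis j x * S x))) ν := hsum.integrable_sq.sub (hi2.const_mul 2)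
  simp_rw [e]
  rw [integral_add i1 hS.integrable_sq, integral_sub hsum.integrable_sq (hi2.const_mul 2),
    integral_const_mul, integral_finsetSum _ fun j _ => (hi j).const_mul _]
  simp_rw [integral_const_mul]
  rw [toInt, integral_sum_trigBasis_sq (w := 1) (by simpa using integral_trigBasis_mul)]
  simp_rw [toInt fun x => trigBasis _ x * S x]
  have e3 : ∑ j ∈ T, (c j - fourierCoefficient S j) ^ 2 = (∑ j ∈ T, c j ^ 2)
      - 2 * (∑ j ∈ T, c j * fourierCoefficient S j) + ∑ j ∈ T, fourierCoefficient S j ^ 2 := by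
    rw [Finset.mul_sum, ← Finset.sum_sub_distrib, ← Finset.sum_add_distrib]
    exact Finset.sum_congr rfl fun j _ => by ring
  rw [e3]
  simp only [fourierCoefficient]
  ring

/-- Bessel's inequality. -/
lemma sum_fourierCoefficient_sq_le (hS : MemLp S 2 (volume.restrict (Set.Icc (0 : ℝ) 1)))
    (T : Finset ℕ+) :
    ∑ j ∈ T, fourierCoefficient S j ^ 2 ≤ ∫ x in Set.Icc (0 : ℝ) 1, S x ^ 2 := by
  have h := (integral_sq_sub_sum_trigBasis hS T (fourierCoefficient S)).2
  have h0 : 0 ≤ ∫ x in Set.Icc (0 : ℝ) 1,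
      ((∑ j ∈ T, fourierCoefficient S j * trigBasis j x) - S x) ^ 2 :=
    integral_nonneg fun x => sq_nonneg _
  rw [h] at h0
  simpa using h0

/-- The error of a weighted least squares estimate. -/
lemma lintegral_weightedLSE_sub (hS : MemLp S 2 (volume.restrict (Set.Icc (0 : ℝ) 1)))
    {n : ℕ} (y : ℝ≥0 → ℝ) {T : Finset ℕ+} {γ : ℕ+ → ℝ} (hγ : ∀ j ∉ T, γ j = 0) :
    ∫⁻ x in Set.Icc (0 : ℝ) 1, ENNReal.ofReal ((weightedLSE n y γ x - S x) ^ 2)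
      = ENNReal.ofReal ((∑ j ∈ T, (γ j * thetaHat n y j - fourierCoefficient S j) ^ 2)
          + ((∫ x in Set.Icc (0 : ℝ) 1, S x ^ 2) - ∑ j ∈ T, fourierCoefficient S j ^ 2)) := by
  have e : ∀ x, weightedLSE n y γ x = ∑ j ∈ T, γ j * thetaHat n y j * trigBasis j x := fun x =>
    tsum_eq_sum fun j hj => by simp [hγ j hj]
  simp_rw [e]
  obtain ⟨h1, h2⟩ := integral_sq_sub_sum_trigBasis hS T fun j => γ j * thetaHat n y j
  rw [← h2, ofReal_integral_eq_lintegral_ofReal h1 (Eventually.of_forall fun x => sq_nonneg _)]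

end Observations

/-! ### The pathwise oracle inequality -/

section Pathwise

/-- Expand (ρQ - M)² ≥ 0. For Q = 0 the quotient is 0 by convention, which is harmless since then M
= 0. -/
lemma two_mul_le_add_sq_div {M Q ρ : ℝ} (hQ : 0 ≤ Q) (hρ : 0 < ρ) (h0 : Q = 0 → M = 0) :
    2 * M ≤ ρ * Q + M ^ 2 / Q / ρ := by
  rcases hQ.eq_or_lt with h | h
  · simp [h0 h.symm, ← h]
  · have e : ρ * Q + M ^ 2 / Q / ρ - 2 * M = (ρ * Q - M) ^ 2 / (Q * ρ) := by
      field_simp; ring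
    have : 0 ≤ (ρ * Q - M) ^ 2 / (Q * ρ) := by positivity
    linarith

variable {ι : Type*} (T : Finset ι)

/-- The loss minus the cost of a weighted estimate, up to a term that does not depend on the
weights. -/
lemma loss_eq (θ e q γ : ι → ℝ) (s σ ρ : ℝ) :
    ∑ j ∈ T, (γ j * (θ j + e j) - θ j) ^ 2
      = ((∑ j ∈ T, γ j ^ 2 * (θ j + e j) ^ 2) - 2 * (∑ j ∈ T, γ j * ((θ j + e j) ^ 2 - σ))
          + ρ * (σ * ∑ j ∈ T, γ j ^ 2))
        + 2 * (∑ j ∈ T, γ j * θ j * e j) + 2 * (∑ j ∈ T, γ j * (e j ^ 2 - q j))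
        - 2 * (∑ j ∈ T, γ j * (s - q j)) + 2 * (s - σ) * (∑ j ∈ T, γ j)
        - ρ * (σ * ∑ j ∈ T, γ j ^ 2) + ∑ j ∈ T, θ j ^ 2 := by
  simp only [Finset.mul_sum, ← Finset.sum_add_distrib, ← Finset.sum_sub_distrib]
  exact Finset.sum_congr rfl fun j _ => by ring

/-- The pathwise form of the oracle inequality. -/
theorem oracle_pathwise (θ e q γ γ₀ : ι → ℝ) {s σ ρ μ D τ : ℝ} (hs : 0 < s) (hρ : 0 < ρ)
    (hρ' : ρ < 1 / 3) (hτ : 0 ≤ τ) (hγ : ∀ j, 0 ≤ γ j ∧ γ j ≤ 1) (hγ₀ : ∀ j, 0 ≤ γ₀ j ∧ γ₀ j ≤ 1)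
    (hq : ∀ j, q j ≤ s) (hD : ∑ j ∈ T, (s - q j) ≤ D) (hμ : ∑ j ∈ T, γ j ≤ μ)
    (hμ₀ : ∑ j ∈ T, γ₀ j ≤ μ)
    (hJ : (∑ j ∈ T, γ j ^ 2 * (θ j + e j) ^ 2) - 2 * (∑ j ∈ T, γ j * ((θ j + e j) ^ 2 - σ))
          + ρ * (σ * ∑ j ∈ T, γ j ^ 2)
        ≤ (∑ j ∈ T, γ₀ j ^ 2 * (θ j + e j) ^ 2) - 2 * (∑ j ∈ T, γ₀ j * ((θ j + e j) ^ 2 - σ))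
          + ρ * (σ * ∑ j ∈ T, γ₀ j ^ 2)) :
    (1 - 3 * ρ) * ((∑ j ∈ T, (γ j * (θ j + e j) - θ j) ^ 2) + τ)
      ≤ (1 + ρ) * ((∑ j ∈ T, (γ₀ j * (θ j + e j) - θ j) ^ 2) + τ)
        + ((∑ j ∈ T, (γ j - γ₀ j) ^ 2 * θ j * e j) ^ 2 / (∑ j ∈ T, (γ j - γ₀ j) ^ 2 * θ j ^ 2)
          + (1 - ρ) * ((∑ j ∈ T, (γ j - γ₀ j) * θ j * e j) ^ 2
              / (∑ j ∈ T, (γ j - γ₀ j) ^ 2 * θ j ^ 2) / ρ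
            + (∑ j ∈ T, γ j * (e j ^ 2 - q j)) ^ 2 / (s * ∑ j ∈ T, γ j ^ 2) / ρ))
        + (1 - ρ) * (2 * D - 2 * (∑ j ∈ T, γ₀ j * (e j ^ 2 - q j)) + (2 + ρ) * μ * |σ - s|
          + ρ * (s * ∑ j ∈ T, γ₀ j ^ 2)) := by
  set E := (∑ j ∈ T, (γ j * (θ j + e j) - θ j) ^ 2) with hE
  set E₀ := (∑ j ∈ T, (γ₀ j * (θ j + e j) - θ j) ^ 2) with hE₀
  set Q := ∑ j ∈ T, (γ j - γ₀ j) ^ 2 * θ j ^ 2 with hQ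
  set A := ∑ j ∈ T, (γ j - γ₀ j) * θ j * e j with hA
  set A₂ := ∑ j ∈ T, (γ j - γ₀ j) ^ 2 * θ j * e j with hA₂
  set B := ∑ j ∈ T, γ j * (e j ^ 2 - q j) with hB
  set B₀ := ∑ j ∈ T, γ₀ j * (e j ^ 2 - q j) with hB₀
  set g := ∑ j ∈ T, γ j ^ 2 with hg
  set g₀ := ∑ j ∈ T, γ₀ j ^ 2 with hg₀
  set l := ∑ j ∈ T, γ j with hl
  set l₀ := ∑ j ∈ T, γ₀ j with hl₀
  have nn : ∀ δ : ι → ℝ, (∀ j, 0 ≤ δ j ∧ δ j ≤ 1) → 0 ≤ ∑ j ∈ T, δ j ^ 2 ∧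
      ∑ j ∈ T, δ j ^ 2 ≤ ∑ j ∈ T, δ j ∧ 0 ≤ ∑ j ∈ T, δ j * (s - q j) ∧
      ∑ j ∈ T, δ j * (s - q j) ≤ D := fun δ hδ =>
    ⟨Finset.sum_nonneg fun j _ => sq_nonneg _,
      Finset.sum_le_sum fun j _ => by nlinarith [hδ j],
      Finset.sum_nonneg fun j _ => mul_nonneg (hδ j).1 (sub_nonneg.2 (hq j)),
      (Finset.sum_le_sum fun j _ =>
        mul_le_of_le_one_left (sub_nonneg.2 (hq j)) (hδ j).2).trans hD⟩
  obtain ⟨n1, n2, n3, n4⟩ := nn γ hγ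
  obtain ⟨m1, m2, m3, m4⟩ := nn γ₀ hγ₀
  have hQ0 : 0 ≤ Q := Finset.sum_nonneg fun j _ => by positivity
  have hzero : Q = 0 → ∀ j ∈ T, (γ j - γ₀ j) * θ j = 0 := fun h j hj => by
    have := (Finset.sum_eq_zero_iff_of_nonneg fun j _ => by positivity).1 h j hj
    rw [← mul_pow] at this
    exact pow_eq_zero_iff (two_ne_zero) |>.1 this
  have hA0 : Q = 0 → A = 0 := fun h => Finset.sum_eq_zero fun j hj => by
    rw [hzero h j hj, zero_mul]
  have hA₂0 : Q = 0 → -A₂ = 0 := fun h => by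
    rw [neg_eq_zero]
    exact Finset.sum_eq_zero fun j hj => by rw [pow_two, mul_assoc (γ j - γ₀ j), hzero h j hj]; simp
  have hB0 : s * g = 0 → B = 0 := fun h => by
    have h' : g = 0 := (mul_eq_zero.1 h).resolve_left hs.ne'
    refine Finset.sum_eq_zero fun j hj => ?_
    have := (Finset.sum_eq_zero_iff_of_nonneg fun j _ => by positivity).1 h' j hj
    rw [pow_eq_zero_iff two_ne_zero |>.1 this, zero_mul]
  have i1 := two_mul_le_add_sq_div hQ0 hρ hA0
  have i2 := two_mul_le_add_sq_div hQ0 hρ hA₂0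
  have i3 := two_mul_le_add_sq_div (mul_nonneg hs.le n1) hρ hB0
  rw [neg_sq] at i2
  -- the estimate of the distance of the two estimators
  have i4 : Q + 2 * A₂ ≤ 2 * (E + τ) + 2 * (E₀ + τ) := by
    have : Q + 2 * A₂ ≤ 2 * E + 2 * E₀ := by
      simp only [hQ, hA₂, hE, hE₀, Finset.mul_sum, ← Finset.sum_add_distrib]
      refine Finset.sum_le_sum fun j _ => ?_
      nlinarith [sq_nonneg ((γ j + γ₀ j) * (θ j + e j) - 2 * θ j),
        sq_nonneg ((γ j - γ₀ j) * e j)]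
    linarith
  have l1 := loss_eq T θ e q γ s σ ρ
  have l2 := loss_eq T θ e q γ₀ s σ ρ
  have hAd : A = (∑ j ∈ T, γ j * θ j * e j) - ∑ j ∈ T, γ₀ j * θ j * e j := by
    rw [hA, ← Finset.sum_sub_distrib]; exact Finset.sum_congr rfl fun j _ => by ring
  have v1 : 2 * (s - σ) * (l - l₀) ≤ 2 * μ * |σ - s| := by
    have : |l - l₀| ≤ μ := abs_le.2 ⟨by linarith, by linarith⟩
    calc 2 * (s - σ) * (l - l₀) ≤ |2 * (s - σ) * (l - l₀)| := le_abs_self _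
      _ = 2 * |l - l₀| * |σ - s| := by rw [abs_mul, abs_mul, abs_sub_comm s]; simp; ring
      _ ≤ _ := by gcongr
  have v2 : (s - σ) * (g - g₀) ≤ μ * |σ - s| := by
    have : |g - g₀| ≤ μ := abs_le.2 ⟨by linarith, by linarith⟩
    calc (s - σ) * (g - g₀) ≤ |(s - σ) * (g - g₀)| := le_abs_self _
      _ = |g - g₀| * |σ - s| := by rw [abs_mul, abs_sub_comm s]; ring
      _ ≤ _ := by gcongr
  have v3 := mul_le_mul_of_nonneg_left v2 hρ.le
  -- Subtract the two loss identities and use the minimality of γ. The term ρsg spent on the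
  -- quadratic noise is repaid by the penalty -ρσg, up to the error of σ.
  have main : E - E₀ ≤ ρ * Q + A ^ 2 / Q / ρ + 2 * D + B ^ 2 / (s * g) / ρ - 2 * B₀
      + (2 + ρ) * μ * |σ - s| + ρ * (s * g₀) := by
    rw [← hE, ← hB, ← hg, ← hl] at l1
    rw [← hE₀, ← hB₀, ← hg₀, ← hl₀] at l2
    generalize A ^ 2 / Q / ρ = X at *
    generalize B ^ 2 / (s * g) / ρ = X' at *
    linarith
  -- Here Q is traded for the losses. Moving 2ρE to the left after multiplication of `main` by 1 - ρ
  -- leaves the factors 1 - 3ρ and 1 + ρ.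
  have main2 : (1 - ρ) * (ρ * Q) ≤ ρ * (2 * (E + τ) + 2 * (E₀ + τ)) + A₂ ^ 2 / Q := by
    have : (1 - ρ) * Q ≤ 2 * (E + τ) + 2 * (E₀ + τ) + A₂ ^ 2 / Q / ρ := by linarith
    have := mul_le_mul_of_nonneg_left this hρ.le
    have e : ρ * (A₂ ^ 2 / Q / ρ) = A₂ ^ 2 / Q := by field_simp
    linarith
  have main3 := mul_le_mul_of_nonneg_left main (by linarith : (0 : ℝ) ≤ 1 - ρ)
  generalize A ^ 2 / Q / ρ = X at *
  generalize A₂ ^ 2 / Q = X₂ at *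
  generalize B ^ 2 / (s * g) / ρ = X' at *
  linarith

end Pathwise

/-! ### The oracle inequality in expectation -/

section Expectation

variable {Ω : Type*} [MeasurableSpace Ω] {P : Measure Ω} [IsProbabilityMeasure P] {ι : Type*}

/-- The expected quadratic loss of a weighted estimate. -/
lemma integral_loss {T : Finset ι} {e : ι → Ω → ℝ} {q : ι → ℝ} (he : ∀ j, MemLp (e j) 2 P)
    (he1 : ∀ j, ∫ ω, e j ω ∂P = 0) (he2 : ∀ j, ∫ ω, e j ω ^ 2 ∂P = q j) (θ γ : ι → ℝ) :
    Integrable (fun ω => ∑ j ∈ T, (γ j * (θ j + e j ω) - θ j) ^ 2) P ∧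
      ∫ ω, ∑ j ∈ T, (γ j * (θ j + e j ω) - θ j) ^ 2 ∂P
        = ∑ j ∈ T, ((γ j - 1) ^ 2 * θ j ^ 2 + γ j ^ 2 * q j) := by
  have i1 : ∀ j, Integrable (e j) P := fun j => (he j).integrable (by norm_num)
  have i2 : ∀ j, Integrable (fun ω => e j ω ^ 2) P := fun j => (he j).integrable_sq
  have i3 : ∀ j, Integrable (fun ω => γ j ^ 2 * e j ω ^ 2 + 2 * (γ j * (γ j - 1) * θ j) * e j ω) P :=
    fun j => ((i2 j).const_mul _).add ((i1 j).const_mul _)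
  have ex : ∀ j ω, (γ j * (θ j + e j ω) - θ j) ^ 2
      = γ j ^ 2 * e j ω ^ 2 + 2 * (γ j * (γ j - 1) * θ j) * e j ω + (γ j - 1) ^ 2 * θ j ^ 2 :=
    fun j ω => by ring
  have i4 : ∀ j, Integrable (fun ω => (γ j * (θ j + e j ω) - θ j) ^ 2) P := fun j => by
    simp_rw [ex]; exact (i3 j).add (integrable_const _)
  refine ⟨integrable_finsetSum _ fun j _ => i4 j, ?_⟩
  rw [integral_finsetSum _ fun j _ => i4 j]
  refine Finset.sum_congr rfl fun j _ => ?_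
  simp_rw [ex]
  rw [integral_add (i3 j) (integrable_const _), integral_add ((i2 j).const_mul _)
    ((i1 j).const_mul _), integral_const_mul, integral_const_mul, he1, he2]
  simp; ring

/-- The oracle inequality for estimates in the sequence model `θ + e`. -/
theorem oracle_expectation {T : Finset ι} {e : ι → Ω → ℝ} {q θ : ι → ℝ} {s ρ μ D τ K : ℝ}
    (hs : 0 < s) (hρ : 0 < ρ) (hρ' : ρ < 1 / 3) (hτ : 0 ≤ τ) (hK : 0 ≤ K)
    (he : ∀ j, MemLp (e j) 2 P) (he1 : ∀ j, ∫ ω, e j ω ∂P = 0)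
    (he2 : ∀ j, ∫ ω, e j ω ^ 2 ∂P = q j) (hq : ∀ j, q j ≤ s) (hD : ∑ j ∈ T, (s - q j) ≤ D)
    (hlin : ∀ c : ι → ℝ, ∫ ω, (∑ j ∈ T, c j * e j ω) ^ 2 ∂P ≤ s * ∑ j ∈ T, c j ^ 2)
    {Γ : Finset (ι → ℝ)} (hΓ : ∀ γ ∈ Γ, (∀ j, 0 ≤ γ j ∧ γ j ≤ 1) ∧ ∑ j ∈ T, γ j ≤ μ)
    (hquad : ∀ γ ∈ Γ, Integrable (fun ω => (∑ j ∈ T, γ j * (e j ω ^ 2 - q j)) ^ 2) P ∧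
      ∫ ω, (∑ j ∈ T, γ j * (e j ω ^ 2 - q j)) ^ 2 ∂P ≤ K * ∑ j ∈ T, γ j ^ 2)
    {σ : Ω → ℝ} (hσ : Integrable (fun ω => |σ ω - s|) P) {γ₀ : ι → ℝ} (hγ₀ : γ₀ ∈ Γ)
    {γ : Ω → ι → ℝ} (hγ : ∀ ω, γ ω ∈ Γ)
    (hJ : ∀ᵐ ω ∂P, (∑ j ∈ T, γ ω j ^ 2 * (θ j + e j ω) ^ 2)
          - 2 * (∑ j ∈ T, γ ω j * ((θ j + e j ω) ^ 2 - σ ω)) + ρ * (σ ω * ∑ j ∈ T, γ ω j ^ 2)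
        ≤ (∑ j ∈ T, γ₀ j ^ 2 * (θ j + e j ω) ^ 2)
          - 2 * (∑ j ∈ T, γ₀ j * ((θ j + e j ω) ^ 2 - σ ω)) + ρ * (σ ω * ∑ j ∈ T, γ₀ j ^ 2)) :
    ∫⁻ ω, ENNReal.ofReal ((∑ j ∈ T, (γ ω j * (θ j + e j ω) - θ j) ^ 2) + τ) ∂P
      ≤ ENNReal.ofReal (((1 + 2 * ρ - ρ ^ 2)
            * (∫ ω, ((∑ j ∈ T, (γ₀ j * (θ j + e j ω) - θ j) ^ 2) + τ) ∂P)
          + Γ.card * (s + (s / ρ + K / s / ρ))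
          + (1 - ρ) * (2 + ρ) * (D + μ * ∫ ω, |σ ω - s| ∂P)) / (1 - 3 * ρ)) := by
  set W : (ι → ℝ) → Ω → ℝ := fun γ ω =>
    (∑ j ∈ T, (γ j - γ₀ j) ^ 2 * θ j * e j ω) ^ 2 / (∑ j ∈ T, (γ j - γ₀ j) ^ 2 * θ j ^ 2)
      + (1 - ρ) * ((∑ j ∈ T, (γ j - γ₀ j) * θ j * e j ω) ^ 2
        / (∑ j ∈ T, (γ j - γ₀ j) ^ 2 * θ j ^ 2) / ρ
      + (∑ j ∈ T, γ j * (e j ω ^ 2 - q j)) ^ 2 / (s * ∑ j ∈ T, γ j ^ 2) / ρ) with hW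
  set R : Ω → ℝ := fun ω => (∑ j ∈ T, (γ₀ j * (θ j + e j ω) - θ j) ^ 2) + τ with hR
  have h1ρ : 0 ≤ 1 - ρ := by linarith
  have hW0 : ∀ γ ω, 0 ≤ W γ ω := fun γ ω => by
    positivity
  have hlin_int : ∀ c : ι → ℝ, Integrable (fun ω => (∑ j ∈ T, c j * e j ω) ^ 2) P := fun c =>
    MemLp.integrable_sq (memLp_finsetSum _ fun j _ => (he j).const_mul _)
  -- For fixed γ each numerator has a second moment proportional to its denominator, so the bound
  -- depends neither on γ nor on θ. For the first ratio (γ - γ₀)⁴ ≤ (γ - γ₀)² is used.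
  have hWint : ∀ γ ∈ Γ, Integrable (W γ) P ∧ ∫ ω, W γ ω ∂P ≤ s + (s / ρ + K / s / ρ) := by
    intro γ hγ
    have hx : ∀ j, (γ j - γ₀ j) ^ 2 ≤ 1 := fun j => by
      have h1 := (hΓ γ hγ).1 j
      have h2 := (hΓ γ₀ hγ₀).1 j
      rw [sq_le_one_iff_abs_le_one, abs_le]
      constructor <;> linarith
    have hQ0 : 0 ≤ ∑ j ∈ T, (γ j - γ₀ j) ^ 2 * θ j ^ 2 :=
      Finset.sum_nonneg fun j _ => by positivity
    have hg0 : 0 ≤ ∑ j ∈ T, γ j ^ 2 := Finset.sum_nonneg fun j _ => by positivity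
    have a1 := (hlin_int fun j => (γ j - γ₀ j) ^ 2 * θ j).div_const
      (∑ j ∈ T, (γ j - γ₀ j) ^ 2 * θ j ^ 2)
    have a2 := ((hlin_int fun j => (γ j - γ₀ j) * θ j).div_const
      (∑ j ∈ T, (γ j - γ₀ j) ^ 2 * θ j ^ 2)).div_const ρ
    have a3 := ((hquad γ hγ).1.div_const (s * ∑ j ∈ T, γ j ^ 2)).div_const ρ
    have b1 : ∫ ω, (∑ j ∈ T, (γ j - γ₀ j) ^ 2 * θ j * e j ω) ^ 2
        / (∑ j ∈ T, (γ j - γ₀ j) ^ 2 * θ j ^ 2) ∂P ≤ s := by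
      rw [integral_div]
      refine div_le_of_le_mul₀ hQ0 hs.le ((hlin _).trans (mul_le_mul_of_nonneg_left ?_ hs.le))
      refine Finset.sum_le_sum fun j _ => ?_
      have := mul_le_mul_of_nonneg_right (hx j) (by positivity : 0 ≤ (γ j - γ₀ j) ^ 2 * θ j ^ 2)
      linarith
    have b2 : ∫ ω, (∑ j ∈ T, (γ j - γ₀ j) * θ j * e j ω) ^ 2
        / (∑ j ∈ T, (γ j - γ₀ j) ^ 2 * θ j ^ 2) / ρ ∂P ≤ s / ρ := by
      rw [integral_div, integral_div]
      refine div_le_div_of_nonneg_right (div_le_of_le_mul₀ hQ0 hs.le ((hlin _).trans ?_)) hρ.le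
      simp only [mul_pow, le_refl]
    have b3 : ∫ ω, (∑ j ∈ T, γ j * (e j ω ^ 2 - q j)) ^ 2 / (s * ∑ j ∈ T, γ j ^ 2) / ρ ∂P
        ≤ K / s / ρ := by
      rw [integral_div, integral_div]
      refine div_le_div_of_nonneg_right (div_le_of_le_mul₀ (mul_nonneg hs.le hg0) (by positivity)
        ((hquad γ hγ).2.trans (le_of_eq ?_))) hρ.le
      field_simp
    refine ⟨a1.add ((a2.add a3).const_mul _), ?_⟩
    have b0 : 0 ≤ s / ρ + K / s / ρ := by positivity
    simp only [hW]
    have comb : ∀ f g k : Ω → ℝ, Integrable f P → Integrable g P → Integrable k P →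
        ∫ ω, (f ω + (1 - ρ) * (g ω + k ω)) ∂P
          = (∫ ω, f ω ∂P) + (1 - ρ) * ((∫ ω, g ω ∂P) + ∫ ω, k ω ∂P) := fun f g k hf hg hk => by
      have hgk : Integrable (fun ω => g ω + k ω) P := hg.add hk
      rw [integral_add hf (hgk.const_mul _), integral_const_mul, integral_add hg hk]
    rw [comb _ _ _ a1 a2 a3]
    have := mul_le_mul_of_nonneg_left (add_le_add b2 b3) h1ρ
    have := mul_le_of_le_one_left b0 (by linarith : 1 - ρ ≤ 1)
    linarith
  have hB : ∀ j, Integrable (fun ω => γ₀ j * (e j ω ^ 2 - q j)) P := fun j =>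
    ((he j).integrable_sq.sub (integrable_const _)).const_mul _
  have hBint : Integrable (fun ω => ∑ j ∈ T, γ₀ j * (e j ω ^ 2 - q j)) P :=
    integrable_finsetSum _ fun j _ => hB j
  have hB0 : ∫ ω, ∑ j ∈ T, γ₀ j * (e j ω ^ 2 - q j) ∂P = 0 := by
    rw [integral_finsetSum _ fun j _ => hB j]
    refine Finset.sum_eq_zero fun j _ => ?_
    rw [integral_const_mul, integral_sub (he j).integrable_sq (integrable_const _), he2]
    simp
  obtain ⟨hl1, hl2⟩ := integral_loss (T := T) he he1 he2 θ γ₀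
  have hRi : Integrable R P := hl1.add (integrable_const _)
  have hRe : ∫ ω, R ω ∂P = (∑ j ∈ T, ((γ₀ j - 1) ^ 2 * θ j ^ 2 + γ₀ j ^ 2 * q j)) + τ := by
    simp only [hR]
    rw [integral_add hl1 (integrable_const _), hl2]; simp
  -- The penalty is essentially the variance part ∑γ₀²q of the risk, the difference being at most
  -- the deficit. It turns 1 + ρ into 1 + 2ρ - ρ² and 2D into (2 + ρ)D, before the factor 1 - ρ.
  have hpen : s * ∑ j ∈ T, γ₀ j ^ 2 ≤ (∫ ω, R ω ∂P) + D := by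
    rw [hRe, Finset.mul_sum]
    have : ∑ j ∈ T, s * γ₀ j ^ 2 ≤ ∑ j ∈ T, (((γ₀ j - 1) ^ 2 * θ j ^ 2 + γ₀ j ^ 2 * q j)
        + (s - q j)) := Finset.sum_le_sum fun j _ => by
      have h1 := (hΓ γ₀ hγ₀).1 j
      have h2 : γ₀ j ^ 2 ≤ 1 := pow_le_one₀ h1.1 h1.2
      have h3 := mul_le_mul_of_nonneg_right h2 (sub_nonneg.2 (hq j))
      have h4 : 0 ≤ (γ₀ j - 1) ^ 2 * θ j ^ 2 := by positivity
      linarith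
    rw [Finset.sum_add_distrib] at this
    linarith
  set F : Ω → ℝ := fun ω => (1 + ρ) * R ω + (∑ γ ∈ Γ, W γ ω)
    + (1 - ρ) * (2 * D - 2 * (∑ j ∈ T, γ₀ j * (e j ω ^ 2 - q j)) + (2 + ρ) * μ * |σ ω - s|
      + ρ * (s * ∑ j ∈ T, γ₀ j ^ 2)) with hF
  have c1 : Integrable (fun ω => (1 + ρ) * R ω) P := hRi.const_mul _
  have c2 : Integrable (fun ω => ∑ γ ∈ Γ, W γ ω) P :=
    integrable_finsetSum _ fun γ hγ => (hWint γ hγ).1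
  have c3 : Integrable (fun ω => 2 * D - 2 * (∑ j ∈ T, γ₀ j * (e j ω ^ 2 - q j))) P :=
    (integrable_const _).sub (hBint.const_mul _)
  have c4 : Integrable (fun ω => 2 * D - 2 * (∑ j ∈ T, γ₀ j * (e j ω ^ 2 - q j))
      + (2 + ρ) * μ * |σ ω - s|) P := c3.add (hσ.const_mul _)
  have c5 : Integrable (fun ω => 2 * D - 2 * (∑ j ∈ T, γ₀ j * (e j ω ^ 2 - q j))
      + (2 + ρ) * μ * |σ ω - s| + ρ * (s * ∑ j ∈ T, γ₀ j ^ 2)) P := c4.add (integrable_const _)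
  have c6 : Integrable (fun ω => (1 + ρ) * R ω + ∑ γ ∈ Γ, W γ ω) P := c1.add c2
  have hFi : Integrable F P := c6.add (c5.const_mul _)
  have hFe : ∫ ω, F ω ∂P ≤ (1 + ρ) * (∫ ω, R ω ∂P) + Γ.card * (s + (s / ρ + K / s / ρ))
      + (1 - ρ) * (2 * D + (2 + ρ) * μ * (∫ ω, |σ ω - s| ∂P)
        + ρ * (s * ∑ j ∈ T, γ₀ j ^ 2)) := by
    have hsum : ∫ ω, ∑ γ ∈ Γ, W γ ω ∂P ≤ Γ.card * (s + (s / ρ + K / s / ρ)) := by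
      rw [integral_finsetSum _ fun γ hγ => (hWint γ hγ).1]
      refine (Finset.sum_le_sum fun γ hγ => (hWint γ hγ).2).trans (le_of_eq ?_)
      rw [Finset.sum_const, nsmul_eq_mul]
    simp only [hF]
    rw [integral_add c6 (c5.const_mul _), integral_add c1 c2, integral_const_mul,
      integral_const_mul, integral_add c4 (integrable_const _), integral_add c3 (hσ.const_mul _),
      integral_sub (integrable_const _) (hBint.const_mul _), integral_const_mul,
      integral_const_mul, hB0]
    simp only [integral_const, probReal_univ, one_smul, mul_zero, sub_zero, integral_const_mul]
    linarith
  have hpt : ∀ᵐ ω ∂P, (1 - 3 * ρ) * ((∑ j ∈ T, (γ ω j * (θ j + e j ω) - θ j) ^ 2) + τ) ≤ F ω := by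
    filter_upwards [hJ] with ω hω
    have h := oracle_pathwise T θ (fun j => e j ω) q (γ ω) γ₀ hs hρ hρ' hτ (hΓ _ (hγ ω)).1
      (hΓ _ hγ₀).1 hq hD (hΓ _ (hγ ω)).2 (hΓ _ hγ₀).2 hω
    -- The selected weight depends on the noise; domination by the sum over Γ removes this
    -- dependence at the price of the factor card Γ.
    have h2 : W (γ ω) ω ≤ ∑ γ ∈ Γ, W γ ω :=
      Finset.single_le_sum (f := fun γ => W γ ω) (fun γ _ => hW0 γ ω) (hγ ω)
    simp only [hF, hR]
    linarith
  have h3ρ : 0 < 1 - 3 * ρ := by linarith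
  calc ∫⁻ ω, ENNReal.ofReal ((∑ j ∈ T, (γ ω j * (θ j + e j ω) - θ j) ^ 2) + τ) ∂P
      ≤ ∫⁻ ω, ENNReal.ofReal (F ω / (1 - 3 * ρ)) ∂P := by
        refine lintegral_mono_ae ?_
        filter_upwards [hpt] with ω hω
        refine ENNReal.ofReal_le_ofReal ?_
        rw [le_div_iff₀ h3ρ]; linarith
    _ = ENNReal.ofReal (∫ ω, F ω / (1 - 3 * ρ) ∂P) := by
        rw [ofReal_integral_eq_lintegral_ofReal (hFi.div_const _)]
        filter_upwards [hpt] with ω hω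
        have h0 : 0 ≤ F ω := le_trans (by positivity) hω
        exact div_nonneg h0 h3ρ.le
    _ ≤ _ := by
        refine ENNReal.ofReal_le_ofReal ?_
        rw [integral_div]
        refine div_le_div_of_nonneg_right (hFe.trans ?_) h3ρ.le
        have := mul_le_mul_of_nonneg_left hpen (mul_nonneg h1ρ hρ.le)
        linarith

end Expectation

/-! ### Comparison of the constants -/

section Constants

variable {amax rmin rmax a lam r₁ r₂ m₄ ρ : ℝ}

/-- Expand both sides: the difference is a combination of nonnegative monomials. The two terms kept
match the Gaussian and the jump part of the variance bound. -/
lemma le_Mstar (hlam : 0 ≤ lam) :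
    91 * rhoStar lam r₁ r₂ ^ 2 + 21 * (lam * r₂ ^ 4 * m₄) ≤ Mstar lam r₁ r₂ m₄ := by
  have h1 : 0 ≤ lam * (r₁ ^ 2 * r₂ ^ 2) := by positivity
  have h2 : 0 ≤ lam * r₂ ^ 2 := by positivity
  have h3 : 0 ≤ r₁ ^ 4 := by positivity
  have h4 : 0 ≤ r₁ ^ 2 := by positivity
  have e : Mstar lam r₁ r₂ m₄ - (91 * rhoStar lam r₁ r₂ ^ 2 + 21 * (lam * r₂ ^ 4 * m₄))
      = 4 * r₁ ^ 2 + 313 * r₁ ^ 4 + 274 * (lam * (r₁ ^ 2 * r₂ ^ 2)) + 356 * (lam * r₂ ^ 2) := by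
    simp only [Mstar, D2star, D1star, lambda2, rhoStar]; ring
  linarith

/-- The constant `Ψ` dominates the remainder terms. -/
lemma remainder_le_Psi (hlam : 0 ≤ lam) (hrmin : 0 < rmin) (hamax : 0 < amax)
    (ha : -amax ≤ a) (ha0 : a ≤ 0) (hmin : rmin ≤ rhoStar lam r₁ r₂)
    (hmax : rhoStar lam r₁ r₂ ≤ rmax) (hm : 1 ≤ m₄) (hρ : 0 < ρ) (hρ' : ρ < 1 / 3) (ν : ℕ) :
    (ν * (rhoStar lam r₁ r₂ + (rhoStar lam r₁ r₂ / ρ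
        + (2 * rhoStar lam r₁ r₂ ^ 2 + 64 * ((m₄ + 3) * lam * r₂ ^ 4)) / rhoStar lam r₁ r₂ / ρ))
      + (1 - ρ) * (2 + ρ) * (rhoStar lam r₁ r₂ * (1 + 4 * (a ^ 2 - a)))) / (1 - 3 * ρ)
    ≤ Psi amax rmin rmax ν (Mstar lam r₁ r₂ m₄) ρ := by
  have hM := le_Mstar (r₁ := r₁) (r₂ := r₂) (m₄ := m₄) hlam
  set s := rhoStar lam r₁ r₂
  set M := Mstar lam r₁ r₂ m₄
  have hs : 0 < s := hrmin.trans_le hmin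
  have hr : 0 < rmax := hs.trans_le hmax
  have h3ρ : 0 < 1 - 3 * ρ := by linarith
  have hp : 0 ≤ lam * r₂ ^ 4 := by positivity
  have hL0 : 0 ≤ L1star amax rmax := by unfold L1star; positivity
  -- Over the common denominator sρ the numerator is at most 56M, by m₄ + 3 ≤ 4m₄ and ρ < 1/3; then
  -- s is bounded below by rmin.
  have h1 : s + (s / ρ + (2 * s ^ 2 + 64 * ((m₄ + 3) * lam * r₂ ^ 4)) / s / ρ)
      ≤ 56 * M / (rmin * ρ) := by
    have e : s + (s / ρ + (2 * s ^ 2 + 64 * ((m₄ + 3) * lam * r₂ ^ 4)) / s / ρ)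
        = (ρ * s ^ 2 + 3 * s ^ 2 + 64 * ((m₄ + 3) * (lam * r₂ ^ 4))) / (s * ρ) := by
      field_simp; ring
    have hm' := mul_le_mul_of_nonneg_right hm hp
    have hρs := mul_le_mul_of_nonneg_right hρ'.le (sq_nonneg s)
    have hs2 := sq_nonneg s
    have hle : ρ * s ^ 2 + 3 * s ^ 2 + 64 * ((m₄ + 3) * (lam * r₂ ^ 4)) ≤ 56 * M := by linarith
    rw [e]
    have h0 : 0 ≤ ρ * s ^ 2 + 3 * s ^ 2 + 64 * ((m₄ + 3) * (lam * r₂ ^ 4)) := by positivity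
    exact div_le_div₀ (h0.trans hle) hle (by positivity)
      (mul_le_mul_of_nonneg_right hmin hρ.le)
  have h2 : (1 - ρ) * (2 + ρ) * (s * (1 + 4 * (a ^ 2 - a)))
      ≤ 4 * rmax * L1star amax rmax / (rmin * ρ) := by
    have b1 : (1 - ρ) * (2 + ρ) ≤ 2 := by nlinarith
    have b2 : a ^ 2 - a ≤ amax * (amax + 1) := by nlinarith
    have b3 : 0 ≤ a ^ 2 - a := by nlinarith
    have b4 : s * (1 + 4 * (a ^ 2 - a)) ≤ rmax * (4 * (1 + amax * (amax + 1))) :=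
      mul_le_mul hmax (by linarith) (by positivity) hr.le
    have b5 : (1 - ρ) * (2 + ρ) * (s * (1 + 4 * (a ^ 2 - a))) ≤ 4 * L1star amax rmax := by
      have := mul_le_mul b1 b4 (by positivity) zero_le_two
      unfold L1star; linarith
    refine b5.trans ?_
    rw [le_div_iff₀ (by positivity)]
    have b6 : rmin * ρ ≤ rmax := by nlinarith
    have := mul_le_mul_of_nonneg_left b6 hL0
    linarith
  rw [div_le_iff₀ h3ρ]
  have e : Psi amax rmin rmax ν M ρ * (1 - 3 * ρ) = 6 * rmax * ν / (rmin * ρ)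
      + 4 * rmax * L1star amax rmax / (rmin * ρ) + ν * (56 * M / (rmin * ρ)) := by
    have : 1 - ρ * 3 ≠ 0 := by linarith
    unfold Psi; field_simp
  rw [e]
  have := mul_le_mul_of_nonneg_left h1 (Nat.cast_nonneg ν : (0 : ℝ) ≤ ν)
  have : 0 ≤ 6 * rmax * ν / (rmin * ρ) := by positivity
  linarith

end Constants

/-! ### Supports of the weights -/

section Weights

variable {Γ : Finset (ℕ+ → ℝ)} {n : ℕ}

lemma numNonzero_le_maxNonzero (hΓ : ∀ γ ∈ Γ, IsWeight n γ) {γ : ℕ+ → ℝ} (hγ : γ ∈ Γ) :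
    numNonzero γ ≤ maxNonzero Γ := by
  have h : Γ.sup numNonzero ≤ n := Finset.sup_le fun γ hγ => (hΓ γ hγ).2.2
  rw [maxNonzero, ENat.natCast_toNat (h.trans_lt (ENat.natCast_lt_top n)).ne]
  exact Finset.le_sup hγ

lemma maxNonzero_pos (hΓ : ∀ γ ∈ Γ, IsWeight n γ) (hne : Γ.Nonempty) : 0 < maxNonzero Γ := by
  obtain ⟨γ, hγ⟩ := hne
  have := (hΓ γ hγ).2.1.trans_le (numNonzero_le_maxNonzero hΓ hγ)
  exact_mod_cast this

lemma exists_common_support (hΓ : ∀ γ ∈ Γ, IsWeight n γ) :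
    ∃ T : Finset ℕ+, ∀ γ ∈ Γ, ∀ j ∉ T, γ j = 0 := by
  classical
  have : ∀ γ, ∃ T : Finset ℕ+, γ ∈ Γ → ∀ j ∉ T, γ j = 0 := fun γ => by
    by_cases h : γ ∈ Γ
    · obtain ⟨T, -, -, hT⟩ := exists_support_of_numNonzero_le (hΓ γ h).2.2
      exact ⟨T, fun _ => hT⟩
    · exact ⟨∅, fun h' => absurd h' h⟩
  choose T hT using this
  exact ⟨Γ.biUnion T, fun γ hγ j hj =>
    hT γ hγ j fun h => hj (Finset.mem_biUnion.2 ⟨γ, hγ, h⟩)⟩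

/-- A sum against a sequence of weights may be taken over the indices of its nonzero terms. -/
lemma sum_eq_sum_of_support {T T' : Finset ℕ+} {γ : ℕ+ → ℝ} (hT : ∀ j ∉ T, γ j = 0)
    (hT' : ∀ j ∉ T', γ j = 0) (f : ℕ+ → ℝ → ℝ) (hf : ∀ j, f j 0 = 0) :
    ∑ j ∈ T, f j (γ j) = ∑ j ∈ T', f j (γ j) := by
  have h1 : ∑' j, f j (γ j) = ∑ j ∈ T, f j (γ j) := tsum_eq_sum fun j hj => by rw [hT j hj, hf]
  have h2 : ∑' j, f j (γ j) = ∑ j ∈ T', f j (γ j) := tsum_eq_sum fun j hj => by rw [hT' j hj, hf]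
  exact h1.symm.trans h2

lemma sum_weights_le (hΓ : ∀ γ ∈ Γ, IsWeight n γ) {γ : ℕ+ → ℝ} (hγ : γ ∈ Γ) {T : Finset ℕ+}
    (hT : ∀ j ∉ T, γ j = 0) : ∑ j ∈ T, γ j ≤ maxNonzero Γ := by
  obtain ⟨T', -, hc, hT'⟩ := exists_support_of_numNonzero_le (numNonzero_le_maxNonzero hΓ hγ)
  rw [sum_eq_sum_of_support hT hT' (fun _ x => x) fun _ => rfl]
  have h1 : (T'.card : ℕ∞) ≤ maxNonzero Γ := hc.trans_le (numNonzero_le_maxNonzero hΓ hγ)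
  calc ∑ j ∈ T', γ j ≤ ∑ j ∈ T', 1 := Finset.sum_le_sum fun j _ => ((hΓ γ hγ).1 j).2
    _ = T'.card := by simp
    _ ≤ maxNonzero Γ := by exact_mod_cast h1

lemma cost_eq_sum {ρ σ : ℝ} {y : ℝ≥0 → ℝ} {γ : ℕ+ → ℝ} {T : Finset ℕ+} (hT : ∀ j ∉ T, γ j = 0) :
    cost n ρ y σ γ = (∑ j ∈ T, γ j ^ 2 * thetaHat n y j ^ 2)
      - 2 * (∑ j ∈ T, γ j * (thetaHat n y j ^ 2 - σ / n)) + ρ * (σ / n * ∑ j ∈ T, γ j ^ 2) := by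
  rw [cost, tsum_eq_sum (s := T) fun j hj => by simp [hT j hj],
    tsum_eq_sum (s := T) fun j hj => by simp [hT j hj],
    tsum_eq_sum (s := T) fun j hj => by simp [hT j hj]]
  ring

end Weights

/-! ### The oracle inequality for the regression model -/

section Oracle

variable {Ω : Type*} [MeasurableSpace Ω] {P : Measure Ω} [IsProbabilityMeasure P]
  {lam : ℝ≥0} {r₁ r₂ a : ℝ} {w : ℝ≥0 → Ω → ℝ} {N : ℝ≥0 → Ω → ℕ} {Y : ℕ → Ω → ℝ}
  {ξ : ℝ≥0 → Ω → ℝ} {S : ℝ → ℝ}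

lemma IsOUNoise.observationSigma_le (h : IsOUNoise P a lam r₁ r₂ w N Y ξ) (n : ℕ) :
    observationSigma (observed S ξ) n ≤ ‹MeasurableSpace Ω› :=
  iSup_le fun t => Measurable.comap_le ((h.measurable t).const_add _)

/-- The oracle inequality against a given member of the family of weights. -/
theorem IsOUNoise.oracle (h : IsOUNoise P a lam r₁ r₂ w N Y ξ) (ha : a ≤ 0)
    (hs : 0 < rhoStar lam r₁ r₂) (hper : Function.Periodic S 1)
    (hS : MemLp S 2 (volume.restrict (Set.Icc (0 : ℝ) 1))) {n : ℕ} (hn : 0 < n) {ρ : ℝ}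
    (hρ : 0 < ρ) (hρ' : ρ < 1 / 3) {Γ : Finset (ℕ+ → ℝ)} (hΓ : ∀ γ ∈ Γ, IsWeight n γ)
    {sigmaHat : Ω → ℝ} (hσ : Integrable (fun ω => |sigmaHat ω - rhoStar lam r₁ r₂|) P)
    {gammaHat : Ω → ℕ+ → ℝ}
    (hsel : IsModelSelection n ρ (observed S ξ) sigmaHat Γ gammaHat)
    {γ₀ : ℕ+ → ℝ} (hγ₀ : γ₀ ∈ Γ) :
    ∃ R : ℝ, 0 ≤ R ∧ risk P (fun ω => weightedLSE n (fun t => observed S ξ t ω) γ₀) S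
        = ENNReal.ofReal R ∧
      risk P (fun ω => weightedLSE n (fun t => observed S ξ t ω) (gammaHat ω)) S
        ≤ ENNReal.ofReal (((1 + 2 * ρ - ρ ^ 2) * R + 1 / n *
            (Γ.card * (rhoStar lam r₁ r₂ + (rhoStar lam r₁ r₂ / ρ
              + (2 * rhoStar lam r₁ r₂ ^ 2 + 64 * jumpConst P lam r₂ Y) / rhoStar lam r₁ r₂ / ρ))
            + (1 - ρ) * (2 + ρ) * (rhoStar lam r₁ r₂ * (1 + 4 * (a ^ 2 - a))
              + maxNonzero Γ * ∫ ω, |sigmaHat ω - rhoStar lam r₁ r₂| ∂P))) / (1 - 3 * ρ)) := by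
  obtain ⟨T, hT⟩ := exists_common_support hΓ
  set s := rhoStar lam r₁ r₂ with hsdef
  set L := 2 * s ^ 2 + 64 * jumpConst P lam r₂ Y with hL
  have hκ := jumpConst_nonneg (P := P) (lam := lam) (r₂ := r₂) (Y := Y)
  have hn' : (0 : ℝ) < n := by exact_mod_cast hn
  have hsq : √(n : ℝ) ^ 2 = n := Real.sq_sqrt hn'.le
  set θ := fourierCoefficient S with hθ
  set e : ℕ+ → Ω → ℝ := fun j ω => xiCoeff n ξ j ω / √n with he
  -- The part of the signal outside the common support of the weights adds the same amount to every
  -- loss; it is nonnegative by Bessel's inequality.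
  set τ := (∫ x in Set.Icc (0 : ℝ) 1, S x ^ 2) - ∑ j ∈ T, fourierCoefficient S j ^ 2 with hτ
  have hτ0 : 0 ≤ τ := sub_nonneg.2 (sum_fourierCoefficient_sq_le hS T)
  have hth := h.thetaHat_observed hper hS hn
  have esq : ∀ j ω, e j ω ^ 2 = xiCoeff n ξ j ω ^ 2 / n := fun j ω => by
    simp only [he]; rw [div_pow, hsq]
  have hrisk : ∀ γ : Ω → ℕ+ → ℝ, (∀ ω, γ ω ∈ Γ) →
      risk P (fun ω => weightedLSE n (fun t => observed S ξ t ω) (γ ω)) S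
        = ∫⁻ ω, ENNReal.ofReal ((∑ j ∈ T, (γ ω j * (θ j + e j ω) - θ j) ^ 2) + τ) ∂P := by
    intro γ hγ
    refine lintegral_congr_ae ?_
    filter_upwards [hth] with ω hω
    rw [lintegral_weightedLSE_sub hS _ (hT _ (hγ ω))]
    simp_rw [hω]
    rfl
  have e2 : ∀ j, MemLp (e j) 2 P := fun j => by
    simp only [he, div_eq_inv_mul]
    exact (h.xiCoeff_mean hn j).1.const_mul _
  have em : ∀ j, ∫ ω, e j ω ∂P = 0 := fun j => by
    simp only [he]; rw [integral_div, (h.xiCoeff_mean hn j).2, zero_div]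
  have ev : ∀ j, ∫ ω, e j ω ^ 2 ∂P = s * filteredGram a n j j / n := fun j => by
    simp_rw [esq]; rw [integral_div, (h.xiCoeff_sq hn j).2]
  obtain ⟨hl1, hl2⟩ := integral_loss (T := T) e2 em ev θ γ₀
  have hRint : Integrable (fun ω => (∑ j ∈ T, (γ₀ j * (θ j + e j ω) - θ j) ^ 2) + τ) P :=
    hl1.add (integrable_const _)
  have hRnn : ∀ ω, 0 ≤ (∑ j ∈ T, (γ₀ j * (θ j + e j ω) - θ j) ^ 2) + τ := fun ω =>
    add_nonneg (Finset.sum_nonneg fun j _ => sq_nonneg _) hτ0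
  refine ⟨∫ ω, ((∑ j ∈ T, (γ₀ j * (θ j + e j ω) - θ j) ^ 2) + τ) ∂P,
    integral_nonneg hRnn, ?_, ?_⟩
  · rw [hrisk (fun _ => γ₀) fun _ => hγ₀,
      ofReal_integral_eq_lintegral_ofReal hRint (Eventually.of_forall hRnn)]
  have hσ' : Integrable (fun ω => |sigmaHat ω / n - s / n|) P := by
    have : ∀ ω, |sigmaHat ω / n - s / n| = |sigmaHat ω - s| / n := fun ω => by
      rw [← sub_div, abs_div, abs_of_pos hn']
    simp_rw [this]; exact hσ.div_const _
  have hσe : ∫ ω, |sigmaHat ω / n - s / n| ∂P = (∫ ω, |sigmaHat ω - s| ∂P) / n := by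
    have : ∀ ω, |sigmaHat ω / n - s / n| = |sigmaHat ω - s| / n := fun ω => by
      rw [← sub_div, abs_div, abs_of_pos hn']
    simp_rw [this]; rw [integral_div]
  -- Scaling from ξ_{j,n} to e_j = ξ_{j,n}/√n divides the variances and the deficit by n, and the
  -- variance constant of the squares by n².
  have key := oracle_expectation (P := P) (T := T) (e := e) (θ := θ)
    (q := fun j => s * filteredGram a n j j / n) (s := s / n) (ρ := ρ) (μ := maxNonzero Γ)
    (D := s * (1 + 4 * (a ^ 2 - a)) / n) (τ := τ) (K := L / n ^ 2) (Γ := Γ)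
    (σ := fun ω => sigmaHat ω / n) (γ₀ := γ₀) (γ := gammaHat) (by positivity) hρ hρ' hτ0
    (by positivity) e2 em ev
    (fun j => div_le_div_of_nonneg_right
      (mul_le_of_le_one_right hs.le (filteredGram_self_le ha hn j)) hn'.le) ?_ ?_
    (fun γ hγ => ⟨(hΓ γ hγ).1, sum_weights_le hΓ hγ (hT γ hγ)⟩) ?_ hσ' hγ₀ hsel.mem ?_
  · rw [hrisk _ hsel.mem]
    refine key.trans (ENNReal.ofReal_le_ofReal (le_of_eq ?_))
    have e0 : L / n ^ 2 / (s / n) = L / s / n := by field_simp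
    rw [hσe, e0]
    congr 1
    ring
  · have := mul_le_mul_of_nonneg_left (sum_one_sub_filteredGram_le ha hn T) hs.le
    rw [Finset.mul_sum] at this
    simp_rw [← sub_div]
    rw [← Finset.sum_div]
    refine div_le_div_of_nonneg_right (le_trans (le_of_eq ?_) this) hn'.le
    exact Finset.sum_congr rfl fun j _ => by ring
  · intro c
    have := (h.integral_sum_xiCoeff_sq_le ha hn T c).2
    have e3 : ∀ ω, (∑ j ∈ T, c j * e j ω) ^ 2 = (∑ j ∈ T, c j * xiCoeff n ξ j ω) ^ 2 / n := by
      intro ω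
      simp only [he, ← mul_div_assoc]
      rw [← Finset.sum_div, div_pow, hsq]
    simp_rw [e3]
    rw [integral_div, div_mul_eq_mul_div]
    exact div_le_div_of_nonneg_right this hn'.le
  · intro γ hγ
    -- The common support T may have more than n elements, so the variance bound is applied on the
    -- support of γ itself.
    obtain ⟨T', hc, -, hT'⟩ := exists_support_of_numNonzero_le (hΓ γ hγ).2.2
    obtain ⟨g1, g2⟩ := h.integral_sum_xiCoeff_sq_sub_le ha hn T' hc γ
    have e4 : ∀ ω, (∑ j ∈ T, γ j * (e j ω ^ 2 - s * filteredGram a n j j / n)) ^ 2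
        = (∑ j ∈ T', γ j * (xiCoeff n ξ j ω ^ 2 - ∫ ω', xiCoeff n ξ j ω' ^ 2 ∂P)) ^ 2 / n ^ 2 := by
      intro ω
      rw [sum_eq_sum_of_support (hT γ hγ) hT'
        (fun j x => x * (e j ω ^ 2 - s * filteredGram a n j j / n)) fun _ => zero_mul _, ← div_pow,
        Finset.sum_div]
      congr 1
      refine Finset.sum_congr rfl fun j _ => ?_
      rw [esq, (h.xiCoeff_sq hn j).2]
      ring
    simp_rw [e4]
    refine ⟨g1.div_const _, ?_⟩
    rw [integral_div, div_mul_eq_mul_div,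
      sum_eq_sum_of_support (hT γ hγ) hT' (fun _ x => x ^ 2) fun _ => by simp]
    exact div_le_div_of_nonneg_right g2 (by positivity)
  · filter_upwards [hth] with ω hω
    have := hsel.minimizes ω γ₀ hγ₀
    rw [cost_eq_sum (hT _ (hsel.mem ω)), cost_eq_sum (hT _ hγ₀)] at this
    simp_rw [hω] at this
    exact this

end Oracle

end OURegression

/-! ### Conclusion -/

theorem mainTheorem3
    -- the bounds that define the parameter region
    (amax lammax rmin rmax : ℝ) (hamax : 0 < amax) (hlammax : 0 < lammax)
    (hrmin : 0 < rmin) (hrmax : 0 < rmax)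
    -- the noise: an Ornstein–Uhlenbeck process with parameters in the region
    (a : ℝ) (lam : ℝ≥0) (r₁ r₂ : ℝ)
    (ha : -amax ≤ a) (ha0 : a ≤ 0) (hlam : (lam : ℝ) ≤ lammax)
    (hmin : rmin ≤ OURegression.rhoStar lam r₁ r₂) (hmax : OURegression.rhoStar lam r₁ r₂ ≤ rmax)
    {Ω : Type*} [MeasurableSpace Ω] (P : Measure Ω) [IsProbabilityMeasure P]
    (w : ℝ≥0 → Ω → ℝ) (N : ℝ≥0 → Ω → ℕ) (Y : ℕ → Ω → ℝ) (ξ : ℝ≥0 → Ω → ℝ)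
    (hξ : OURegression.IsOUNoise P a lam r₁ r₂ w N Y ξ)
    -- conditions C1 (with the constant `ϱ*`) and C2 hold
    : OURegression.ConditionC1 P ξ (OURegression.rhoStar lam r₁ r₂) ∧
      OURegression.ConditionC2 P ξ ∧
      -- and the model selection procedure satisfies the sharp oracle inequality
      ∀ (S : ℝ → ℝ), Function.Periodic S 1 → MemLp S 2 (volume.restrict (Set.Icc (0 : ℝ) 1)) →
      ∀ (n : ℕ), 1 ≤ n → ∀ (ρ : ℝ), 0 < ρ → ρ < 1 / 3 →
      ∀ (Γ : Finset (ℕ+ → ℝ)), (∀ γ ∈ Γ, OURegression.IsWeight n γ) →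
      ∀ (sigmaHat : Ω → ℝ),
        Measurable[OURegression.observationSigma (OURegression.observed S ξ) n] sigmaHat →
      ∀ (gammaHat : Ω → ℕ+ → ℝ),
        OURegression.IsModelSelection n ρ (OURegression.observed S ξ) sigmaHat Γ gammaHat →
        OURegression.risk P
            (fun ω => OURegression.weightedLSE n (fun t => OURegression.observed S ξ t ω)
              (gammaHat ω)) S
          ≤ ENNReal.ofReal ((1 + 3 * ρ - 2 * ρ ^ 2) / (1 - 3 * ρ)) *
              (⨅ γ ∈ Γ, OURegression.risk P
                (fun ω => OURegression.weightedLSE n (fun t => OURegression.observed S ξ t ω) γ) S)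
            + (1 / (n : ℝ≥0∞)) *
              OURegression.remainderB P
                (OURegression.Psi amax rmin rmax Γ.card
                  (OURegression.Mstar lam r₁ r₂ (∫ ω, Y 0 ω ^ 4 ∂P)) ρ)
                (OURegression.maxNonzero Γ) sigmaHat (OURegression.rhoStar lam r₁ r₂) ρ := by
  have hs : 0 < OURegression.rhoStar lam r₁ r₂ := hrmin.trans_le hmin
  refine ⟨hξ.conditionC1 ha0 hs, hξ.conditionC2 ha0, ?_⟩
  intro S hper hS n hn ρ hρ hρ' Γ hΓ sigmaHat hσ gammaHat hsel
  have h3ρ : 0 < 1 - 3 * ρ := by linarith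
  have hn' : (0 : ℝ) < n := by exact_mod_cast hn
  -- A probability space is nonempty and the selection takes its values in Γ.
  have hne : Γ.Nonempty := by
    obtain ⟨ω⟩ : Nonempty Ω := P.nonempty_of_neZero
    exact ⟨_, hsel.mem ω⟩
  have hμ := OURegression.maxNonzero_pos hΓ hne
  have hμ' : (0 : ℝ) < OURegression.maxNonzero Γ := by exact_mod_cast hμ
  have hσm : Measurable fun ω => |sigmaHat ω - OURegression.rhoStar lam r₁ r₂| :=
    continuous_abs.measurable.comp ((hσ.mono (hξ.observationSigma_le n) le_rfl).sub_const _)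
  by_cases hint : Integrable (fun ω => |sigmaHat ω - OURegression.rhoStar lam r₁ r₂|) P
  swap
  · -- the bound is infinite if the variance estimator is not integrable
    have htop : ∫⁻ ω, ENNReal.ofReal |sigmaHat ω - OURegression.rhoStar lam r₁ r₂| ∂P = ∞ := by
      by_contra hfin
      refine hint ⟨hσm.aestronglyMeasurable, ?_⟩
      rw [hasFiniteIntegral_iff_ofReal (Eventually.of_forall fun ω => abs_nonneg _)]
      exact lt_top_iff_ne_top.2 hfin
    have h0 : ENNReal.ofReal (6 * OURegression.maxNonzero Γ / (1 - 3 * ρ)) ≠ 0 :=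
      (ENNReal.ofReal_pos.2 (by positivity)).ne'
    have h1 : (1 / (n : ℝ≥0∞)) ≠ 0 := by simp
    rw [OURegression.remainderB, htop, ENNReal.mul_top h0, add_top, ENNReal.mul_top h1, add_top]
    exact le_top
  obtain ⟨γ₀, hγ₀, hmin₀⟩ := Finset.exists_min_image Γ (fun γ => OURegression.risk P
    (fun ω => OURegression.weightedLSE n (fun t => OURegression.observed S ξ t ω) γ) S) hne
  have hinf : (⨅ γ ∈ Γ, OURegression.risk P (fun ω => OURegression.weightedLSE n
      (fun t => OURegression.observed S ξ t ω) γ) S) = OURegression.risk P (fun ω =>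
      OURegression.weightedLSE n (fun t => OURegression.observed S ξ t ω) γ₀) S :=
    le_antisymm (iInf₂_le γ₀ hγ₀) (le_iInf₂ hmin₀)
  obtain ⟨R, hR0, hR, hle⟩ := hξ.oracle ha0 hs hper hS hn hρ hρ' hΓ hint hsel hγ₀
  have hpsi := OURegression.remainder_le_Psi (r₁ := r₁) (r₂ := r₂) lam.coe_nonneg hrmin hamax ha ha0
    hmin hmax hξ.jumps.one_le_fourth hρ hρ' Γ.card
  rw [hinf, hR]
  refine hle.trans ?_
  have hE0 : 0 ≤ ∫ ω, |sigmaHat ω - OURegression.rhoStar lam r₁ r₂| ∂P :=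
    integral_nonneg fun ω => abs_nonneg _
  rw [OURegression.remainderB,
    ← ofReal_integral_eq_lintegral_ofReal hint (Eventually.of_forall fun ω => abs_nonneg _)]
  rw [← OURegression.jumpConst] at hpsi
  set E := ∫ ω, |sigmaHat ω - OURegression.rhoStar lam r₁ r₂| ∂P
  set Ψ := OURegression.Psi amax rmin rmax Γ.card
    (OURegression.Mstar lam r₁ r₂ (∫ ω, Y 0 ω ^ 4 ∂P)) ρ
  set s := OURegression.rhoStar lam r₁ r₂
  set μ : ℝ := (OURegression.maxNonzero Γ : ℝ)
  have hκ := OURegression.jumpConst_nonneg (P := P) (lam := lam) (r₂ := r₂) (Y := Y)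
  have hn1 : (1 / (n : ℝ≥0∞)) = ENNReal.ofReal (1 / n) := by
    rw [ENNReal.ofReal_div_of_pos hn', ENNReal.ofReal_one, ENNReal.ofReal_natCast]
  have hΨ : 0 ≤ Ψ := by
    refine le_trans ?_ hpsi
    have : 0 ≤ a ^ 2 - a := by nlinarith
    have : 0 ≤ 1 - ρ := by linarith
    positivity
  have hc : 0 ≤ (1 + 3 * ρ - 2 * ρ ^ 2) / (1 - 3 * ρ) := div_nonneg (by nlinarith) h3ρ.le
  have h6 : 0 ≤ 6 * μ / (1 - 3 * ρ) := by positivity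
  rw [hn1, ← ENNReal.ofReal_mul hc, ← ENNReal.ofReal_mul h6,
    ← ENNReal.ofReal_add hΨ (by positivity), ← ENNReal.ofReal_mul (by positivity),
    ← ENNReal.ofReal_add (by positivity) (by positivity)]
  refine ENNReal.ofReal_le_ofReal ?_
  rw [add_div, mul_div_right_comm, mul_div_assoc (1 / (n : ℝ))]
  refine add_le_add (mul_le_mul_of_nonneg_right ?_ hR0)
    (mul_le_mul_of_nonneg_left ?_ (by positivity))
  -- The factor obtained is 1 + 2ρ - ρ², which is below the stated one because ρ - ρ² ≥ 0.
  · exact div_le_div_of_nonneg_right (by nlinarith) h3ρ.le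
  -- Separate the deterministic remainder, bounded by Ψ, from the error of the variance estimator,
  -- whose factor (1 - ρ)(2 + ρ) is at most 6.
  · rw [mul_add ((1 - ρ) * (2 + ρ)), ← add_assoc, add_div]
    refine add_le_add hpsi ?_
    rw [div_mul_eq_mul_div]
    refine div_le_div_of_nonneg_right ?_ h3ρ.le
    have : (1 - ρ) * (2 + ρ) ≤ 6 := by nlinarith
    have := mul_le_mul_of_nonneg_right this (mul_nonneg hμ'.le hE0)
    linarith
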